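/- **Conventions.** A spectral curve on $\mathbb{CP}^1$ is given by functions $x(z),y(z)$ with simple zeros of $\mathrm dx$, and $B(z,z')=\frac{\mathrm dz\,\mathrm dz'}{(z-z')^2}$. Its correlation differentials are defined by the topological recursion: $\omega_{0,1}=y\,\mathrm dx$, $\omega_{0,2}=B$ and, for $2g-2+n>0$, $n\ge 1$, $$\omega_{g,n}(z_1,z_S)=\sum_\alpha \mathop{\mathrm{Res}}_{p=\alpha}K_\alpha(z_1,p)\Big[\omega_{g-1,n+1}(p,\sigma_\alpha(p),z_S)+\sum_{\substack{g_1+g_2=g\\ I\sqcup J=S}}^{\circ}\omega_{g_1,|I|+1}(p,z_I)\,\omega_{g_2,|J|+1}(\sigma_\alpha(p),z_J)\Big],\qquad K_\alpha(z_1,p)=\frac12\,\frac{\int_p^{\sigma_\alpha(p)}B(z_1,\cdot)}{\omega_{0,1}(p)-\omega_{0,1}(\sigma_\alpha(p))},$$ where $S=\{2,\dots,n\}$, $\alpha$ runs over the zeros of $\mathrm dx$, $\sigma_\alpha$ is the local involution with $x\circ\sigma_\alpha=x$, and $\circ$ means that terms containing $\omega_{0,1}$ are omitted. For $q\in\mathbb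 C$, $|q|<1$, let $\zeta_q(2k)=\sum_{m\ge1}\frac{q^{mk}}{(1-q^m)^{2k}}$. Okuyama's discrete volumes $N^q_{g,n}(b_1,\dots,b_n)$ ($b_i\in\mathbb Z_{>0}$) are defined by the expansion at $z_i=0$ $$\omega_{g,n}=\sum_{b_1,\dots,b_n\ge1}N^q_{g,n}(b_1,\dots,b_n)\prod_{i=1}^n b_iz_i^{b_i-1}\,\mathrm dz_i$$ for the curve $x=z+z^{-1}$, $y=\frac12(z-z^{-1})\prod_{k\ge1}\frac{(1-q^kz^2)(1-q^kz^{-2})}{(1-q^k)^2}$; near $z=\pm1$ this $y$ equals $\frac12(z-z^{-1})\exp\big(-\sum_{k\ge1}\frac{\zeta_q(2k)}{k}(z-z^{-1})^{2k}\big)$. The curve $\mathcal S^{\mathrm{top}}$ is $$x=\tfrac12z^2,\qquad y=z\exp\Big(-\sum_{m\ge1}\frac{\zeta_q(2m)}{m}(4z^2)^m\Big),$$ and its correlation differentials are denoted $\omega^{\mathrm{top}}_{g,n}$. **Lemma.** Let $g\ge0$, $n\ge1$ with $2g-2+n>0$. (1) There are polynomials $P_\varepsilon\in\mathbb Q[Z_1,Z_2,\dots][b_1,\dots,b_n]$,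 one for each parity class $\varepsilon\in(\mathbb Z/2)^n$, of degree at most $6g-6+2n$ for the grading $\deg b_i=1$, $\deg Z_k=2k$, such that $N^q_{g,n}(b)=P_{b\bmod 2}(Z,b)$ with $Z_k=\zeta_q(2k)$, for all $q$ with $|q|<1$ and all $b$; and such that the same formula gives the expansion coefficients for the curve $x=z+z^{-1}$, $y=\frac12(z-z^{-1})\exp\big(-\sum_{k\ge1}\frac{Z_k}{k}(z-z^{-1})^{2k}\big)$, for every complex sequence $(Z_k)$ of at most exponential growth (this determines the $P_\varepsilon$, so that their degree and top degree part are well defined). (2) $P_\varepsilon=0$ if $\sum_i\varepsilon_i$ is odd, and the degree $6g-6+2n$ part of $P_\varepsilon$ is one and the same polynomial for all $\varepsilon$ with $\sum_i\varepsilon_i$ even. Let $N^{q,\mathrm{top}}_{g,n}(b_1,\dots,b_n)$ be this polynomial at $Z_k=\zeta_q(2k)$. (3) For every $q$ with $|q|<1$, the topological recursion on $\mathcal S^{\mathrm{top}}$ produces $$\omega^{\mathrm{top}}_{g,n}(z_1,\dots,z_n)=(-1)^n\,2^{2g-3+n}\,\frac{\partial}{\partial z_1}\cdots\frac{\partial}{\partial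 z_n}\mathcal L\{N^{q,\mathrm{top}}_{g,n}\}(z_1,\dots,z_n)\,\mathrm dz_1\cdots\mathrm dz_n$$ for all $z_i\ne0$. Here $\mathcal L\{P\}(z)=\int_0^\infty\!\cdots\!\int_0^\infty P(x)\prod_i e^{-z_ix_i}\,\mathrm dx_1\cdots\mathrm dx_n$ for $\mathrm{Re}\,z_i>0$, extended to all $z_i\neq 0$ as a polynomial in the $z_i^{-1}$. -/

import Mathlib

open Filter Topology MeasureTheory

noncomputable section

namespace TopRec

/-! ### Rational spectral curves and the topological recursion

Multidifferentials on (products of) the Riemann sphere are written in the affine coordinate `z`,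
`ω = w(z₁, …, zₙ) dz₁ ⋯ dzₙ`, and represented by their coefficient function `w`. -/

/-- A spectral curve on the Riemann sphere with affine coordinate `z` and
`B(z, z') = dz dz' / (z - z')²`, whose branch points (zeros of `dx`) are all simple and lie in the
affine part. `branch` is the set of zeros of `dx`, and `σ α` is the non-trivial holomorphic
involution near `α` with `x ∘ σ α = x`. Only the germs of `y` at the branch points enter the
recursion, so `y` need not be rational. -/
structure SpectralCurve where
  x : ℂ → ℂ
  y : ℂ → ℂ
  branch : Finset ℂ
  σ : ℂ → ℂ → ℂ
  mem_branch_iff : ∀ p, p ∈ branch ↔ AnalyticAt ℂ x p ∧ deriv x p = 0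
  simple : ∀ α ∈ branch, deriv (deriv x) α ≠ 0
  σ_analytic : ∀ α ∈ branch, AnalyticAt ℂ (σ α) α
  σ_fix : ∀ α ∈ branch, σ α α = α
  σ_deriv : ∀ α ∈ branch, deriv (σ α) α = -1
  σ_x : ∀ α ∈ branch, ∀ᶠ p in 𝓝 α, x (σ α p) = x p

/-- The residue at `α` of `f(z) dz`, for `f` holomorphic in a punctured neighbourhood of `α`
(the integral over a small circle does not depend on its radius). -/
def residue (f : ℂ → ℂ) (α : ℂ) : ℂ :=
  limUnder (𝓝[>] (0 : ℝ)) fun r =>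
    (2 * (Real.pi : ℂ) * Complex.I)⁻¹ * ∮ z in C(α, r), f z

/-- The recursion kernel
`K_α(p₁, p) = ½ (∫_p^{σ_α(p)} B(p₁, ·)) / (ω_{0,1}(p) - ω_{0,1}(σ_α(p)))`, with `ω_{0,1} = y dx`.
The integral is evaluated with the primitive `p' ↦ 1 / (p₁ - p')` of `1 / (p₁ - p')²`, and
`ω_{0,1}(σ_α(p))` is the pullback of `y dx` under `σ_α`. -/
def SpectralCurve.kernel (C : SpectralCurve) (α p₁ p : ℂ) : ℂ :=
  (1 / 2) * (1 / (p₁ - C.σ α p) - 1 / (p₁ - p)) /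
    (C.y p * deriv C.x p - C.y (C.σ α p) * deriv C.x (C.σ α p) * deriv (C.σ α) p)

/-- The points `z_i`, `i ∈ I`, listed in increasing order of the index. -/
def pick {m : ℕ} (z : Fin m → ℂ) (I : Finset (Fin m)) : Fin I.card → ℂ :=
  fun i => z (I.orderEmbOfFin rfl i)

/-- `C.corr g m p₁ (z₁, …, z_m)` is the coefficient of `ω_{g, m + 1}(p₁, z₁, …, z_m)`.
The factors `deriv (C.σ α) p` come from pulling back along `σ_α`. The sum over `h` and `I` is the
sum over `g₁ + g₂ = g` and `I ⊔ J = S`, without the terms that involve `ω_{0,1}`. -/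
def SpectralCurve.corr (C : SpectralCurve) (g m : ℕ) (p₁ : ℂ) (z : Fin m → ℂ) : ℂ :=
  if g = 0 ∧ m = 0 then C.y p₁ * deriv C.x p₁
  else if h01 : g = 0 ∧ m = 1 then 1 / (p₁ - z ⟨0, by omega⟩) ^ 2
  else
    ∑ α ∈ C.branch, residue (fun p =>
      C.kernel α p₁ p *
        ((if hg : 0 < g then
            SpectralCurve.corr C (g - 1) (m + 1) p (Fin.cons (C.σ α p) z) * deriv (C.σ α) p
          else 0) +
        ∑ h : Fin (g + 1), ∑ I : Finset (Fin m),
          if hI : ¬ ((h : ℕ) = 0 ∧ I.card = 0) ∧ ¬ (g - (h : ℕ) = 0 ∧ Iᶜ.card = 0) then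
            SpectralCurve.corr C h I.card p (pick z I) *
              (SpectralCurve.corr C (g - h) Iᶜ.card (C.σ α p) (pick z Iᶜ) * deriv (C.σ α) p)
          else 0)) α
termination_by 2 * g + m
decreasing_by
  · omega
  · have h1 := I.card_add_card_compl
    have h2 := h.isLt
    simp only [Fintype.card_fin] at h1
    omega
  · have h1 := I.card_add_card_compl
    have h2 := h.isLt
    simp only [Fintype.card_fin] at h1
    omega

/-- The coefficient function of the correlation differential `ω_{g,n}(z₁, …, zₙ)`, `n ≥ 1`. -/
def SpectralCurve.omega (C : SpectralCurve) (g : ℕ) : (n : ℕ) → (Fin n → ℂ) → ℂ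
  | 0, _ => 0
  | m + 1, z => C.corr g m (z 0) (Fin.tail z)

/-! ### The spectral curves -/

lemma deriv_add_inv {p : ℂ} (hp : p ≠ 0) :
    deriv (fun z : ℂ => z + z⁻¹) p = 1 - (p ^ 2)⁻¹ := by
  have h := (hasDerivAt_id p).add (hasDerivAt_inv hp)
  have h2 : HasDerivAt (fun z : ℂ => z + z⁻¹) (1 - (p ^ 2)⁻¹) p := by
    rw [sub_eq_add_neg]; exact h
  exact h2.deriv

lemma not_analyticAt_add_inv : ¬ AnalyticAt ℂ (fun z : ℂ => z + z⁻¹) 0 := by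
  intro h
  have h1 : AnalyticAt ℂ (fun z : ℂ => (z + z⁻¹) - z) 0 := h.sub analyticAt_id
  have h2 : Tendsto (fun z : ℂ => z⁻¹) (𝓝[≠] 0) (𝓝 ((0 : ℂ)⁻¹)) := by
    have := h1.continuousAt.tendsto
    simp only [add_sub_cancel_left] at this
    exact this.mono_left nhdsWithin_le_nhds
  have h3 : Tendsto (fun z : ℂ => z⁻¹) (𝓝[≠] 0) (Bornology.cobounded ℂ) :=
    tendsto_inv₀_nhdsNE_zero
  exact (not_tendsto_nhds_of_tendsto_atTop
    (tendsto_norm_cobounded_atTop.comp h3) _) h2.norm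

/-- The rational spectral curve with `x(z) = z + 1/z` and the given `y`: the branch points are
`±1`, and the local involutions are both `z ↦ 1/z`. -/
def joukowskyCurve (y : ℂ → ℂ) : SpectralCurve where
  x := fun z => z + z⁻¹
  y := y
  branch := {1, -1}
  σ := fun _ z => z⁻¹
  mem_branch_iff := by
    intro p
    by_cases hp : p = 0
    · subst hp
      simp [not_analyticAt_add_inv]
    · have ha : AnalyticAt ℂ (fun z : ℂ => z + z⁻¹) p :=
        analyticAt_id.add (analyticAt_inv hp)
      rw [deriv_add_inv hp]
      simp only [Finset.mem_insert, Finset.mem_singleton, ha, true_and]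
      rw [sub_eq_zero, eq_comm (a := (1 : ℂ)), inv_eq_one]
      exact sq_eq_one_iff.symm
  simple := by
    intro α hα
    have hα0 : α ≠ 0 := by
      rintro rfl
      simp at hα
    have he : deriv (fun z : ℂ => z + z⁻¹) =ᶠ[𝓝 α] fun z => 1 - (z ^ 2)⁻¹ := by
      filter_upwards [isOpen_ne.mem_nhds hα0] with z hz using deriv_add_inv hz
    rw [he.deriv_eq]
    have hd : HasDerivAt (fun z : ℂ => 1 - (z ^ 2)⁻¹) (-(-(2 * α) / (α ^ 2) ^ 2)) α := by
      have := ((hasDerivAt_pow 2 α).inv (pow_ne_zero 2 hα0)).const_sub 1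
      simpa using this
    rw [hd.deriv]
    simp [hα0]
  σ_analytic := by
    intro α hα
    refine analyticAt_inv ?_
    rintro rfl
    simp at hα
  σ_fix := by
    intro α hα
    simp only [Finset.mem_insert, Finset.mem_singleton] at hα
    rcases hα with rfl | rfl <;> norm_num
  σ_deriv := by
    intro α hα
    simp only [Finset.mem_insert, Finset.mem_singleton] at hα
    rcases hα with rfl | rfl <;> simp
  σ_x := by
    intro α _
    refine Eventually.of_forall fun p => ?_
    simp [add_comm]

/-- The spectral curve with `x(z) = z² / 2` and the given `y`: the only branch point is `0`, with
involution `z ↦ -z`. -/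
def squareCurve (y : ℂ → ℂ) : SpectralCurve where
  x := fun z => z ^ 2 / 2
  y := y
  branch := {0}
  σ := fun _ z => -z
  mem_branch_iff := by
    intro p
    have ha : AnalyticAt ℂ (fun z : ℂ => z ^ 2 / 2) p := by fun_prop
    simp [ha]
  simple := by
    intro α _
    have : deriv (fun z : ℂ => z ^ 2 / 2) = fun z => z := by
      ext z; simp
    rw [this]
    simp
  σ_analytic := by
    intro α _
    fun_prop
  σ_fix := by
    intro α hα
    simp only [Finset.mem_singleton] at hα
    simp [hα]
  σ_deriv := by
    intro α _
    simp
  σ_x := by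
    intro α _
    refine Eventually.of_forall fun p => ?_
    simp

/-- The even `q`-zeta values `ζ_q(2k) = ∑_{m ≥ 1} q^{mk} / (1 - q^m)^{2k}`. -/
def qZetaEven (q : ℂ) (k : ℕ) : ℂ :=
  ∑' m : ℕ, q ^ ((m + 1) * k) / (1 - q ^ (m + 1)) ^ (2 * k)

/-- Okuyama's spectral curve: `x(z) = z + 1/z`,
`y(z) = ½ (z - 1/z) ∏_{k ≥ 1} (1 - q^k z²) (1 - q^k z⁻²) / (1 - q^k)²`. -/
def okuyamaCurve (q : ℂ) : SpectralCurve :=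
  joukowskyCurve fun z =>
    (1 / 2) * (z - z⁻¹) *
      ∏' k : ℕ, (1 - q ^ (k + 1) * z ^ 2) * (1 - q ^ (k + 1) * (z⁻¹) ^ 2) / (1 - q ^ (k + 1)) ^ 2

/-- Okuyama's spectral curve with the values `ζ_q(2), ζ_q(4), …` replaced by independent parameters
`Z 0, Z 1, …`: near the branch points `±1` Okuyama's function is
`y(z) = ½ (z - 1/z) exp (-∑_{k ≥ 1} (ζ_q(2k) / k) (z - 1/z)^{2k})`. -/
def genericOkuyamaCurve (Z : ℕ → ℂ) : SpectralCurve :=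
  joukowskyCurve fun z =>
    (1 / 2) * (z - z⁻¹) *
      Complex.exp (-∑' k : ℕ, Z k / ((k : ℂ) + 1) * (z - z⁻¹) ^ (2 * (k + 1)))

/-- The spectral curve `S^top`: `x(z) = z² / 2`,
`y(z) = z exp (-∑_{m ≥ 1} (ζ_q(2m) / m) (4 z²)^m)`, near the branch point `0`. -/
def topCurve (q : ℂ) : SpectralCurve :=
  squareCurve fun z =>
    z * Complex.exp (-∑' m : ℕ, qZetaEven q (m + 1) / ((m : ℂ) + 1) * (4 * z ^ 2) ^ (m + 1))

/-! ### Discrete volumes, degree, top degree part -/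

/-- `N(b₁, …, bₙ)`, for positive integers `bᵢ`, are the coefficients in the expansion
`ω_{g,n} = ∑_{b₁, …, bₙ ≥ 1} N(b₁, …, bₙ) ∏ bᵢ zᵢ^{bᵢ - 1} dzᵢ` at `z = 0`
(the summation variable below is `bᵢ - 1`). -/
def IsDiscreteVolume (C : SpectralCurve) (g n : ℕ) (N : (Fin n → ℕ) → ℂ) : Prop :=
  ∀ᶠ z in 𝓝 (0 : Fin n → ℂ),
    HasSum (fun b : Fin n → ℕ =>
      N (fun i => b i + 1) * ∏ i, (((b i : ℂ) + 1) * z i ^ b i)) (C.omega g n z)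

/-- The polynomial ring `ℚ[ζ(2), ζ(4), …][b₁, …, bₙ]`: the variable `Sum.inl k` stands for
`ζ_q(2 (k + 1))`, the variable `Sum.inr i` for `bᵢ`. -/
abbrev VolRing (n : ℕ) : Type := MvPolynomial (ℕ ⊕ Fin n) ℚ

/-- The grading: `ζ_q(2 (k + 1))` has degree `2 (k + 1)`, and `bᵢ` has degree `1`. -/
def volDeg (n : ℕ) : ℕ ⊕ Fin n → ℕ :=
  Sum.elim (fun k => 2 * (k + 1)) (fun _ => 1)

/-- Evaluation of a polynomial at values of the zeta variables and of `b₁, …, bₙ`. -/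
def evalVol {n : ℕ} (P : VolRing n) (Z : ℕ → ℂ) (b : Fin n → ℂ) : ℂ :=
  MvPolynomial.aeval (Sum.elim Z b) P

/-- The value at `b ∈ ℤ_{>0}ⁿ` of the quasi-polynomial with underlying polynomials `P ε`, one for
each parity class `ε` of `b`. -/
def evalQuasi {n : ℕ} (P : (Fin n → ZMod 2) → VolRing n) (Z : ℕ → ℂ) (b : Fin n → ℕ) : ℂ :=
  evalVol (P fun i => (b i : ZMod 2)) Z (fun i => (b i : ℂ))

/-- `P` is Okuyama's discrete volume as a quasi-polynomial with coefficients in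
`ℚ[ζ(2), ζ(4), …]`: it computes `N^q_{g,n}` for every `q`, and it does so as a formal
polynomial in the zeta values, namely also after these are replaced by independent parameters
(of at most exponential growth, so that `y` converges near the branch points). The latter
determines `P` uniquely, whatever relations hold among the numbers `ζ_q(2k)`. -/
def IsOkuyamaVolume (g n : ℕ) (P : (Fin n → ZMod 2) → VolRing n) : Prop :=
  (∀ q : ℂ, ‖q‖ < 1 →
    IsDiscreteVolume (okuyamaCurve q) g n (evalQuasi P fun k => qZetaEven q (k + 1))) ∧
  (∀ Z : ℕ → ℂ, (∃ c : ℝ, ∀ k, ‖Z k‖ ≤ c ^ (k + 1)) →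
    IsDiscreteVolume (genericOkuyamaCurve Z) g n (evalQuasi P Z))

/-- The part of degree `6g - 6 + 2n`. -/
def topPart (g : ℕ) {n : ℕ} (P : VolRing n) : VolRing n :=
  MvPolynomial.weightedHomogeneousComponent (volDeg n) (6 * g + 2 * n - 6) P

/-! ### Laplace transform and mixed derivative -/

/-- `ℒ{f}(z) = ∫_0^∞ ⋯ ∫_0^∞ f(x) ∏ exp(-zᵢ xᵢ) dx₁ ⋯ dxₙ`. -/
def laplace {n : ℕ} (f : (Fin n → ℝ) → ℂ) (z : Fin n → ℂ) : ℂ :=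
  ∫ x in Set.univ.pi (fun _ : Fin n => Set.Ioi (0 : ℝ)), f x * ∏ i, Complex.exp (-(z i * x i))

/-- The partial derivative `∂f/∂zᵢ`. -/
def partialDeriv {n : ℕ} (i : Fin n) (f : (Fin n → ℂ) → ℂ) : (Fin n → ℂ) → ℂ :=
  fun z => deriv (fun w => f (Function.update z i w)) (z i)

/-- `∂/∂z₁ ⋯ ∂/∂zₙ f`. -/
def mixedPartial {n : ℕ} (f : (Fin n → ℂ) → ℂ) : (Fin n → ℂ) → ℂ :=
  (List.finRange n).foldr partialDeriv f

end TopRec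

end

/-!
The two spectral curves are specializations of one homogeneous family, and the topological recursion
respects the grading.

Near the branch point `1` of `x = z + 1/z` put `z = exp(-t)`, so that the involution is `t ↦ -t`.
Okuyama's `y` is there `½ (z - 1/z) exp (-∑ (Z_k / k) (z - 1/z)^{2k})` (`tprod_eq_expSum`), and
`(z - 1/z)² = 4 sinh(t)²`, of which `4 t²`, the argument in `S^top`, is the leading term. Give `Z_k`
the degree `2k`, and let `s` be a variable of degree `1` that multiplies `t` in the power series
with rational coefficients, as in `sinh(s t) / (s t)`. Then the coefficient of `t^j` in the kernel
denominator is, up to a shift of `j`, a homogeneous polynomial of degree `j` in `s` and the `Z_k`;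
`s = 1` gives the curve `x = z + 1/z`, and `s = 0` gives `S^top`, up to a factor `2` in the
denominators, from which the powers of `2` in the result come (`exists_kernelDen_expansion`).

The differentials with a pole at `z = 1` only are spanned by `ξ_e = ∑_{b ≥ 1} b^{e + 1} z^{b - 1}`.
The polynomial `b^e` of degree `e` is the coefficient of `b z^{b - 1}` in `ξ_e`, and the principal
part `(e + 1)! / t^{e + 2}` of `ξ_e dz` (up to sign) is `-d/dt` of the Laplace transform of `x^e`.
Hence the passage from a discrete volume to the Laplace transform of its top degree part is the
passage from `s = 1` to `s = 0`, for combinations of products of the `ξ_e` whose coefficients are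
homogeneous in `s` and `Z` (`IsQuasiPoly`, `isQuasiPoly_gen`). The branch point `-1` is exchanged
with `1` by `z ↦ -z`, which replaces a product of `ξ_e` by its symmetrization (`symm`): this cancels
the coefficients with `∑ b_i` odd, and doubles those with `∑ b_i` even.

What remains is that `ω_{g,n}` is, for both curves, the specialization of one symmetrized
combination that is homogeneous of degree `6g - 6 + 2n`. This is `isHomogeneousCorr`, by induction
on `2g - 2 + n`. The bidifferential has the `ξ_e / e!` as expansion coefficients
(`hasExp_bidifferential`), homogeneous families have homogeneous expansion coefficients at the
branch points (`exists_expansion_one`, `exists_expansion_two`), and the residue is a coefficient of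
the product of the expansions of the kernel and of the bracket (`residue_eq_coeff`,
`residue_step`).
-/

noncomputable section

namespace TopRec

/-! ### Convergent expansions in a punctured neighbourhood -/

/-- `f` agrees near `0`, away from `0`, with the sum of the convergent power series with
coefficients `c`. The value `f 0` plays no role. -/
def HasExp (f : ℂ → ℂ) (c : ℕ → ℂ) : Prop :=
  ∀ᶠ t in 𝓝[≠] (0 : ℂ), HasSum (fun n => c n * t ^ n) (f t)

lemma tendsto_neg_punctured : Tendsto (fun t : ℂ => -t) (𝓝[≠] 0) (𝓝[≠] 0) := by
  refine tendsto_nhdsWithin_of_tendsto_nhds_of_eventually_within _ ?_ ?_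
  · have : Tendsto (fun t : ℂ => -t) (𝓝 0) (𝓝 (-0)) := continuous_neg.tendsto 0
    rw [neg_zero] at this
    exact this.mono_left nhdsWithin_le_nhds
  · filter_upwards [self_mem_nhdsWithin] with t ht
    simpa using ht

lemma _root_.HasSum.of_congr {ι : Type*} {f g : ι → ℂ} {a : ℂ} (h : ∀ i, f i = g i)
    (hg : HasSum g a) : HasSum f a := by
  rwa [funext h]

namespace HasExp

variable {f g : ℂ → ℂ} {c d : ℕ → ℂ}

lemma congr (h : HasExp f c) (hfg : g =ᶠ[𝓝[≠] 0] f) : HasExp g c := by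
  filter_upwards [h, hfg] with t ht he
  rwa [he]

lemma add (hf : HasExp f c) (hg : HasExp g d) :
    HasExp (fun t => f t + g t) (fun n => c n + d n) := by
  filter_upwards [hf, hg] with t h1 h2
  simpa only [add_mul] using h1.add h2

lemma const_mul (a : ℂ) (hf : HasExp f c) :
    HasExp (fun t => a * f t) (fun n => a * c n) := by
  filter_upwards [hf] with t h1
  simpa only [mul_assoc] using h1.mul_left a

lemma neg (hf : HasExp f c) : HasExp (fun t => -f t) (fun n => -c n) := by
  simpa using hf.const_mul (-1)

lemma sub (hf : HasExp f c) (hg : HasExp g d) :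
    HasExp (fun t => f t - g t) (fun n => c n - d n) := by
  simpa only [sub_eq_add_neg] using hf.add hg.neg

lemma zero : HasExp (fun _ => 0) (fun _ => 0) :=
  Eventually.of_forall fun t => by simp

lemma sum {ι : Type*} (s : Finset ι) {F : ι → ℂ → ℂ} {C : ι → ℕ → ℂ}
    (h : ∀ i ∈ s, HasExp (F i) (C i)) :
    HasExp (fun t => ∑ i ∈ s, F i t) (fun n => ∑ i ∈ s, C i n) := by
  classical
  induction s using Finset.induction_on with
  | empty => simpa using zero
  | insert a s ha ih =>
    simp only [Finset.sum_insert ha]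
    exact (h a (Finset.mem_insert_self _ _)).add
      (ih fun i hi => h i (Finset.mem_insert_of_mem hi))

lemma mul (hf : HasExp f c) (hg : HasExp g d) :
    HasExp (fun t => f t * g t)
      (fun n => ∑ ij ∈ Finset.HasAntidiagonal.antidiagonal n, c ij.1 * d ij.2) := by
  filter_upwards [hf, hg] with t h1 h2
  have s1 := h1.summable.norm
  have s2 := h2.summable.norm
  have h3 := tsum_mul_tsum_eq_tsum_sum_antidiagonal_of_summable_norm s1 s2
  have s3 := (summable_norm_sum_mul_antidiagonal_of_summable_norm s1 s2).of_norm
  rw [h1.tsum_eq, h2.tsum_eq] at h3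
  rw [h3]
  refine HasSum.of_congr (fun n => ?_) s3.hasSum
  rw [Finset.sum_mul]
  refine Finset.sum_congr rfl fun ij hij => ?_
  rw [← Finset.HasAntidiagonal.mem_antidiagonal.mp hij, pow_add]
  ring

lemma pow_mul (k : ℕ) (hf : HasExp f c) :
    HasExp (fun t => t ^ k * f t) (fun n => if k ≤ n then c (n - k) else 0) := by
  filter_upwards [hf] with t h1
  have h2 := h1.mul_left (t ^ k)
  rw [← (Function.Injective.hasSum_iff (add_left_injective k) (f := fun n =>
    (if k ≤ n then c (n - k) else 0) * t ^ n))]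
  · refine HasSum.of_congr (fun n => ?_) h2
    simp only [Function.comp_apply, Nat.le_add_left, if_true, Nat.add_sub_cancel]
    ring
  · intro n hn
    have : ¬ k ≤ n := fun h => hn ⟨n - k, by simp [h]⟩
    simp [this]

lemma comp_neg (hf : HasExp f c) : HasExp (fun t => f (-t)) (fun n => (-1) ^ n * c n) := by
  filter_upwards [tendsto_neg_punctured.eventually hf] with t ht
  convert ht using 2 with n
  rw [neg_pow t]
  ring

lemma of_eventually (h : ∀ᶠ t in 𝓝 (0 : ℂ), HasSum (fun n => c n * t ^ n) (f t)) : HasExp f c :=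
  h.filter_mono nhdsWithin_le_nhds

lemma of_analyticAt (hf : AnalyticAt ℂ f 0) :
    HasExp f (fun n => iteratedDeriv n f 0 / n.factorial) := by
  have h := hasFPowerSeriesAt_iff.mp hf.hasFPowerSeriesAt
  refine of_eventually ?_
  filter_upwards [h] with t ht
  simpa [FormalMultilinearSeries.coeff_ofScalars, mul_comm] using ht

/-- A function with a convergent expansion extends analytically over `0`. -/
lemma exists_hasFPowerSeriesAt (hf : HasExp f c) :
    ∃ φ : ℂ → ℂ, HasFPowerSeriesAt φ (FormalMultilinearSeries.ofScalars ℂ c) 0 ∧ φ 0 = c 0 ∧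
      f =ᶠ[𝓝[≠] 0] φ := by
  refine ⟨fun t => ∑' n, c n * t ^ n, ?_, ?_, ?_⟩
  · rw [hasFPowerSeriesAt_iff]
    have h := eventually_nhdsWithin_iff.mp hf
    filter_upwards [h] with t ht
    by_cases h0 : t = 0
    · subst h0
      have h1 : ∀ n, n ≠ 0 → (0 : ℂ) ^ n • (FormalMultilinearSeries.ofScalars ℂ c).coeff n = 0 := by
        intro n hn; simp [hn]
      have h2 := hasSum_single 0 h1
      have h3 : ∑' n, c n * (0 : ℂ) ^ n = c 0 := by
        rw [tsum_eq_single 0]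
        · simp
        · intro n hn; simp [hn]
      simpa [FormalMultilinearSeries.coeff_ofScalars, h3] using h2
    · have h2 := ht h0
      rw [zero_add, h2.tsum_eq]
      simpa [FormalMultilinearSeries.coeff_ofScalars, mul_comm] using h2
  · simp only
    rw [tsum_eq_single 0]
    · simp
    · intro n hn; simp [hn]
  · filter_upwards [hf] with t ht
    exact ht.tsum_eq.symm

lemma exists_analyticAt (hf : HasExp f c) :
    ∃ φ : ℂ → ℂ, AnalyticAt ℂ φ 0 ∧ φ 0 = c 0 ∧ f =ᶠ[𝓝[≠] 0] φ := by
  obtain ⟨φ, h1, h2, h3⟩ := hf.exists_hasFPowerSeriesAt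
  exact ⟨φ, h1.analyticAt, h2, h3⟩

lemma tendsto (hf : HasExp f c) : Tendsto f (𝓝[≠] 0) (𝓝 (c 0)) := by
  obtain ⟨φ, h1, h2, h3⟩ := hf.exists_analyticAt
  rw [← h2]
  exact (h1.continuousAt.tendsto.mono_left nhdsWithin_le_nhds).congr' h3.symm

lemma unique (hf : HasExp f c) (hg : HasExp f d) : c = d := by
  obtain ⟨φ, h1, -, h3⟩ := hf.exists_hasFPowerSeriesAt
  obtain ⟨ψ, h4, -, h6⟩ := hg.exists_hasFPowerSeriesAt
  have h7 : φ =ᶠ[𝓝 0] ψ :=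
    (h1.analyticAt.frequently_eq_iff_eventually_eq h4.analyticAt).mp
      ((h3.symm.trans h6).frequently)
  have h8 := h1.eq_formalMultilinearSeries_of_eventually h4 h7
  exact FormalMultilinearSeries.ofScalars_series_injective ℂ ℂ h8

/-- The first `N` terms split off, with an analytic remainder. -/
lemma exists_remainder (hf : HasExp f c) (N : ℕ) :
    ∃ φ : ℂ → ℂ, AnalyticAt ℂ φ 0 ∧
      ∀ᶠ t in 𝓝[≠] 0, f t = ∑ n ∈ Finset.range N, c n * t ^ n + t ^ N * φ t := by
  have h1 : HasExp (fun t => (f t - ∑ n ∈ Finset.range N, c n * t ^ n) / t ^ N)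
      (fun n => c (n + N)) := by
    filter_upwards [hf, self_mem_nhdsWithin] with t ht h0
    have h2 := ((hasSum_nat_add_iff' N).mpr ht).div_const (t ^ N)
    refine HasSum.of_congr (fun n => ?_) h2
    have : t ^ N ≠ 0 := pow_ne_zero _ h0
    rw [pow_add]
    field_simp
  obtain ⟨φ, hφ, -, h2⟩ := h1.exists_analyticAt
  refine ⟨φ, hφ, ?_⟩
  filter_upwards [h2, self_mem_nhdsWithin] with t ht h0
  have : t ^ N ≠ 0 := pow_ne_zero _ h0
  rw [← ht]
  field_simp
  ring

lemma one : HasExp (fun _ => 1) (fun n => if n = 0 then 1 else 0) := by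
  refine Eventually.of_forall fun t => ?_
  convert hasSum_single 0 _ using 1
  · simp
  · intro n hn; simp [hn]

lemma const (a : ℂ) : HasExp (fun _ => a) (fun n => if n = 0 then a else 0) := by
  simpa using one.const_mul a

lemma exp : HasExp Complex.exp (fun n => 1 / n.factorial) := by
  refine Eventually.of_forall fun t => ?_
  have h := NormedSpace.exp_series_hasSum_exp' (𝕂 := ℂ) t
  rw [← Complex.exp_eq_exp_ℂ] at h
  simpa using h

end HasExp

/-! ### Residues in a local coordinate -/

lemma eventually_circleIntegral_eq {f g : ℂ → ℂ} {α : ℂ} (h : f =ᶠ[𝓝[≠] α] g) :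
    ∀ᶠ r in 𝓝[>] (0 : ℝ), ∮ z in C(α, r), f z = ∮ z in C(α, r), g z := by
  obtain ⟨ε, hε, h⟩ := Metric.eventually_nhds_iff.mp (eventually_nhdsWithin_iff.mp h)
  filter_upwards [Ioo_mem_nhdsGT hε] with r hr
  refine circleIntegral.integral_congr hr.1.le fun z hz => h ?_ ?_
  · rw [mem_sphere_iff_norm, ← dist_eq_norm] at hz
    rw [hz]; exact hr.2
  · rintro rfl
    simp at hz
    exact hr.1.ne hz

lemma residue_congr {f g : ℂ → ℂ} {α : ℂ} (h : f =ᶠ[𝓝[≠] α] g) : residue f α = residue g α := by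
  unfold residue limUnder
  congr 1
  refine Filter.map_congr ?_
  filter_upwards [eventually_circleIntegral_eq h] with r hr
  rw [hr]

/-- A simple pole, an exact part and a bounded part: only the first contributes to the residue. -/
lemma residue_of_eq {f G G' h : ℂ → ℂ} {α v : ℂ}
    (hG : ∀ᶠ p in 𝓝[≠] α, HasDerivAt G (G' p) p ∧ ContinuousAt G' p)
    (hh : AnalyticAt ℂ h α)
    (hf : ∀ᶠ p in 𝓝[≠] α, f p = v * (p - α)⁻¹ + G' p + h p) :
    residue f α = v := by
  rw [residue_congr hf]
  refine Tendsto.limUnder_eq ?_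
  obtain ⟨ε, hε, hG⟩ := Metric.eventually_nhds_iff.mp (eventually_nhdsWithin_iff.mp hG)
  obtain ⟨δ, hδ, hh1⟩ := Metric.eventually_nhds_iff.mp hh.eventually_analyticAt
  obtain ⟨C, hC⟩ : ∃ C : ℝ, ∀ᶠ p in 𝓝 α, ‖h p‖ ≤ C := by
    refine ⟨‖h α‖ + 1, ?_⟩
    have := hh.continuousAt.norm.eventually (gt_mem_nhds (lt_add_one ‖h α‖))
    filter_upwards [this] with p hp using hp.le
  obtain ⟨η, hη, hC⟩ := Metric.eventually_nhds_iff.mp hC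
  have key : ∀ᶠ r in 𝓝[>] (0 : ℝ),
      (2 * (Real.pi : ℂ) * Complex.I)⁻¹ * (∮ z in C(α, r), (v * (z - α)⁻¹ + G' z + h z)) =
      v + (2 * (Real.pi : ℂ) * Complex.I)⁻¹ * ∮ z in C(α, r), h z := by
    filter_upwards [Ioo_mem_nhdsGT hε, Ioo_mem_nhdsGT hδ] with r hr hr'
    have hne : ∀ z ∈ Metric.sphere α r, z ≠ α := by
      rintro z hz rfl
      simp at hz
      exact hr.1.ne hz
    have hG2 : ∀ z ∈ Metric.sphere α r, HasDerivAt G (G' z) z ∧ ContinuousAt G' z := by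
      intro z hz
      refine hG ?_ (hne z hz)
      rw [Metric.mem_sphere.mp hz]; exact hr.2
    have i1 : CircleIntegrable (fun z => v * (z - α)⁻¹) α r := by
      refine ContinuousOn.circleIntegrable hr.1.le ?_
      refine continuousOn_const.mul (ContinuousOn.inv₀ (by fun_prop) fun z hz => ?_)
      exact sub_ne_zero.mpr (hne z hz)
    have i2 : CircleIntegrable G' α r :=
      ContinuousOn.circleIntegrable hr.1.le fun z hz => (hG2 z hz).2.continuousWithinAt
    have i3 : CircleIntegrable h α r := by
      refine ContinuousOn.circleIntegrable hr.1.le fun z hz => ?_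
      have : dist z α < δ := by rw [Metric.mem_sphere.mp hz]; exact hr'.2
      exact (hh1 this).continuousAt.continuousWithinAt
    have e1 := circleIntegral.integral_add (i1.add i2) i3
    have e2 := circleIntegral.integral_add i1 i2
    have e3 : (∮ z in C(α, r), v * (z - α)⁻¹) = v * (2 * Real.pi * Complex.I) := by
      rw [circleIntegral.integral_const_mul,
        circleIntegral.integral_sub_center_inv α hr.1.ne']
    have e4 : (∮ z in C(α, r), G' z) = 0 :=
      circleIntegral.integral_eq_zero_of_hasDerivWithinAt hr.1.le
        fun z hz => (hG2 z hz).1.hasDerivWithinAt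
    simp only [Pi.add_apply] at e1 e2
    rw [e1, e2, e3, e4]
    have hpi : (Real.pi : ℂ) ≠ 0 := by exact_mod_cast Real.pi_ne_zero
    field_simp
    ring
  have hlim : Tendsto (fun r : ℝ => ∮ z in C(α, r), h z) (𝓝[>] 0) (𝓝 0) := by
    have h1 : Tendsto (fun r : ℝ => 2 * Real.pi * r * C) (𝓝[>] 0) (𝓝 0) := by
      have : Tendsto (fun r : ℝ => 2 * Real.pi * r * C) (𝓝 0) (𝓝 (2 * Real.pi * 0 * C)) := by
        apply Continuous.tendsto; fun_prop
      simp only [mul_zero, zero_mul] at this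
      exact this.mono_left nhdsWithin_le_nhds
    refine squeeze_zero_norm' ?_ h1
    filter_upwards [Ioo_mem_nhdsGT hη] with r hr
    refine circleIntegral.norm_integral_le_of_norm_le_const hr.1.le fun z hz => hC ?_
    rw [Metric.mem_sphere.mp hz]; exact hr.2
  refine Tendsto.congr' (EventuallyEq.symm key) ?_
  simpa using (hlim.const_mul ((2 * (Real.pi : ℂ) * Complex.I)⁻¹)).const_add v

/-- The residue at `α` of `t⁻ᴺ g(t) dt`, for a local coordinate `t = τ(p)` at `α`, is the
coefficient of `tᴺ⁻¹` in the expansion of `g`. -/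
lemma residue_eq_coeff {f g τ : ℂ → ℂ} {c : ℕ → ℂ} {α : ℂ} (hg : HasExp g c) (N : ℕ)
    (hτ : AnalyticAt ℂ τ α) (h0 : τ α = 0) (h1 : deriv τ α ≠ 0)
    (hf : ∀ᶠ p in 𝓝[≠] α, τ p ^ (N + 1) * f p = deriv τ p * g (τ p)) :
    residue f α = c N := by
  obtain ⟨φ, hφ, hφg⟩ := hg.exists_remainder (N + 1)
  set θ := dslope τ α with hθ
  have hθa : AnalyticAt ℂ θ α := by
    obtain ⟨p, hp⟩ := hτ
    exact (hp.has_fpower_series_dslope_fslope).analyticAt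
  have hθ0 : θ α ≠ 0 := by rw [hθ, dslope_same]; exact h1
  have hτθ : ∀ p, τ p = (p - α) * θ p := by
    intro p
    have := sub_smul_dslope τ α p
    rw [h0, sub_zero, smul_eq_mul] at this
    exact this.symm
  have hθev : ∀ᶠ p in 𝓝 α, AnalyticAt ℂ θ p ∧ θ p ≠ 0 :=
    hθa.eventually_analyticAt.and (hθa.continuousAt.eventually_ne hθ0)
  have hτev : ∀ᶠ p in 𝓝[≠] α, AnalyticAt ℂ τ p ∧ τ p ≠ 0 := by
    filter_upwards [nhdsWithin_le_nhds hτ.eventually_analyticAt, nhdsWithin_le_nhds hθev,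
      self_mem_nhdsWithin] with p h2 h3 h4
    refine ⟨h2, ?_⟩
    rw [hτθ]
    exact mul_ne_zero (sub_ne_zero.mpr h4) h3.2
  have htend : Tendsto τ (𝓝[≠] α) (𝓝[≠] 0) := by
    refine tendsto_nhdsWithin_of_tendsto_nhds_of_eventually_within _ ?_ ?_
    · have := hτ.continuousAt.tendsto
      rw [h0] at this
      exact this.mono_left nhdsWithin_le_nhds
    · filter_upwards [hτev] with p hp using hp.2
  have hφ' : AnalyticAt ℂ (fun p => φ (τ p)) α := by
    have : AnalyticAt ℂ φ (τ α) := by rwa [h0]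
    exact this.comp hτ
  refine residue_of_eq
    (G := fun p => ∑ n ∈ Finset.range N, c n * (-(1 / ((N - n : ℕ) : ℂ)) * (τ p ^ (N - n))⁻¹))
    (G' := fun p => ∑ n ∈ Finset.range N, c n * (deriv τ p * (τ p ^ (N - n + 1))⁻¹))
    (h := fun p => c N * (deriv θ p / θ p) + deriv τ p * φ (τ p)) ?_ ?_ ?_
  · filter_upwards [hτev] with p hp
    constructor
    · refine HasDerivAt.fun_sum fun n hn => HasDerivAt.const_mul _ ?_
      have hn' : N - n ≠ 0 := by have := Finset.mem_range.mp hn; omega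
      have hd := (((hp.1.differentiableAt.hasDerivAt).pow (N - n)).inv
        (pow_ne_zero _ hp.2)).const_mul (-(1 / ((N - n : ℕ) : ℂ)))
      refine hd.congr_deriv ?_
      obtain ⟨k, hk⟩ := Nat.exists_eq_succ_of_ne_zero hn'
      have hk0 : ((k : ℂ) + 1) ≠ 0 := by exact_mod_cast Nat.succ_ne_zero k
      have hp2 := hp.2
      rw [hk]
      simp only [Nat.succ_eq_add_one, Nat.add_sub_cancel, Pi.pow_apply, Nat.cast_add, Nat.cast_one]
      field_simp
      ring
    · have hd : ContinuousAt (deriv τ) p := hp.1.deriv.continuousAt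
      have hc : ContinuousAt τ p := hp.1.continuousAt
      refine tendsto_finsetSum _ fun n _ => ?_
      exact tendsto_const_nhds.mul (hd.mul ((hc.pow _).inv₀ (pow_ne_zero _ hp.2)))
  · exact (analyticAt_const.mul (hθa.deriv.div hθa hθ0)).add (hτ.deriv.mul hφ')
  · filter_upwards [hf, hτev, htend.eventually hφg, nhdsWithin_le_nhds hθev, self_mem_nhdsWithin]
      with p h2 h3 h4 h5 h6
    have hpα : p - α ≠ 0 := sub_ne_zero.mpr h6
    have hdτ : deriv τ p = θ p + (p - α) * deriv θ p := by
      have h7 : τ = fun p => (p - α) * θ p := funext hτθ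
      have h8 : HasDerivAt τ (1 * θ p + (p - α) * deriv θ p) p := by
        conv => enter [1]; rw [h7]
        exact ((hasDerivAt_id p).sub_const α).mul h5.1.differentiableAt.hasDerivAt
      rw [h8.deriv, one_mul]
    have h9 : f p = deriv τ p * g (τ p) * (τ p ^ (N + 1))⁻¹ := by
      rw [← h2]
      have := pow_ne_zero (N + 1) h3.2
      field_simp
    have h10 : deriv τ p * (τ p)⁻¹ = (p - α)⁻¹ + deriv θ p / θ p := by
      rw [hdτ, hτθ]
      have := h5.2
      field_simp
    rw [h9, h4, Finset.sum_range_succ]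
    have h11 : deriv τ p * (∑ n ∈ Finset.range N, c n * τ p ^ n) * (τ p ^ (N + 1))⁻¹ =
        ∑ n ∈ Finset.range N, c n * (deriv τ p * (τ p ^ (N - n + 1))⁻¹) := by
      rw [Finset.mul_sum, Finset.sum_mul]
      refine Finset.sum_congr rfl fun n hn => ?_
      have hn' : N + 1 = n + (N - n + 1) := by have := Finset.mem_range.mp hn; omega
      have h12 := pow_ne_zero n h3.2
      have h13 := pow_ne_zero (N - n + 1) h3.2
      rw [hn', pow_add]
      have : n + (N - n + 1) - n = N - n + 1 := by omega
      field_simp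
    have h14 : τ p ^ N * (τ p ^ (N + 1))⁻¹ = (τ p)⁻¹ := by
      have := h3.2
      rw [pow_succ]
      field_simp
    have h15 : τ p ^ (N + 1) * (τ p ^ (N + 1))⁻¹ = 1 := mul_inv_cancel₀ (pow_ne_zero _ h3.2)
    rw [← h11]
    linear_combination c N * h10 + deriv τ p * c N * h14 + deriv τ p * φ (τ p) * h15

/-! ### Expansions with rational coefficients -/

/-- `f` has a convergent expansion at `0` with rational coefficients and constant term `q`. -/
def HasRatExp (f : ℂ → ℂ) (q : ℚ) : Prop :=
  ∃ x : ℕ → ℚ, x 0 = q ∧ HasExp f (fun n => (x n : ℂ))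

namespace HasRatExp

variable {f g : ℂ → ℂ} {p q : ℚ}

lemma congr (h : HasRatExp f q) (hfg : g =ᶠ[𝓝[≠] 0] f) : HasRatExp g q := by
  obtain ⟨x, hx, h⟩ := h
  exact ⟨x, hx, h.congr hfg⟩

lemma const (q : ℚ) : HasRatExp (fun _ => (q : ℂ)) q := by
  refine ⟨fun n => if n = 0 then q else 0, by simp, ?_⟩
  convert HasExp.const (q : ℂ) using 2 with n
  by_cases h : n = 0 <;> simp [h]

lemma zero : HasRatExp (fun _ => 0) 0 := by simpa using const 0

lemma one : HasRatExp (fun _ => 1) 1 := by simpa using const 1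

lemma add (hf : HasRatExp f p) (hg : HasRatExp g q) : HasRatExp (fun t => f t + g t) (p + q) := by
  obtain ⟨x, hx, hf⟩ := hf
  obtain ⟨y, hy, hg⟩ := hg
  refine ⟨fun n => x n + y n, by simp [hx, hy], ?_⟩
  simpa using hf.add hg

lemma mul (hf : HasRatExp f p) (hg : HasRatExp g q) : HasRatExp (fun t => f t * g t) (p * q) := by
  obtain ⟨x, hx, hf⟩ := hf
  obtain ⟨y, hy, hg⟩ := hg
  refine ⟨fun n => ∑ ij ∈ Finset.HasAntidiagonal.antidiagonal n, x ij.1 * y ij.2,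
    by simp [hx, hy], ?_⟩
  simpa using hf.mul hg

lemma neg (hf : HasRatExp f p) : HasRatExp (fun t => -f t) (-p) := by
  simpa using (const (-1)).mul hf

lemma sub (hf : HasRatExp f p) (hg : HasRatExp g q) : HasRatExp (fun t => f t - g t) (p - q) := by
  simpa only [sub_eq_add_neg] using hf.add hg.neg

lemma pow (hf : HasRatExp f p) (k : ℕ) : HasRatExp (fun t => f t ^ k) (p ^ k) := by
  induction k with
  | zero => simpa using one
  | succ k ih => simpa only [pow_succ] using ih.mul hf

lemma sum {ι : Type*} (s : Finset ι) {F : ι → ℂ → ℂ} {r : ι → ℚ}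
    (h : ∀ i ∈ s, HasRatExp (F i) (r i)) : HasRatExp (fun t => ∑ i ∈ s, F i t) (∑ i ∈ s, r i) := by
  classical
  induction s using Finset.induction_on with
  | empty => simpa using zero
  | insert a s ha ih =>
    simp only [Finset.sum_insert ha]
    exact (h a (Finset.mem_insert_self _ _)).add
      (ih fun i hi => h i (Finset.mem_insert_of_mem hi))

lemma comp_neg (hf : HasRatExp f p) : HasRatExp (fun t => f (-t)) p := by
  obtain ⟨x, hx, hf⟩ := hf
  exact ⟨fun n => (-1) ^ n * x n, by simp [hx], by simpa using hf.comp_neg⟩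

lemma id : HasRatExp (fun t => t) 0 := by
  refine ⟨fun n => if n = 1 then 1 else 0, by simp, Eventually.of_forall fun t => ?_⟩
  have h := hasSum_single (f := fun n : ℕ => (((if n = 1 then 1 else 0 : ℚ) : ℚ) : ℂ) * t ^ n) 1
    (fun n hn => by simp [hn])
  simpa using h

lemma exp : HasRatExp Complex.exp 1 :=
  ⟨fun n => 1 / n.factorial, by simp, by simpa using HasExp.exp⟩

lemma exp_neg : HasRatExp (fun t => Complex.exp (-t)) 1 := exp.comp_neg

/-- The reciprocal is computed by the reciprocal of the rational power series. -/
lemma inv (hf : HasRatExp f p) (hp : p ≠ 0) : HasRatExp (fun t => (f t)⁻¹) p⁻¹ := by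
  obtain ⟨x, hx, hf⟩ := hf
  obtain ⟨φ, hφ, hφ0, hfφ⟩ := hf.exists_analyticAt
  have hφ1 : φ 0 ≠ 0 := by rw [hφ0, hx]; exact_mod_cast hp
  have h1 := HasExp.of_analyticAt (hφ.inv hφ1)
  set d : ℕ → ℂ := fun n => iteratedDeriv n φ⁻¹ 0 / n.factorial
  have h2 : HasExp (fun t => (f t)⁻¹) d := h1.congr (by
    filter_upwards [hfφ] with t ht
    rw [ht]; rfl)
  have h3 := hf.mul h2
  have h4 : HasExp (fun t => f t * (f t)⁻¹) (fun n => if n = 0 then 1 else 0) := by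
    refine HasExp.one.congr ?_
    have : ∀ᶠ t in 𝓝[≠] (0 : ℂ), φ t ≠ 0 :=
      nhdsWithin_le_nhds (hφ.continuousAt.eventually_ne hφ1)
    filter_upwards [hfφ, this] with t h5 h6
    rw [h5]; exact mul_inv_cancel₀ h6
  have h5 := h3.unique h4
  let P : PowerSeries ℚ := PowerSeries.mk x
  let D : PowerSeries ℂ := PowerSeries.mk d
  have hPD : PowerSeries.map (algebraMap ℚ ℂ) P * D = 1 := by
    ext n
    rw [PowerSeries.coeff_mul, PowerSeries.coeff_one]
    simpa [P, D] using congrFun h5 n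
  have hP0 : PowerSeries.constantCoeff P ≠ 0 := by simpa [P, hx] using hp
  have hPP : P * P⁻¹ = 1 := PowerSeries.mul_inv_cancel _ hP0
  have hD : D = PowerSeries.map (algebraMap ℚ ℂ) P⁻¹ := by
    have h6 : PowerSeries.map (algebraMap ℚ ℂ) P⁻¹ * PowerSeries.map (algebraMap ℚ ℂ) P = 1 := by
      rw [← map_mul, mul_comm, hPP, map_one]
    calc D = PowerSeries.map (algebraMap ℚ ℂ) P⁻¹ * PowerSeries.map (algebraMap ℚ ℂ) P * D := by
          rw [h6, one_mul]
      _ = _ := by rw [mul_assoc, hPD, mul_one]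
  refine ⟨fun n => PowerSeries.coeff n P⁻¹, ?_, ?_⟩
  · simp [P, hx]
  · convert h2 using 2 with n
    have := congrArg (PowerSeries.coeff n) hD
    simpa [D] using this.symm

end HasRatExp

/-- Division by the coordinate. -/
lemma HasExp.div_self {f : ℂ → ℂ} {c : ℕ → ℂ} (hf : HasExp f c) (h0 : c 0 = 0) :
    HasExp (fun t => f t / t) (fun n => c (n + 1)) := by
  filter_upwards [hf, self_mem_nhdsWithin] with t ht ht0
  have ht0' : t ≠ 0 := ht0
  have h2 := ((hasSum_nat_add_iff' 1).mpr ht).div_const t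
  simp only [Finset.range_one, Finset.sum_singleton, h0, zero_mul, sub_zero] at h2
  refine h2.of_congr fun n => ?_
  rw [pow_succ]
  field_simp

/-- `2 sinh(t) / t`. -/
lemma hasRatExp_sinh : HasRatExp (fun t => (Complex.exp t - Complex.exp (-t)) / t) 2 := by
  obtain ⟨x, hx, h⟩ := HasRatExp.exp.sub HasRatExp.exp_neg
  have hx1 : x 1 = 2 := by
    have h1 : HasExp (fun t => Complex.exp t - Complex.exp (-t))
        (fun n => 1 / n.factorial - (-1) ^ n * (1 / n.factorial)) := by
      exact HasExp.exp.sub HasExp.exp.comp_neg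
    have := congrFun (h.unique h1) 1
    norm_num at this
    exact_mod_cast this
  exact ⟨fun n => x (n + 1), hx1, h.div_self (by simp [hx])⟩

/-- `(1 - exp(-t)) / t`. -/
lemma hasRatExp_one_sub_exp_neg : HasRatExp (fun t => (1 - Complex.exp (-t)) / t) 1 := by
  obtain ⟨x, hx, h⟩ := HasRatExp.one.sub HasRatExp.exp_neg
  have hx1 : x 1 = 1 := by
    have h1 : HasExp (fun t => 1 - Complex.exp (-t))
        (fun n => (if n = 0 then 1 else 0) - (-1) ^ n * (1 / n.factorial)) := by
      exact HasExp.one.sub HasExp.exp.comp_neg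
    have := congrFun (h.unique h1) 1
    norm_num at this
    exact_mod_cast this
  exact ⟨fun n => x (n + 1), hx1, h.div_self (by simp [hx])⟩

/-! ### The basis of differentials -/

open Polynomial in
/-- The polynomials `r_e` with `∑_{b ≥ 0} (b + 1)^{e + 1} z^b = v² r_e(v)`, `v = 1 / (1 - z)`. -/
def eulerPoly : ℕ → ℚ[X]
  | 0 => 1
  | e + 1 => eulerPoly e + (X - 1) * (2 * eulerPoly e + X * derivative (eulerPoly e))

open Polynomial in
lemma natDegree_eulerPoly_le (e : ℕ) : (eulerPoly e).natDegree ≤ e := by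
  induction e with
  | zero => simp [eulerPoly]
  | succ e ih =>
    rw [eulerPoly]
    have h1 : (derivative (eulerPoly e)).natDegree ≤ e - 1 :=
      (natDegree_derivative_le _).trans (by omega)
    have h2 : (X * derivative (eulerPoly e)).natDegree ≤ e := by
      by_cases he : e = 0
      · subst he
        simp [eulerPoly]
      · refine natDegree_mul_le.trans ?_
        rw [natDegree_X]; omega
    have h3 : (2 * eulerPoly e).natDegree ≤ e := by
      refine natDegree_mul_le.trans ?_
      have : (2 : ℚ[X]).natDegree = 0 := natDegree_ofNat (R := ℚ) 2
      omega
    refine natDegree_add_le_of_degree_le (ih.trans (by omega)) ?_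
    refine natDegree_mul_le.trans ?_
    have h4 : ((X : ℚ[X]) - 1).natDegree ≤ 1 := by
      simpa using natDegree_X_sub_C_le (1 : ℚ)
    have := natDegree_add_le_of_degree_le h3 h2
    omega

open Polynomial in
lemma coeff_eulerPoly_self (e : ℕ) : (eulerPoly e).coeff e = (e + 1).factorial := by
  induction e with
  | zero => simp [eulerPoly]
  | succ e ih =>
    have h0 : (eulerPoly e).coeff (e + 1) = 0 :=
      coeff_eq_zero_of_natDegree_lt (by have := natDegree_eulerPoly_le e; omega)
    have h1 : (2 * eulerPoly e + X * derivative (eulerPoly e)).coeff (e + 1) = 0 := by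
      rw [coeff_add, coeff_X_mul, coeff_derivative, coeff_ofNat_mul, h0]; simp
    have h2 : (2 * eulerPoly e + X * derivative (eulerPoly e)).coeff e =
        ((e : ℚ) + 2) * (e + 1).factorial := by
      rw [coeff_add, coeff_ofNat_mul, ih]
      cases e with
      | zero => simp
      | succ k => rw [coeff_X_mul, coeff_derivative, ih]; push_cast; ring
    rw [eulerPoly, coeff_add, h0, sub_mul, one_mul, coeff_sub, coeff_X_mul, h1, h2,
      Nat.factorial_succ (e + 1)]
    push_cast
    ring

/-- The basis of the differentials that the recursion produces (coefficient functions, in the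
coordinate `z`). For `x = z + 1/z` (`true`) it is `χ ξ_e(χ z)` with
`ξ_e(z) = ∑_{b ≥ 0} (b + 1)^{e + 1} z^b`, with its only pole at the branch point `χ`; for
`x = z² / 2` (`false`) it is the principal part `(e + 1)! / z^{e + 2}` of `exp(-z) ξ_e(exp(-z))`,
and only `χ = 1` is used. -/
def basisFn : Bool → ℤˣ × ℕ → ℂ → ℂ
  | true, a, z => (a.1 : ℤ) * (((1 - (a.1 : ℤ) * z)⁻¹) ^ 2 *
      Polynomial.aeval ((1 - (a.1 : ℤ) * z)⁻¹) (eulerPoly a.2))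
  | false, a, z => if a.1 = 1 then ((a.2 + 1).factorial : ℂ) / z ^ (a.2 + 2) else 0

lemma basisFn_true_neg (a : ℤˣ × ℕ) (z : ℂ) :
    basisFn true a (-z) = -basisFn true (-a.1, a.2) z := by
  simp only [basisFn]
  push_cast
  have : 1 - ((a.1 : ℤ) : ℂ) * -z = 1 - -((a.1 : ℤ) : ℂ) * z := by ring
  rw [this]
  ring

lemma basisFn_false_of_ne {a : ℤˣ × ℕ} (h : a.1 ≠ 1) (z : ℂ) : basisFn false a z = 0 := by
  simp [basisFn, h]

/-- The expansion of a basis differential at the branch point `1`, in the coordinate `t` with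
`z = exp(-t)`: it has rational coefficients, and its leading term is that of the basis differential
of the curve `x = z² / 2`. -/
lemma exists_basis_expansion (a : ℤˣ × ℕ) :
    HasRatExp (fun t => t ^ (a.2 + 2) * (Complex.exp (-t) * basisFn true a (Complex.exp (-t))))
      (if a.1 = 1 then ((a.2 + 1).factorial : ℚ) else 0) := by
  obtain ⟨χ, e⟩ := a
  have haeval : ∀ v : ℂ, Polynomial.aeval v (eulerPoly e) =
      ∑ k ∈ Finset.range (e + 1), ((eulerPoly e).coeff k : ℂ) * v ^ k := by
    intro v
    rw [Polynomial.aeval_eq_sum_range' (n := e + 1) (by have := natDegree_eulerPoly_le e; omega)]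
    simp [Algebra.smul_def]
  rcases Int.units_eq_one_or χ with rfl | rfl
  · have hT := hasRatExp_one_sub_exp_neg.inv one_ne_zero
    have h := HasRatExp.exp_neg.mul (HasRatExp.sum (Finset.range (e + 1)) fun k _ =>
      (HasRatExp.const ((eulerPoly e).coeff k)).mul ((HasRatExp.id.pow (e - k)).mul
        (hT.pow (k + 2))))
    have hv : 1 * ∑ k ∈ Finset.range (e + 1), (eulerPoly e).coeff k *
        (0 ^ (e - k) * (1⁻¹ : ℚ) ^ (k + 2)) = ((e + 1).factorial : ℚ) := by
      rw [Finset.sum_range_succ, Finset.sum_eq_zero]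
      · simp [coeff_eulerPoly_self]
      · intro k hk
        have : e - k ≠ 0 := by have := Finset.mem_range.mp hk; omega
        simp [this]
    rw [hv] at h
    simp only [if_true]
    refine h.congr ?_
    filter_upwards [self_mem_nhdsWithin] with t ht
    have ht0 : t ≠ 0 := ht
    simp only [basisFn, Units.val_one, Int.cast_one, one_mul, haeval, inv_div]
    rw [Finset.mul_sum, Finset.mul_sum, Finset.mul_sum, Finset.mul_sum]
    refine Finset.sum_congr rfl fun k hk => ?_
    have hk' : e + 2 = e - k + (k + 2) := by have := Finset.mem_range.mp hk; omega
    rw [hk', pow_add, div_pow, pow_add _ k 2, div_eq_mul_inv, ← inv_pow]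
    generalize (1 - Complex.exp (-t))⁻¹ = v
    ring
  · have hT : HasRatExp (fun t => (1 + Complex.exp (-t))⁻¹) (1 + 1)⁻¹ :=
      (HasRatExp.one.add HasRatExp.exp_neg).inv (by norm_num)
    have h := (HasRatExp.id.pow (e + 2)).mul (HasRatExp.exp_neg.mul ((HasRatExp.const (-1)).mul
      ((hT.pow 2).mul (HasRatExp.sum (Finset.range (e + 1)) fun k _ =>
      (HasRatExp.const ((eulerPoly e).coeff k)).mul (hT.pow k)))))
    rw [zero_pow (by omega), zero_mul] at h
    have hne : ¬ ((-1 : ℤˣ) = 1) := by decide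
    simp only [hne, if_false]
    refine h.congr (Eventually.of_forall fun t => ?_)
    simp only [basisFn, haeval]
    simp

/-- The expansion of a basis differential at `z = 0`. -/
lemma hasSum_basisFn (a : ℤˣ × ℕ) {z : ℂ} (hz : ‖z‖ < 1) :
    HasSum (fun b : ℕ => ((a.1 : ℤ) : ℂ) ^ (b + 1) * ((b : ℂ) + 1) ^ (a.2 + 1) * z ^ b)
      (basisFn true a z) := by
  obtain ⟨χ, e⟩ := a
  -- the linear functional taking `v ^ k` to the `b`-th coefficient of `v ^ (k + 2)`
  let Λ : ℕ → Polynomial ℚ →ₗ[ℚ] ℚ := fun b =>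
    Polynomial.lsum fun k => ((b + k + 1).choose (k + 1) : ℚ) • LinearMap.id
  have hΛm : ∀ b k (c : ℚ), Λ b (Polynomial.monomial k c) = (b + k + 1).choose (k + 1) * c := by
    intro b k c
    simp [Λ, Polynomial.lsum_apply]
  have hstep : ∀ b (r : Polynomial ℚ), Λ b (r + (Polynomial.X - 1) *
      (2 * r + Polynomial.X * Polynomial.derivative r)) = (b + 1) * Λ b r := by
    intro b r
    induction r using Polynomial.induction_on' with
    | add p q hp hq =>
      rw [map_add (Λ b) p q, mul_add ((b : ℚ) + 1), ← hp, ← hq, ← map_add]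
      congr 1
      simp only [Polynomial.derivative_add]
      ring
    | monomial k c =>
      have h1 : Polynomial.monomial k c + (Polynomial.X - 1) * (2 * Polynomial.monomial k c +
          Polynomial.X * Polynomial.derivative (Polynomial.monomial k c)) =
          Polynomial.monomial (k + 1) ((k + 2) * c) - Polynomial.monomial k ((k + 1) * c) := by
        have h2 : Polynomial.X * Polynomial.derivative (Polynomial.monomial k c) =
            Polynomial.monomial k ((k : ℚ) * c) := by
          rw [Polynomial.derivative_monomial]
          cases k with
          | zero => simp
          | succ k => simp [Polynomial.X_mul_monomial, mul_comm]
        have h3 : (2 : Polynomial ℚ) * Polynomial.monomial k c = Polynomial.monomial k (2 * c) := by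
          rw [← Polynomial.C_ofNat, Polynomial.C_mul_monomial]
        rw [h2, h3, ← map_add, sub_mul, one_mul, Polynomial.X_mul_monomial]
        have h4 : 2 * c + k * c = (k + 2) * c := by ring
        rw [h4, add_comm, sub_add, ← map_sub]
        congr 2
        ring
      rw [h1, map_sub, hΛm, hΛm, hΛm]
      have h5 : ((b + (k + 1) + 1).choose (k + 1 + 1) : ℚ) * (k + 2) =
          (b + k + 2) * (b + k + 1).choose (k + 1) := by
        have := Nat.add_one_mul_choose_eq (b + k + 1) (k + 1)
        have h6 : ((b + k + 1 + 1 : ℕ) : ℚ) * ((b + k + 1).choose (k + 1) : ℕ) =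
          ((b + k + 1 + 1).choose (k + 1 + 1) : ℕ) * ((k + 1 + 1 : ℕ) : ℚ) := by exact_mod_cast this
        push_cast at h6
        have h7 : b + (k + 1) + 1 = b + k + 1 + 1 := by ring
        rw [h7]
        linarith
      linear_combination c * h5
  have hΛ : ∀ b, Λ b (eulerPoly e) = ((b : ℚ) + 1) ^ (e + 1) := by
    intro b
    induction e with
    | zero =>
      rw [eulerPoly, ← Polynomial.monomial_zero_one, hΛm]
      simp
    | succ e ih => rw [eulerPoly, hstep, ih]; ring
  have hχ : ‖((χ : ℤ) : ℂ)‖ = 1 := by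
    rcases Int.units_eq_one_or χ with rfl | rfl <;> simp
  have hz' : ‖((χ : ℤ) : ℂ) * z‖ < 1 := by rw [norm_mul, hχ, one_mul]; exact hz
  have haeval : ∀ v : ℂ, Polynomial.aeval v (eulerPoly e) =
      ∑ k ∈ Finset.range (e + 1), ((eulerPoly e).coeff k : ℂ) * v ^ k := by
    intro v
    rw [Polynomial.aeval_eq_sum_range' (n := e + 1) (by have := natDegree_eulerPoly_le e; omega)]
    simp [Algebra.smul_def]
  have hs := hasSum_sum (s := Finset.range (e + 1)) fun k _ =>
    (hasSum_choose_mul_geometric_of_norm_lt_one (k + 1) hz').mul_left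
      (((χ : ℤ) : ℂ) * ((eulerPoly e).coeff k : ℂ))
  have hval : basisFn true (χ, e) z = ∑ k ∈ Finset.range (e + 1),
      ((χ : ℤ) : ℂ) * ((eulerPoly e).coeff k : ℂ) *
        (1 / (1 - ((χ : ℤ) : ℂ) * z) ^ (k + 1 + 1)) := by
    simp only [basisFn, haeval, Finset.mul_sum]
    refine Finset.sum_congr rfl fun k _ => ?_
    rw [one_div, ← inv_pow]
    ring
  rw [hval]
  refine hs.of_congr fun b => ?_
  have h1 : ((b : ℂ) + 1) ^ (e + 1) = ∑ k ∈ Finset.range (e + 1),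
      ((eulerPoly e).coeff k : ℂ) * ((b + k + 1).choose (k + 1) : ℂ) := by
    have h2 := hΛ b
    rw [Polynomial.lsum_apply, Polynomial.sum_over_range' _ (by simp) (e + 1)
      (by have := natDegree_eulerPoly_le e; omega)] at h2
    have h3 := congrArg (fun x : ℚ => (x : ℂ)) h2
    push_cast at h3
    rw [← h3]
    refine Finset.sum_congr rfl fun k _ => ?_
    simp [mul_comm]
  rw [h1, Finset.mul_sum, Finset.sum_mul]
  refine Finset.sum_congr rfl fun k _ => ?_
  rw [mul_pow, ← add_assoc]
  ring

/-! ### Expansions of the bidifferential and of the recursion kernel -/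

/-- The local coordinate `t` at the branch point: `p = exp(-t)` at the branch point `1` of
`x = z + 1/z`, and `p = t` at the branch point `0` of `x = z² / 2`. The involution is `t ↦ -t` in
both cases. The sign in `exp(-t)` makes the expansion of `∑ b^{e + 1} p^b` the Laplace transform
`∑ b^{e + 1} exp(-t b)`, up to regular terms. -/
def localPt : Bool → ℂ → ℂ
  | true, t => Complex.exp (-t)
  | false, t => t

/-- The factor `dp / dt` for `p = localPt s t`, up to the sign `-1` for `x = z + 1/z`; it turns
coefficient functions in `p` into coefficient functions in `t`. -/
def localWt : Bool → ℂ → ℂ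
  | true, t => Complex.exp (-t)
  | false, _ => 1

/-- The points away from the branch points. -/
def Regular : Bool → ℂ → Prop
  | true, z => z ≠ 1 ∧ z ≠ -1
  | false, z => z ≠ 0

lemma hasDerivAt_eulerPoly (e : ℕ) {z t : ℂ} (h : 1 - z * Complex.exp t ≠ 0) :
    HasDerivAt (fun t => Complex.exp t * ((1 - z * Complex.exp t)⁻¹ ^ 2 *
        Polynomial.aeval ((1 - z * Complex.exp t)⁻¹) (eulerPoly e)))
      (Complex.exp t * ((1 - z * Complex.exp t)⁻¹ ^ 2 *
        Polynomial.aeval ((1 - z * Complex.exp t)⁻¹) (eulerPoly (e + 1)))) t := by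
  have hE := Complex.hasDerivAt_exp t
  have hV : HasDerivAt (fun t => (1 - z * Complex.exp t)⁻¹)
      ((1 - z * Complex.exp t)⁻¹ ^ 2 - (1 - z * Complex.exp t)⁻¹) t := by
    have h1 := ((hE.const_mul z).const_sub 1).fun_inv h
    refine h1.congr_deriv ?_
    field_simp
    ring
  have hP := ((eulerPoly e).hasDerivAt_aeval ((1 - z * Complex.exp t)⁻¹)).comp t hV
  refine (hE.mul ((hV.fun_pow 2).mul hP)).congr_deriv ?_
  simp only [eulerPoly, map_add, map_mul, map_sub, Polynomial.aeval_X, map_one, map_ofNat,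
    Function.comp_apply, Pi.mul_apply]
  generalize (1 - z * Complex.exp t)⁻¹ = v
  ring

lemma one_sub_mul_exp_ne_zero {z : ℂ} (hz : z ≠ 1) :
    ∀ᶠ t in 𝓝 (0 : ℂ), 1 - z * Complex.exp t ≠ 0 := by
  have hc : ContinuousAt (fun t : ℂ => 1 - z * Complex.exp t) 0 := by fun_prop
  refine hc.eventually_ne ?_
  simpa [sub_ne_zero] using hz.symm

lemma basisFn_true_one (e : ℕ) (z : ℂ) : basisFn true (1, e) z =
    (1 - z)⁻¹ ^ 2 * Polynomial.aeval ((1 - z)⁻¹) (eulerPoly e) := by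
  simp [basisFn]

lemma iteratedDeriv_bidifferential {z : ℂ} (hz : z ≠ 1) (l : ℕ) :
    iteratedDeriv l (fun t => Complex.exp t * (1 - z * Complex.exp t)⁻¹ ^ 2) =ᶠ[𝓝 0]
      fun t => Complex.exp t * ((1 - z * Complex.exp t)⁻¹ ^ 2 *
        Polynomial.aeval ((1 - z * Complex.exp t)⁻¹) (eulerPoly l)) := by
  induction l with
  | zero =>
    refine Eventually.of_forall fun t => ?_
    simp [eulerPoly]
  | succ l ih =>
    rw [iteratedDeriv_succ]
    refine ih.deriv.trans ?_
    filter_upwards [one_sub_mul_exp_ne_zero hz] with t ht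
    exact (hasDerivAt_eulerPoly l ht).deriv

/-- The expansion of `p B(p, z)`, `p = exp(-t)`, near the branch point `1`. -/
lemma hasExp_bidifferential_true {z : ℂ} (hz : z ≠ 1) :
    HasExp (fun t => Complex.exp (-t) * (1 / (Complex.exp (-t) - z) ^ 2))
      (fun l => basisFn true (1, l) z / l.factorial) := by
  have ha : AnalyticAt ℂ (fun t => Complex.exp t * (1 - z * Complex.exp t)⁻¹ ^ 2) 0 := by
    have h1 : AnalyticAt ℂ (fun t : ℂ => 1 - z * Complex.exp t) 0 := by fun_prop
    have h2 : AnalyticAt ℂ (fun t : ℂ => Complex.exp t) 0 := by fun_prop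
    exact h2.mul ((h1.inv (one_sub_mul_exp_ne_zero hz).self_of_nhds).pow 2)
  have h := (HasExp.of_analyticAt ha).congr
    (g := fun t => Complex.exp (-t) * (1 / (Complex.exp (-t) - z) ^ 2)) ?_
  · convert h using 2 with l
    rw [(iteratedDeriv_bidifferential hz l).self_of_nhds, basisFn_true_one]
    simp
  · refine Eventually.of_forall fun t => ?_
    have h1 : Complex.exp (-t) - z = Complex.exp (-t) * (1 - z * Complex.exp t) := by
      rw [mul_sub, mul_left_comm, ← Complex.exp_add]; simp
    have h2 : Complex.exp (-t) ≠ 0 := Complex.exp_ne_zero _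
    have h3 : Complex.exp t = (Complex.exp (-t))⁻¹ := by rw [Complex.exp_neg, inv_inv]
    simp only [h1, mul_pow]
    rw [one_div, mul_inv, inv_pow]
    generalize 1 - z * Complex.exp t = w
    rw [h3]
    field_simp

/-- The primitive of the bidifferential. -/
lemma hasExp_primitive_true {z : ℂ} (hz : z ≠ 1) :
    HasExp (fun t => -(1 / (z - Complex.exp (-t))))
      (fun j => if j = 0 then -(1 / (z - 1)) else basisFn true (1, j - 1) z / j.factorial) := by
  have ha : AnalyticAt ℂ (fun t => -(1 / (z - Complex.exp (-t)))) 0 := by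
    have h1 : AnalyticAt ℂ (fun t : ℂ => z - Complex.exp (-t)) 0 := by fun_prop
    have h2 : z - Complex.exp (-0) ≠ 0 := by simpa [sub_ne_zero] using hz
    exact (analyticAt_const.div h1 h2).neg
  have h := HasExp.of_analyticAt ha
  convert h using 2 with j
  cases j with
  | zero => simp
  | succ l =>
    have hd : deriv (fun t => -(1 / (z - Complex.exp (-t)))) =ᶠ[𝓝 0]
        fun t => Complex.exp t * (1 - z * Complex.exp t)⁻¹ ^ 2 := by
      have hc : ContinuousAt (fun t : ℂ => z - Complex.exp (-t)) 0 := by fun_prop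
      have hne := hc.eventually_ne (y := 0) (by simpa [sub_ne_zero] using hz)
      filter_upwards [hne] with t ht
      have h1 : HasDerivAt (fun t : ℂ => z - Complex.exp (-t)) (Complex.exp (-t)) t := by
        have := ((Complex.hasDerivAt_exp (-t)).comp t (hasDerivAt_neg t)).const_sub z
        simpa using this
      have h2 := (h1.fun_inv ht).fun_neg
      have h3 : deriv (fun t => -(1 / (z - Complex.exp (-t)))) t =
          Complex.exp (-t) / (z - Complex.exp (-t)) ^ 2 := by
        have : (fun t => -(1 / (z - Complex.exp (-t)))) = fun t => -(z - Complex.exp (-t))⁻¹ := by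
          funext t; rw [one_div]
        rw [this, h2.deriv]; ring
      rw [h3]
      have h4 : z - Complex.exp (-t) = -(Complex.exp (-t) * (1 - z * Complex.exp t)) := by
        rw [mul_sub, mul_left_comm, ← Complex.exp_add]; simp
      have h6 : Complex.exp t = (Complex.exp (-t))⁻¹ := by rw [Complex.exp_neg, inv_inv]
      have h5 : Complex.exp (-t) ≠ 0 := Complex.exp_ne_zero _
      rw [h4, neg_sq, mul_pow, inv_pow]
      generalize 1 - z * Complex.exp t = w
      rw [h6]
      field_simp
    rw [iteratedDeriv_succ']
    have h6 : iteratedDeriv l (deriv fun t => -(1 / (z - Complex.exp (-t)))) 0 =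
        iteratedDeriv l (fun t => Complex.exp t * (1 - z * Complex.exp t)⁻¹ ^ 2) 0 :=
      hd.iteratedDeriv_eq l
    rw [h6, (iteratedDeriv_bidifferential hz l).self_of_nhds]
    simp [basisFn_true_one]

lemma hasExp_primitive_false {z : ℂ} (hz : z ≠ 0) :
    HasExp (fun t => 1 / (z - t)) (fun j => 1 / z ^ (j + 1)) := by
  have : ∀ᶠ t in 𝓝 (0 : ℂ), ‖t / z‖ < 1 := by
    have hc : ContinuousAt (fun t : ℂ => ‖t / z‖) 0 := by fun_prop
    exact hc.eventually_lt_const (by simp)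
  refine HasExp.of_eventually ?_
  filter_upwards [this] with t ht
  have h := (hasSum_geometric_of_norm_lt_one ht).mul_left (1 / z)
  have h1 : 1 / z * (1 - t / z)⁻¹ = 1 / (z - t) := by
    rw [one_sub_div hz, inv_div]
    field_simp
  rw [h1] at h
  refine h.of_congr fun n => ?_
  rw [div_pow, pow_succ]
  field_simp

lemma hasExp_bidifferential_false {z : ℂ} (hz : z ≠ 0) :
    HasExp (fun t => 1 * (1 / (t - z) ^ 2)) (fun l => basisFn false (1, l) z / l.factorial) := by
  have h := (hasExp_primitive_false hz).mul (hasExp_primitive_false hz)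
  convert h.congr (g := fun t => 1 * (1 / (t - z) ^ 2)) ?_ using 2 with l
  · have h1 : ∀ ij ∈ Finset.HasAntidiagonal.antidiagonal l,
        1 / z ^ (ij.1 + 1) * (1 / z ^ (ij.2 + 1)) = 1 / z ^ (l + 2) := by
      intro ij hij
      rw [← Finset.HasAntidiagonal.mem_antidiagonal.mp hij, div_mul_div_comm, ← pow_add]
      congr 2
      · simp
      · ring
    rw [Finset.sum_congr rfl h1, Finset.sum_const, Finset.Nat.card_antidiagonal]
    have h2 : (l.factorial : ℂ) ≠ 0 := by exact_mod_cast l.factorial_ne_zero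
    simp only [basisFn, if_true, Nat.factorial_succ, nsmul_eq_mul]
    push_cast
    field_simp
  · refine Eventually.of_forall fun t => ?_
    simp only
    rw [← neg_sub z t, neg_sq, div_mul_div_comm]
    simp [sq]

lemma hasExp_bidifferential (s : Bool) {z : ℂ} (hz : Regular s z) :
    HasExp (fun t => localWt s t * (1 / (localPt s t - z) ^ 2))
      (fun l => basisFn s (1, l) z / l.factorial) := by
  cases s
  · exact hasExp_bidifferential_false hz
  · exact hasExp_bidifferential_true hz.1

/-- The numerator of the recursion kernel in the local coordinate, with a sign that makes the two
curves alike. -/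
def kernelNum (s : Bool) (t z : ℂ) : ℂ :=
  (if s then 1 else -1) * (1 / 2 * (1 / (z - localPt s (-t)) - 1 / (z - localPt s t)))

lemma hasExp_kernelNum (s : Bool) {z : ℂ} (hz : Regular s z) :
    HasExp (fun t => kernelNum s t z)
      (fun j => if Odd j then basisFn s (1, j - 1) z / j.factorial else 0) := by
  cases s
  · have h := ((hasExp_primitive_false hz).sub
      (hasExp_primitive_false hz).comp_neg).const_mul (1 / 2)
    convert h using 2 with j j
    · simp only [kernelNum, localPt]
      simp only [Bool.false_eq_true, if_false]
      ring
    · by_cases hj : Odd j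
      · obtain ⟨k, rfl⟩ := hj
        have h2 : (((2 * k + 1).factorial : ℕ) : ℂ) ≠ 0 := by
          exact_mod_cast (2 * k + 1).factorial_ne_zero
        have h3 : Odd (2 * k + 1) := ⟨k, rfl⟩
        simp only [h3, if_true, basisFn, h3.neg_one_pow, Nat.add_sub_cancel]
        field_simp
        ring
      · rw [if_neg hj, (Nat.not_odd_iff_even.mp hj).neg_one_pow]; ring
  · have h := ((hasExp_primitive_true hz.1).sub
      (hasExp_primitive_true hz.1).comp_neg).const_mul (1 / 2)
    convert h using 2 with j j
    · simp only [kernelNum, localPt]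
      simp only [if_true, neg_neg]
      ring
    · by_cases hj : Odd j
      · rw [if_pos hj, hj.neg_one_pow, if_neg (by rintro rfl; simp at hj)]
        ring
      · rw [if_neg hj, (Nat.not_odd_iff_even.mp hj).neg_one_pow]; ring

/-! ### Graded families of differentials -/

/-- Polynomials in a homogenizing variable `s` (`none`) and in the parameters `Z k` (`some k`). -/
abbrev Scal : Type := MvPolynomial (Option ℕ) ℚ

/-- The grading of `Scal`: `s` has degree `1`, and `Z k` has degree `2 (k + 1)`. -/
def scalDeg : Option ℕ → ℕ
  | none => 1
  | some k => 2 * (k + 1)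

/-- Evaluation at the given parameters `Z` and at `s = 1` (for the curve `x = z + 1/z`) or at
`s = 0` (for the curve `x = z² / 2`). -/
def scalEval (s : Bool) (Z : ℕ → ℂ) : Scal →ₐ[ℚ] ℂ :=
  MvPolynomial.aeval fun o => o.elim (if s then 1 else 0) Z

/-- The polynomial at `s = 0`. -/
def topSymbol : Scal →ₐ[ℚ] MvPolynomial ℕ ℚ :=
  MvPolynomial.aeval fun o => o.elim 0 MvPolynomial.X

lemma scalEval_false (Z : ℕ → ℂ) (φ : Scal) :
    scalEval false Z φ = MvPolynomial.aeval Z (topSymbol φ) := by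
  have : scalEval false Z = (MvPolynomial.aeval Z).comp topSymbol := by
    refine MvPolynomial.algHom_ext fun o => ?_
    cases o <;> simp [scalEval, topSymbol]
  rw [this]; rfl

lemma scalEval_false_eq_zero {φ : Scal} (h : topSymbol φ = 0) (Z : ℕ → ℂ) :
    scalEval false Z φ = 0 := by
  rw [scalEval_false, h, map_zero]

/-- Families of functions of points `z i`, `i : ι`, for both curves (`true` for `x = z + 1/z`,
`false` for `x = z² / 2`) and all values of the parameters. -/
abbrev Fam (ι : Type) : Type := Bool → (ℕ → ℂ) → (ι → ℂ) → ℂ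

section

variable {ι : Type} [Fintype ι]

/-- A product of basis differentials with a coefficient that is polynomial in the parameters. -/
def gen (φ : Scal) (a : ι → ℤˣ × ℕ) : Fam ι :=
  fun s Z z => scalEval s Z φ * ∏ i, basisFn s (a i) (z i)

/-- `gen φ a` is homogeneous of degree `d`, where `(χ, e)` has degree `e`, and its coefficient
vanishes at `s = 0` unless all poles are at the branch point `χ = 1`. -/
def IsGen (d : ℕ) (φ : Scal) (a : ι → ℤˣ × ℕ) : Prop :=
  (∃ k, MvPolynomial.IsWeightedHomogeneous scalDeg φ k ∧ k + ∑ i, (a i).2 = d) ∧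
    ((∀ i, (a i).1 = 1) ∨ topSymbol φ = 0)

variable (ι) in
/-- The families that are homogeneous of degree `d`. -/
def homFam (d : ℕ) : AddSubgroup (Fam ι) :=
  AddSubgroup.closure {F | ∃ φ a, IsGen d φ a ∧ F = gen φ a}

lemma gen_mem_homFam {d : ℕ} {φ : Scal} {a : ι → ℤˣ × ℕ} (h : IsGen d φ a) : gen φ a ∈ homFam ι d :=
  AddSubgroup.subset_closure ⟨φ, a, h, rfl⟩

lemma homFam_induction {d : ℕ} {p : Fam ι → Prop} (hgen : ∀ φ a, IsGen d φ a → p (gen φ a))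
    (h0 : p 0) (hadd : ∀ F G, p F → p G → p (F + G)) (hneg : ∀ F, p F → p (-F))
    {F : Fam ι} (hF : F ∈ homFam ι d) : p F := by
  induction hF using AddSubgroup.closure_induction with
  | mem F h => obtain ⟨φ, a, h, rfl⟩ := h; exact hgen φ a h
  | zero => exact h0
  | add F G _ _ h1 h2 => exact hadd F G h1 h2
  | neg F _ h => exact hneg F h

lemma homFam_map {κ : Type} [Fintype κ] {d d' : ℕ} (T : Fam ι →+ Fam κ)
    (hT : ∀ φ a, IsGen d φ a → T (gen φ a) ∈ homFam κ d') {F : Fam ι} (hF : F ∈ homFam ι d) :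
    T F ∈ homFam κ d' :=
  homFam_induction (p := fun F => T F ∈ homFam κ d') hT (by rw [map_zero]; exact zero_mem _)
    (fun F G h1 h2 => by rw [map_add]; exact add_mem h1 h2)
    (fun F h => by rw [map_neg]; exact neg_mem h) hF

/-- Multiplication by a coefficient. -/
def scalMul (φ : Scal) : Fam ι →+ Fam ι where
  toFun F := fun s Z z => scalEval s Z φ * F s Z z
  map_zero' := by funext s Z z; simp
  map_add' F G := by funext s Z z; simp [mul_add]

lemma scalMul_mem {k d : ℕ} {φ : Scal} (hφ : MvPolynomial.IsWeightedHomogeneous scalDeg φ k)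
    {F : Fam ι} (hF : F ∈ homFam ι d) : scalMul φ F ∈ homFam ι (k + d) := by
  refine homFam_map (scalMul φ) (fun ψ a h => ?_) hF
  obtain ⟨⟨l, h1, h2⟩, h3⟩ := h
  have h4 : scalMul φ (gen ψ a) = gen (φ * ψ) a := by
    funext s Z z
    simp [scalMul, gen, mul_assoc]
  rw [h4]
  refine gen_mem_homFam ⟨⟨k + l, hφ.mul h1, by omega⟩, ?_⟩
  rcases h3 with h3 | h3
  · exact Or.inl h3
  · right; rw [map_mul, h3, mul_zero]

end

/-- Multiplication by a basis differential in a further point. -/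
def consMul {m : ℕ} (l : ℕ) : Fam (Fin m) →+ Fam (Fin (m + 1)) where
  toFun F := fun s Z w => basisFn s (1, l) (w 0) * F s Z (Fin.tail w)
  map_zero' := by funext s Z z; simp
  map_add' F G := by funext s Z z; simp [mul_add]

lemma consMul_mem {m d : ℕ} (l : ℕ) {F : Fam (Fin m)} (hF : F ∈ homFam (Fin m) d) :
    consMul l F ∈ homFam (Fin (m + 1)) (l + d) := by
  refine homFam_map (consMul l) (fun ψ a h => ?_) hF
  obtain ⟨⟨k, h1, h2⟩, h3⟩ := h
  have h4 : consMul l (gen ψ a) = gen ψ (Fin.cons (1, l) a : Fin (m + 1) → ℤˣ × ℕ) := by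
    funext s Z z
    simp only [consMul, gen, AddMonoidHom.coe_mk, ZeroHom.coe_mk, Fin.prod_univ_succ,
      Fin.cons_zero, Fin.cons_succ, Fin.tail]
    ring
  rw [h4]
  refine gen_mem_homFam ⟨⟨k, h1, ?_⟩, ?_⟩
  · simp only [Fin.sum_univ_succ, Fin.cons_zero, Fin.cons_succ]; omega
  · rcases h3 with h3 | h3
    · left
      intro i
      cases i using Fin.cases with
      | zero => rfl
      | succ i => exact h3 i
    · exact Or.inr h3

/-- The product of families in complementary sets of points. -/
lemma pick_mul_mem {m d d' : ℕ} (I : Finset (Fin m)) {F : Fam (Fin I.card)}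
    {G : Fam (Fin Iᶜ.card)} (hF : F ∈ homFam _ d) (hG : G ∈ homFam _ d') :
    (fun s Z z => F s Z (pick z I) * G s Z (pick z Iᶜ) : Fam (Fin m)) ∈
      homFam (Fin m) (d + d') := by
  let T : Fam (Fin I.card) →+ Fam (Fin Iᶜ.card) →+ Fam (Fin m) :=
    AddMonoidHom.mk' (fun F => AddMonoidHom.mk'
      (fun G => fun s Z z => F s Z (pick z I) * G s Z (pick z Iᶜ))
      (fun G G' => by funext s Z z; simp [mul_add]))
      (fun F F' => by ext G s Z z; simp [add_mul])
  change T F G ∈ _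
  refine homFam_map (T F) (fun ψ b hb => ?_) hG
  refine homFam_map (T.flip (gen ψ b)) (fun φ a ha => ?_) hF
  let e : Fin I.card ⊕ Fin Iᶜ.card ≃ Fin m := finSumEquivOfFinset rfl rfl
  have hl : ∀ i, e (Sum.inl i) = I.orderEmbOfFin rfl i := fun i => finSumEquivOfFinset_inl rfl rfl i
  have hr : ∀ i, e (Sum.inr i) = Iᶜ.orderEmbOfFin rfl i := fun i =>
    finSumEquivOfFinset_inr rfl rfl i
  let c : Fin m → ℤˣ × ℕ := fun i => Sum.elim a b (e.symm i)
  have hcl : ∀ i, c (I.orderEmbOfFin rfl i) = a i := by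
    intro i; simp only [c]; rw [← hl, Equiv.symm_apply_apply]; rfl
  have hcr : ∀ i, c (Iᶜ.orderEmbOfFin rfl i) = b i := by
    intro i; simp only [c]; rw [← hr, Equiv.symm_apply_apply]; rfl
  have h1 : T.flip (gen ψ b) (gen φ a) = gen (φ * ψ) c := by
    funext s Z z
    change gen φ a s Z (pick z I) * gen ψ b s Z (pick z Iᶜ) = _
    simp only [gen, map_mul]
    rw [← Equiv.prod_comp e, Fintype.prod_sum_type]
    simp only [hl, hr, hcl, hcr, pick]
    ring
  rw [h1]
  obtain ⟨⟨k, h2, h3⟩, h4⟩ := ha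
  obtain ⟨⟨l, h5, h6⟩, h7⟩ := hb
  refine gen_mem_homFam ⟨⟨k + l, h2.mul h5, ?_⟩, ?_⟩
  · rw [← Equiv.sum_comp e, Fintype.sum_sum_type]
    simp only [hl, hr, hcl, hcr]
    omega
  · rcases h4 with h4 | h4
    · rcases h7 with h7 | h7
      · left
        intro i
        obtain ⟨j, rfl⟩ := e.surjective i
        cases j with
        | inl j => rw [hl, hcl]; exact h4 j
        | inr j => rw [hr, hcr]; exact h7 j
      · right; rw [map_mul, h7, mul_zero]
    · right; rw [map_mul, h4, zero_mul]

/-! ### Symmetrization under `z ↦ -z` -/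

/-- The sum over the branch points: for the curve `x = z + 1/z` the contribution of the branch point
`-1` is obtained from that of the branch point `1` by `z ↦ -z`. -/
def symm {m : ℕ} (F : Fam (Fin m)) : Fam (Fin m)
  | true, Z, z => F true Z z + (-1) ^ m * F true Z (-z)
  | false, Z, z => F false Z z

lemma symm_add {m : ℕ} (F G : Fam (Fin m)) : symm (F + G) = symm F + symm G := by
  funext s Z z
  cases s <;> simp [symm]
  ring

lemma symm_neg {m : ℕ} (F : Fam (Fin m)) : symm (-F) = -symm F := by
  funext s Z z
  cases s <;> simp [symm]
  ring

lemma symm_zero {m : ℕ} : symm (0 : Fam (Fin m)) = 0 := by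
  funext s Z z
  cases s <;> simp [symm]

/-- The symmetrization of a family is symmetric. -/
lemma symm_true_neg {m : ℕ} (F : Fam (Fin m)) (Z : ℕ → ℂ) (z : Fin m → ℂ) :
    symm F true Z (-z) = (-1) ^ m * symm F true Z z := by
  simp only [symm, neg_neg, mul_add, ← mul_assoc, ← mul_pow]
  norm_num
  ring

/-- At `s = 0` the second generator vanishes, so that the formula holds for both curves. This needs
at least one point. -/
lemma symm_gen {m d : ℕ} {φ : Scal} {a : Fin (m + 1) → ℤˣ × ℕ} (h : IsGen d φ a) :
    symm (gen φ a) = gen φ a + gen φ fun i => (-(a i).1, (a i).2) := by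
  funext s Z z
  cases s
  · simp only [symm, Pi.add_apply]
    suffices gen φ (fun i => (-(a i).1, (a i).2)) false Z z = 0 by rw [this, add_zero]
    rcases h.2 with h | h
    · simp only [gen]
      rw [Finset.prod_eq_zero (Finset.mem_univ 0), mul_zero]
      refine basisFn_false_of_ne ?_ _
      simp only [h]
      decide
    · simp [gen, scalEval_false_eq_zero h]
  · simp only [symm, gen, Pi.add_apply, Pi.neg_apply, basisFn_true_neg, Finset.prod_neg,
      Finset.card_univ, Fintype.card_fin]
    have : ((-1 : ℂ) ^ (m + 1)) * (-1) ^ (m + 1) = 1 := by rw [← mul_pow]; norm_num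
    linear_combination (scalEval true Z φ *
      ∏ i, basisFn true (-(a i).1, (a i).2) (z i)) * this

/-! ### Local expansions of homogeneous families -/

/-- A pair of functions with rational expansions that is the specialization at `s = 1` and `s = 0`
of an expansion in `s t`. -/
def HasScaledExp (g : Bool → ℂ → ℂ) (q : ℚ) : Prop :=
  HasRatExp (g true) q ∧ g false =ᶠ[𝓝[≠] 0] fun _ => (q : ℂ)

lemma HasScaledExp.mul {g h : Bool → ℂ → ℂ} {p q : ℚ} (hg : HasScaledExp g p)
    (hh : HasScaledExp h q) : HasScaledExp (fun s t => g s t * h s t) (p * q) := by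
  refine ⟨hg.1.mul hh.1, ?_⟩
  filter_upwards [hg.2, hh.2] with t h1 h2
  rw [h1, h2]; push_cast; rfl

lemma HasScaledExp.comp_neg {g : Bool → ℂ → ℂ} {p : ℚ} (hg : HasScaledExp g p) :
    HasScaledExp (fun s t => g s (-t)) p :=
  ⟨hg.1.comp_neg, tendsto_neg_punctured.eventually hg.2⟩

lemma HasScaledExp.const (q : ℚ) : HasScaledExp (fun _ _ => (q : ℂ)) q :=
  ⟨HasRatExp.const q, EventuallyEq.rfl⟩

lemma HasScaledExp.congr {g h : Bool → ℂ → ℂ} {p : ℚ} (hg : HasScaledExp g p)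
    (hh : ∀ s, h s =ᶠ[𝓝[≠] 0] g s) : HasScaledExp h p :=
  ⟨hg.1.congr (hh true), (hh false).trans hg.2⟩

lemma hasScaledExp_basisFn (a : ℤˣ × ℕ) :
    HasScaledExp (fun s t => t ^ (a.2 + 2) * (localWt s t * basisFn s a (localPt s t)))
      (if a.1 = 1 then ((a.2 + 1).factorial : ℚ) else 0) := by
  refine ⟨exists_basis_expansion a, ?_⟩
  filter_upwards [self_mem_nhdsWithin] with t ht
  have ht' : t ≠ 0 := ht
  by_cases h : a.1 = 1
  · simp only [localWt, basisFn, localPt, h, if_true]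
    push_cast
    field_simp
  · simp [basisFn, h]

/-- The coefficients of a scaled expansion, as homogeneous polynomials in `s`. -/
lemma HasScaledExp.exists_scal {g : Bool → ℂ → ℂ} {q : ℚ} (hg : HasScaledExp g q) :
    ∃ ψ : ℕ → Scal, (∀ j, MvPolynomial.IsWeightedHomogeneous scalDeg (ψ j) j) ∧
      (q = 0 → ∀ j, topSymbol (ψ j) = 0) ∧
      ∀ s Z, HasExp (g s) (fun j => scalEval s Z (ψ j)) := by
  obtain ⟨⟨y, hy0, hy⟩, hg0⟩ := hg
  refine ⟨fun j => MvPolynomial.C (y j) * MvPolynomial.X none ^ j, fun j => ?_, fun hq j => ?_,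
    fun s Z => ?_⟩
  · have h1 := ((MvPolynomial.isWeightedHomogeneous_X ℚ scalDeg none).pow j)
    have h2 := (MvPolynomial.isWeightedHomogeneous_C scalDeg (y j)).mul h1
    simpa [scalDeg] using h2
  · have hX : topSymbol (MvPolynomial.X none) = 0 := by simp [topSymbol]
    rw [map_mul, map_pow, hX]
    by_cases h0 : j = 0
    · rw [h0, hy0, hq]; simp
    · rw [zero_pow h0]; simp
  · cases s
    · convert (HasExp.const (q : ℂ)).congr hg0 using 2 with j
      by_cases hj : j = 0
      · simp [scalEval, hj, hy0]
      · simp [scalEval, hj]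
    · convert hy using 2 with j
      simp [scalEval]

/-- The product of a homogeneous generator of degree `r` with a scaled expansion, as an expansion
with homogeneous coefficients. -/
lemma exists_expansion_of_scaled {m r k : ℕ} {g : Bool → ℂ → ℂ} {q : ℚ} (hg : HasScaledExp g q)
    {φ : Scal} (hφ : MvPolynomial.IsWeightedHomogeneous scalDeg φ k) {a : Fin m → ℤˣ × ℕ}
    (hr : k + ∑ i, (a i).2 = r) (hq : topSymbol φ = 0 ∨ (∀ i, (a i).1 = 1) ∨ q = 0) :
    ∃ f : ℕ → Fam (Fin m), (∀ j, f j ∈ homFam (Fin m) j) ∧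
      ∀ s Z z, HasExp (fun t => t ^ r * (g s t * gen φ a s Z z)) (fun j => f j s Z z) := by
  obtain ⟨ψ, hψ, hψ0, h1⟩ := hg.exists_scal
  refine ⟨fun j => if r ≤ j then gen (φ * ψ (j - r)) a else 0, fun j => ?_, fun s Z z => ?_⟩
  · by_cases hj : r ≤ j
    · simp only [hj, if_true]
      refine gen_mem_homFam ⟨⟨k + (j - r), hφ.mul (hψ _), by omega⟩, ?_⟩
      rcases hq with hq | hq | hq
      · right; rw [map_mul, hq, zero_mul]
      · exact Or.inl hq
      · right
        rw [map_mul, hψ0 hq, mul_zero]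
    · simp only [hj, if_false]; exact zero_mem _
  · have h2 := ((h1 s Z).const_mul (gen φ a s Z z)).pow_mul r
    convert h2 using 2 with t j
    · ring
    · by_cases hj : r ≤ j
      · simp only [hj, if_true, gen, map_mul]; ring
      · simp [hj]

/-- Expansions with homogeneous coefficients exist for all homogeneous families if they exist for
the generators and their images under `z ↦ -z`. -/
lemma exists_expansion_of_gen {m n d : ℕ} (w : Bool → ℂ → ℂ)
    (P : Bool → ℂ → (Fin m → ℂ) → Fin (n + 1) → ℂ)
    (key : ∀ (k : ℕ) (φ : Scal) (b : Fin (n + 1) → ℤˣ × ℕ),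
      MvPolynomial.IsWeightedHomogeneous scalDeg φ k → k + ∑ i, (b i).2 = d →
      (topSymbol φ = 0 ∨ (∀ i, (b i).1 = 1) ∨ ∀ i, (b i).1 ≠ 1) →
      ∃ f : ℕ → Fam (Fin m), (∀ j, f j ∈ homFam (Fin m) j) ∧
        ∀ s Z z, HasExp (fun t => w s t * gen φ b s Z (P s t z)) (fun j => f j s Z z))
    {F : Fam (Fin (n + 1))} (hF : F ∈ homFam (Fin (n + 1)) d) :
    ∃ f : ℕ → Fam (Fin m), (∀ j, f j ∈ homFam (Fin m) j) ∧
      ∀ s Z z, HasExp (fun t => w s t * symm F s Z (P s t z)) (fun j => f j s Z z) := by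
  refine homFam_induction (p := fun F => ∃ f : ℕ → Fam (Fin m), (∀ j, f j ∈ homFam (Fin m) j) ∧
    ∀ s Z z, HasExp (fun t => w s t * symm F s Z (P s t z)) (fun j => f j s Z z))
    (fun φ a h => ?_) ?_ ?_ ?_ hF
  · rw [symm_gen h]
    obtain ⟨⟨k, h1, h2⟩, h3⟩ := h
    obtain ⟨f, hf1, hf2⟩ := key k φ a h1 h2 (by tauto)
    obtain ⟨f', hf1', hf2'⟩ := key k φ (fun i => (-(a i).1, (a i).2)) h1 h2 (by
      rcases h3 with h3 | h3
      · right; right; intro i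
        simp only [h3]
        decide
      · exact Or.inl h3)
    refine ⟨fun j => f j + f' j, fun j => add_mem (hf1 j) (hf1' j), fun s Z z => ?_⟩
    refine ((hf2 s Z z).add (hf2' s Z z)).congr (Eventually.of_forall fun t => ?_)
    simp only [Pi.add_apply]; ring
  · exact ⟨fun _ => 0, fun _ => zero_mem _, fun s Z z => by simpa [symm_zero] using HasExp.zero⟩
  · rintro F G ⟨f, hf1, hf2⟩ ⟨f', hf1', hf2'⟩
    refine ⟨fun j => f j + f' j, fun j => add_mem (hf1 j) (hf1' j), fun s Z z => ?_⟩
    refine ((hf2 s Z z).add (hf2' s Z z)).congr (Eventually.of_forall fun t => ?_)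
    simp only [symm_add, Pi.add_apply]; ring
  · rintro F ⟨f, hf1, hf2⟩
    refine ⟨fun j => -f j, fun j => neg_mem (hf1 j), fun s Z z => ?_⟩
    refine (hf2 s Z z).neg.congr (Eventually.of_forall fun t => ?_)
    simp only [symm_neg, Pi.neg_apply]; ring

/-- The expansion of a homogeneous family in one of its points. -/
lemma exists_expansion_one {m d : ℕ} {F : Fam (Fin (m + 1))} (hF : F ∈ homFam (Fin (m + 1)) d) :
    ∃ f : ℕ → Fam (Fin m), (∀ j, f j ∈ homFam (Fin m) j) ∧ ∀ s Z z,
      HasExp (fun t => t ^ (d + 2) * localWt s t *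
        symm F s Z (Fin.cons (localPt s t) z : Fin (m + 1) → ℂ)) (fun j => f j s Z z) := by
  refine exists_expansion_of_gen (fun s t => t ^ (d + 2) * localWt s t)
    (fun s t z => Fin.cons (localPt s t) z) (fun k φ b h1 h2 hb => ?_) hF
  obtain ⟨f, hf1, hf2⟩ := exists_expansion_of_scaled (hasScaledExp_basisFn (b 0)) h1
    (a := Fin.tail b) rfl (by
      rcases hb with h | h | h
      · exact Or.inl h
      · exact Or.inr (Or.inl fun i => h i.succ)
      · exact Or.inr (Or.inr (if_neg (h 0))))
  refine ⟨f, hf1, fun s Z z => ?_⟩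
  convert hf2 s Z z using 2 with t
  have hd : d + 2 = k + ∑ i, (Fin.tail b i).2 + ((b 0).2 + 2) := by
    rw [← h2, Fin.sum_univ_succ]
    simp only [Fin.tail]
    ring
  rw [hd, pow_add]
  simp only [gen, Fin.prod_univ_succ, Fin.cons_zero, Fin.cons_succ, Fin.tail]
  ring

/-- The expansion of a homogeneous family in two of its points that are exchanged by the
involution. -/
lemma exists_expansion_two {m d : ℕ} {F : Fam (Fin (m + 2))} (hF : F ∈ homFam (Fin (m + 2)) d) :
    ∃ f : ℕ → Fam (Fin m), (∀ j, f j ∈ homFam (Fin m) j) ∧ ∀ s Z z,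
      HasExp (fun t => t ^ (d + 4) * (localWt s t * localWt s (-t)) *
        symm F s Z (Fin.cons (localPt s t) (Fin.cons (localPt s (-t)) z : Fin (m + 1) → ℂ) :
          Fin (m + 2) → ℂ)) (fun j => f j s Z z) := by
  refine exists_expansion_of_gen (fun s t => t ^ (d + 4) * (localWt s t * localWt s (-t)))
    (fun s t z => Fin.cons (localPt s t) (Fin.cons (localPt s (-t)) z : Fin (m + 1) → ℂ))
    (fun k φ b h1 h2 hb => ?_) hF
  obtain ⟨f, hf1, hf2⟩ := exists_expansion_of_scaled
    (((hasScaledExp_basisFn (b 0)).mul (hasScaledExp_basisFn (b 1)).comp_neg).mul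
      (HasScaledExp.const ((-1) ^ (b 1).2))) h1
    (a := Fin.tail (Fin.tail b)) rfl (by
      rcases hb with h | h | h
      · exact Or.inl h
      · exact Or.inr (Or.inl fun i => h i.succ.succ)
      · refine Or.inr (Or.inr ?_)
        rw [if_neg (h 0), zero_mul, zero_mul])
  refine ⟨f, hf1, fun s Z z => ?_⟩
  convert hf2 s Z z using 2 with t
  have hd : d + 4 = k + ∑ i, (Fin.tail (Fin.tail b) i).2 + (((b 0).2 + 2) + ((b 1).2 + 2)) := by
    rw [← h2, Fin.sum_univ_succ, Fin.sum_univ_succ]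
    simp only [Fin.tail, Fin.succ_zero_eq_one]
    ring
  have h5 : (-t) ^ ((b 1).2 + 2) * (-1) ^ (b 1).2 = t ^ ((b 1).2 + 2) := by
    rw [neg_pow t, pow_add (-1 : ℂ), neg_one_sq, mul_one, mul_right_comm, ← mul_pow]
    norm_num
  rw [hd, pow_add, pow_add t ((b 0).2 + 2), ← h5]
  simp only [gen, Fin.prod_univ_succ, Fin.cons_zero, Fin.cons_succ, Fin.tail,
    Fin.succ_zero_eq_one]
  push_cast
  ring

/-! ### The function `y` -/

/-- The function `w ↦ exp (-∑_{k ≥ 1} (Z_k / k) w^k)`, where `Z k` stands for `Z_{k + 1}`. -/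
def expSum (Z : ℕ → ℂ) (w : ℂ) : ℂ :=
  Complex.exp (-∑' k : ℕ, Z k / ((k : ℂ) + 1) * w ^ (k + 1))

/-- The coefficient of `w^n` in `exp (∑_{k ≥ 1} (Z_k / k) w^k)`, by Newton's recursion (the complete
homogeneous symmetric polynomial in terms of power sums). -/
def newtonPoly : ℕ → Scal
  | 0 => 1
  | n + 1 => MvPolynomial.C (1 / ((n : ℚ) + 1)) *
      ∑ i : Fin (n + 1), MvPolynomial.X (some (i : ℕ)) * newtonPoly (n - i)

lemma newtonPoly_homogeneous (n : ℕ) :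
    MvPolynomial.IsWeightedHomogeneous scalDeg (newtonPoly n) (2 * n) := by
  induction n using Nat.strong_induction_on with
  | _ n ih =>
    cases n with
    | zero => rw [newtonPoly]; exact MvPolynomial.isWeightedHomogeneous_one ℚ scalDeg
    | succ n =>
      rw [newtonPoly]
      have h1 : MvPolynomial.IsWeightedHomogeneous scalDeg (∑ i : Fin (n + 1),
          MvPolynomial.X (some (i : ℕ)) * newtonPoly (n - i)) (2 * (n + 1)) := by
        refine MvPolynomial.IsWeightedHomogeneous.sum _ _ _ fun i _ => ?_
        have h2 := (MvPolynomial.isWeightedHomogeneous_X ℚ scalDeg (some (i : ℕ))).mul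
          (ih (n - i) (by omega))
        have h3 : scalDeg (some (i : ℕ)) + 2 * (n - i) = 2 * (n + 1) := by
          simp only [scalDeg]; omega
        rwa [h3] at h2
      simpa using (MvPolynomial.isWeightedHomogeneous_C scalDeg _).mul h1

lemma HasExp.deriv {f : ℂ → ℂ} {c : ℕ → ℂ} (hf : HasExp f c) (ha : AnalyticAt ℂ f 0) :
    HasExp (deriv f) (fun n => ((n : ℂ) + 1) * c (n + 1)) := by
  have h1 := hf.unique (HasExp.of_analyticAt ha)
  convert HasExp.of_analyticAt ha.deriv using 2 with n
  simp only [h1]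
  rw [← iteratedDeriv_succ', Nat.factorial_succ]
  have h2 : ((n : ℂ) + 1) ≠ 0 := by exact_mod_cast Nat.succ_ne_zero n
  have h3 : (n.factorial : ℂ) ≠ 0 := by exact_mod_cast n.factorial_ne_zero
  push_cast
  field_simp

/-- At most exponential growth. -/
def ExpGrowth (Z : ℕ → ℂ) : Prop := ∃ c : ℝ, ∀ k, ‖Z k‖ ≤ c ^ (k + 1)

lemma hasExp_logSeries {Z : ℕ → ℂ} (hZ : ExpGrowth Z) :
    HasExp (fun w => ∑' k : ℕ, Z k / ((k : ℂ) + 1) * w ^ (k + 1))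
      (fun j => if j = 0 then 0 else Z (j - 1) / j) := by
  obtain ⟨c, hc⟩ := hZ
  have hc0 : 0 ≤ c := by simpa using (norm_nonneg _).trans (hc 0)
  have hev : ∀ᶠ w in 𝓝 (0 : ℂ), c * ‖w‖ < 1 := by
    have : ContinuousAt (fun w : ℂ => c * ‖w‖) 0 := by fun_prop
    exact this.eventually_lt_const (by simp)
  refine HasExp.of_eventually ?_
  filter_upwards [hev] with w hw
  have hsum : Summable fun k : ℕ => Z k / ((k : ℂ) + 1) * w ^ (k + 1) := by
    have hg := (summable_nat_add_iff 1).mpr (summable_geometric_of_lt_one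
      (mul_nonneg hc0 (norm_nonneg w)) hw)
    refine Summable.of_norm_bounded hg fun k => ?_
    rw [norm_mul, norm_div, norm_pow, mul_pow]
    refine mul_le_mul_of_nonneg_right ?_ (by positivity)
    refine (div_le_self (norm_nonneg _) ?_).trans (hc k)
    have : ‖(k : ℂ) + 1‖ = (k : ℝ) + 1 := by
      rw [← Nat.cast_add_one, Complex.norm_natCast]; push_cast; rfl
    rw [this]
    have : (0 : ℝ) ≤ k := Nat.cast_nonneg k
    linarith
  have h := (hasSum_nat_add_iff (f := fun j : ℕ =>
    (if j = 0 then 0 else Z (j - 1) / (j : ℂ)) * w ^ j) 1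
    (g := ∑' k : ℕ, Z k / ((k : ℂ) + 1) * w ^ (k + 1))).mp ?_
  · simpa using h
  · refine hsum.hasSum.of_congr fun k => ?_
    simp

/-- The expansion of the reciprocal of `expSum Z`. -/
lemma hasExp_inv_expSum {Z : ℕ → ℂ} (hZ : ExpGrowth Z) (s : Bool) :
    HasExp (fun w => (expSum Z w)⁻¹) (fun n => scalEval s Z (newtonPoly n)) := by
  have hL := hasExp_logSeries hZ
  obtain ⟨φ, hφ, hφ0, hLφ⟩ := hL.exists_analyticAt
  have hLφ' : HasExp φ _ := hL.congr hLφ.symm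
  simp only [if_true] at hφ0
  have ha : AnalyticAt ℂ (fun w => Complex.exp (φ w)) 0 := hφ.cexp
  set d : ℕ → ℂ := fun n => iteratedDeriv n (fun w => Complex.exp (φ w)) 0 / n.factorial with hd
  have hF : HasExp (fun w => Complex.exp (φ w)) d := HasExp.of_analyticAt ha
  have h1 := hF.deriv ha
  have h2 := (hLφ'.deriv hφ).mul hF
  have h3 : HasExp (deriv fun w => Complex.exp (φ w)) _ := h2.congr (by
    filter_upwards [nhdsWithin_le_nhds hφ.eventually_analyticAt] with w hw
    rw [(hw.differentiableAt.hasDerivAt.cexp).deriv]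
    ring)
  have h4 := h1.unique h3
  have hd0 : d 0 = 1 := by simp [hd, hφ0]
  have hdn : ∀ n, d n = scalEval s Z (newtonPoly n) := by
    intro n
    induction n using Nat.strong_induction_on with
    | _ n ih =>
      cases n with
      | zero => rw [hd0, newtonPoly, map_one]
      | succ n =>
        have h5 := congrFun h4 n
        have hn : ((n : ℂ) + 1) ≠ 0 := by exact_mod_cast Nat.succ_ne_zero n
        rw [Finset.Nat.sum_antidiagonal_eq_sum_range_succ_mk] at h5
        rw [newtonPoly, map_mul, map_sum, Fin.sum_univ_eq_sum_range
          (fun i => scalEval s Z (MvPolynomial.X (some i) * newtonPoly (n - i)))]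
        have h6 : ∑ i ∈ Finset.range (n + 1), scalEval s Z (MvPolynomial.X (some i) *
            newtonPoly (n - i)) = ((n : ℂ) + 1) * d (n + 1) := by
          rw [h5]
          refine Finset.sum_congr rfl fun i hi => ?_
          have hi0 : ((i : ℂ) + 1) ≠ 0 := by exact_mod_cast Nat.succ_ne_zero i
          rw [map_mul, ← ih (n - i) (by omega)]
          simp only [scalEval, MvPolynomial.aeval_X, Option.elim_some, Nat.succ_ne_zero, if_false,
            Nat.add_sub_cancel]
          push_cast
          field_simp
        rw [h6]
        simp [scalEval]
        field_simp
  have hdd : d = fun n => scalEval s Z (newtonPoly n) := funext hdn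
  rw [← hdd]
  refine hF.congr ?_
  filter_upwards [hLφ] with w hw
  rw [expSum, ← Complex.exp_neg, neg_neg, hw]

/-- Expansion of `B(t) F(t² A(t))`. -/
lemma HasExp.comp_sq_mul {F A B : ℂ → ℂ} {f a : ℕ → ℂ} {C : ℕ → ℕ → ℂ} (hF : HasExp F f)
    (hA : HasExp A a) (ha0 : a 0 ≠ 0)
    (hC : ∀ n, HasExp (fun t => A t ^ n * B t) (C n)) :
    HasExp (fun t => B t * F (t ^ 2 * A t)) (fun i => ∑ n ∈ Finset.range (i + 1),
      f n * if 2 * n ≤ i then C n (i - 2 * n) else 0) := by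
  obtain ⟨α, hα, hα0, hAα⟩ := hA.exists_analyticAt
  have hin : Tendsto (fun t => t ^ 2 * A t) (𝓝[≠] 0) (𝓝[≠] 0) := by
    have hid : Tendsto (fun t : ℂ => t ^ 2) (𝓝[≠] 0) (𝓝 0) := by
      have : Tendsto (fun t : ℂ => t ^ 2) (𝓝 0) (𝓝 (0 ^ 2)) := (continuous_pow 2).tendsto 0
      rw [zero_pow two_ne_zero] at this
      exact this.mono_left nhdsWithin_le_nhds
    refine tendsto_nhdsWithin_of_tendsto_nhds_of_eventually_within _ ?_ ?_
    · simpa using hid.mul hA.tendsto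
    · filter_upwards [self_mem_nhdsWithin, hA.tendsto.eventually_ne ha0] with t h1 h2
      exact mul_ne_zero (pow_ne_zero 2 h1) h2
  -- for each `i` only the terms of `F` of order at most `i` matter, and the remainder is analytic
  have key : ∀ i, ∃ g : ℕ → ℂ, HasExp (fun t => B t * F (t ^ 2 * A t)) g ∧
      g i = ∑ n ∈ Finset.range (i + 1), f n * if 2 * n ≤ i then C n (i - 2 * n) else 0 := by
    intro i
    obtain ⟨Φ, hΦ, hrem⟩ := hF.exists_remainder (i + 1)
    have hcomp : AnalyticAt ℂ (fun t => Φ (t ^ 2 * α t)) 0 := by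
      have h1 : AnalyticAt ℂ (fun t => t ^ 2 * α t) 0 := (analyticAt_id.pow 2).mul hα
      have h2 : AnalyticAt ℂ Φ ((fun t => t ^ 2 * α t) 0) := by simpa using hΦ
      exact h2.comp (f := fun t => t ^ 2 * α t) h1
    have h1 := HasExp.of_analyticAt hcomp
    have h2 := HasExp.sum (Finset.range (i + 1)) fun n _ => ((hC n).pow_mul (2 * n)).const_mul (f n)
    have h3 := ((hC (i + 1)).mul h1).pow_mul (2 * (i + 1))
    refine ⟨_, (h2.add h3).congr ?_, ?_⟩
    · filter_upwards [hin.eventually hrem, hAα] with t h4 h5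
      rw [h4, ← h5, mul_add, Finset.mul_sum]
      congr 1
      · refine Finset.sum_congr rfl fun n _ => ?_
        rw [mul_pow, _root_.pow_mul]; ring
      · rw [mul_pow, _root_.pow_mul]; ring
    · rw [if_neg (by omega : ¬ 2 * (i + 1) ≤ i), add_zero]
  choose g hg1 hg2 using key
  have h0 : g 0 = fun i => ∑ n ∈ Finset.range (i + 1),
      f n * if 2 * n ≤ i then C n (i - 2 * n) else 0 := by
    funext i
    rw [← hg2 i, (hg1 0).unique (hg1 i)]
  rw [← h0]
  exact hg1 0

/-- The two spectral curves. -/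
def crv (s : Bool) (y : ℂ → ℂ) : SpectralCurve :=
  match s with
  | true => joukowskyCurve y
  | false => squareCurve y

/-- The branch point at which local expansions are taken. -/
def brPt : Bool → ℂ
  | true => 1
  | false => 0

/-- `y` is the function of the spectral curve with parameters `Z`, near the branch points. Only the
germs of `y` there matter, and Okuyama's infinite product has this form only there. -/
def Valid (s : Bool) (y : ℂ → ℂ) (Z : ℕ → ℂ) : Prop :=
  ExpGrowth Z ∧
  match s with
  | true => ∀ χ : ℤˣ, ∀ᶠ z in 𝓝 ((χ : ℤ) : ℂ),
      y z = 1 / 2 * (z - z⁻¹) * expSum Z ((z - z⁻¹) ^ 2)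
  | false => ∀ᶠ z in 𝓝 0, y z = z * expSum Z (4 * z ^ 2)

/-- The denominator of the recursion kernel. -/
def kernelDen (s : Bool) (y : ℂ → ℂ) (p : ℂ) : ℂ :=
  (crv s y).y p * deriv (crv s y).x p -
    (crv s y).y ((crv s y).σ (brPt s) p) * deriv (crv s y).x ((crv s y).σ (brPt s) p) *
      deriv ((crv s y).σ (brPt s)) p

/-- The function `4 sinh(t)² / t²`, and its limit `4`. -/
def sqFactor : Bool → ℂ → ℂ
  | true, t => ((Complex.exp t - Complex.exp (-t)) / t) ^ 2
  | false, _ => 4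

lemma hasScaledExp_sqFactor : HasScaledExp sqFactor 4 := by
  refine ⟨?_, ?_⟩
  · have := hasRatExp_sinh.pow 2
    norm_num at this
    exact this
  · refine Eventually.of_forall fun t => ?_
    simp [sqFactor]

lemma HasScaledExp.inv {g : Bool → ℂ → ℂ} {p : ℚ} (hg : HasScaledExp g p) (hp : p ≠ 0) :
    HasScaledExp (fun s t => (g s t)⁻¹) p⁻¹ := by
  refine ⟨hg.1.inv hp, ?_⟩
  filter_upwards [hg.2] with t h1
  rw [h1]; push_cast; rfl

lemma HasScaledExp.pow {g : Bool → ℂ → ℂ} {p : ℚ} (hg : HasScaledExp g p) (n : ℕ) :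
    HasScaledExp (fun s t => g s t ^ n) (p ^ n) := by
  refine ⟨hg.1.pow n, ?_⟩
  filter_upwards [hg.2] with t h1
  rw [h1]; push_cast; rfl

lemma tendsto_localPt_true : Tendsto (fun t => Complex.exp (-t)) (𝓝 0) (𝓝 1) := by
  have : Continuous fun t : ℂ => Complex.exp (-t) := by fun_prop
  simpa using this.tendsto 0

lemma kernelDen_true {y : ℂ → ℂ} {Z : ℕ → ℂ} (h : Valid true y Z) : ∀ᶠ p in 𝓝 (1 : ℂ),
    p * kernelDen true y p = (p - p⁻¹) ^ 2 * expSum Z ((p - p⁻¹) ^ 2) := by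
  have h1 := h.2 1
  simp only [Units.val_one, Int.cast_one] at h1
  have hinv : Tendsto (fun p : ℂ => p⁻¹) (𝓝 1) (𝓝 1) := by
    have := (continuousAt_inv₀ (one_ne_zero (α := ℂ))).tendsto
    rwa [inv_one] at this
  filter_upwards [h1, hinv.eventually h1, isOpen_ne.mem_nhds (one_ne_zero (α := ℂ))] with p h2 h3 h4
  have h4' : p ≠ 0 := h4
  have hx : ∀ w : ℂ, w ≠ 0 → deriv (joukowskyCurve y).x w = 1 - (w ^ 2)⁻¹ :=
    fun w hw => deriv_add_inv hw
  have hσ : deriv ((joukowskyCurve y).σ (brPt true)) p = -(p ^ 2)⁻¹ := deriv_inv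
  have hσ' : (joukowskyCurve y).σ (brPt true) p = p⁻¹ := rfl
  have hy : (joukowskyCurve y).y = y := rfl
  simp only [kernelDen, crv]
  rw [hσ, hσ', hy, hx p h4', hx _ (inv_ne_zero h4'), h2, h3]
  rw [inv_inv, ← neg_sub p p⁻¹, neg_sq]
  generalize expSum Z ((p - p⁻¹) ^ 2) = E
  field_simp
  ring

lemma kernelDen_false {y : ℂ → ℂ} {Z : ℕ → ℂ} (h : Valid false y Z) : ∀ᶠ p in 𝓝 (0 : ℂ),
    kernelDen false y p = 2 * p ^ 2 * expSum Z (4 * p ^ 2) := by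
  have h1 : ∀ᶠ z in 𝓝 (0 : ℂ), y z = z * expSum Z (4 * z ^ 2) := h.2
  have hneg : Tendsto (fun p : ℂ => -p) (𝓝 0) (𝓝 0) := by
    simpa using (continuous_neg (G := ℂ)).tendsto 0
  filter_upwards [h1, hneg.eventually h1] with p h2 h3
  have hx : ∀ w : ℂ, deriv (squareCurve y).x w = w := by
    intro w
    have : HasDerivAt (fun z : ℂ => z ^ 2 / 2) (2 * w / 2) w := by
      simpa using (hasDerivAt_pow 2 w).div_const 2
    change deriv (fun z : ℂ => z ^ 2 / 2) w = w
    rw [this.deriv]; ring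
  have hσ : deriv ((squareCurve y).σ (brPt false)) p = -1 := (hasDerivAt_neg p).deriv
  have hσ' : (squareCurve y).σ (brPt false) p = -p := rfl
  have hy : (squareCurve y).y = y := rfl
  simp only [kernelDen, crv]
  rw [hσ, hσ', hy, hx, hx, h2, h3, neg_sq]
  ring

/-- The expansion of the reciprocal of the denominator of the recursion kernel: its coefficients
are homogeneous polynomials in the parameters, the same ones for both curves. For `x = z² / 2` the
denominator is half the leading term of that for `x = z + 1/z`, which accounts for the factor
`2`. -/
lemma exists_kernelDen_expansion : ∃ κ : ℕ → Scal,
    (∀ i, MvPolynomial.IsWeightedHomogeneous scalDeg (κ i) i) ∧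
    ∀ s y Z, Valid s y Z → HasExp (fun t => t ^ 2 *
      ((if s then 1 else 2) * (localWt s t * kernelDen s y (localPt s t)))⁻¹)
      (fun i => scalEval s Z (κ i)) := by
  have hsc : ∀ n, HasScaledExp (fun s t => sqFactor s t ^ n * (sqFactor s t)⁻¹) (4 ^ n * 4⁻¹) :=
    fun n => (hasScaledExp_sqFactor.pow n).mul (hasScaledExp_sqFactor.inv (by norm_num))
  choose ψ hψ _ hψe using fun n => (hsc n).exists_scal
  refine ⟨fun i => ∑ n ∈ Finset.range (i + 1), newtonPoly n *
    if 2 * n ≤ i then ψ n (i - 2 * n) else 0, fun i => ?_, fun s y Z hv => ?_⟩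
  · refine MvPolynomial.IsWeightedHomogeneous.sum _ _ _ fun n _ => ?_
    by_cases h : 2 * n ≤ i
    · rw [if_pos h]
      have := (newtonPoly_homogeneous n).mul (hψ n (i - 2 * n))
      rwa [Nat.add_sub_cancel' h] at this
    · rw [if_neg h, mul_zero]; exact MvPolynomial.isWeightedHomogeneous_zero _ _ _
  · have hF := hasExp_inv_expSum hv.1 s
    obtain ⟨A, -, -, hA⟩ := hasScaledExp_sqFactor.exists_scal
    have hA0 : scalEval s Z (A 0) ≠ 0 := by
      have h1 := (hA s Z).tendsto
      have h2 : Tendsto (sqFactor s) (𝓝[≠] 0) (𝓝 4) := by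
        cases s
        · exact tendsto_const_nhds
        · obtain ⟨x, hx, hx'⟩ := hasScaledExp_sqFactor.1
          have := hx'.tendsto
          rw [hx] at this
          simpa using this
      rw [tendsto_nhds_unique h1 h2]
      norm_num
    have h := hF.comp_sq_mul (hA s Z) hA0 (fun n => hψe n s Z)
    convert h.congr (g := fun t => t ^ 2 *
      ((if s then 1 else 2) * (localWt s t * kernelDen s y (localPt s t)))⁻¹) ?_ using 2 with i
    · rw [map_sum]
      refine Finset.sum_congr rfl fun n _ => ?_
      rw [map_mul]
      split_ifs <;> simp
    · cases s
      · filter_upwards [nhdsWithin_le_nhds (kernelDen_false hv), self_mem_nhdsWithin] with t h1 ht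
        have ht0 : t ≠ 0 := ht
        simp only [localWt, localPt, sqFactor, h1]
        rw [mul_comm (t ^ 2) 4]
        simp only [Bool.false_eq_true, if_false]
        rw [one_mul, mul_inv, mul_inv, mul_inv]
        generalize (expSum Z (4 * t ^ 2))⁻¹ = E
        field_simp
        norm_num
        ring
      · filter_upwards [nhdsWithin_le_nhds (tendsto_localPt_true.eventually (kernelDen_true hv)),
          self_mem_nhdsWithin] with t h1 ht
        have ht0 : t ≠ 0 := ht
        have h2 : (Complex.exp (-t) - (Complex.exp (-t))⁻¹) ^ 2 =
            t ^ 2 * ((Complex.exp t - Complex.exp (-t)) / t) ^ 2 := by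
          rw [← Complex.exp_neg, neg_neg]
          field_simp
          ring
        simp only [localWt, localPt, sqFactor, if_true, one_mul]
        rw [h1, h2, mul_inv, mul_inv]
        generalize (expSum Z _)⁻¹ = E
        field_simp

/-! ### The recursion in the local coordinate -/

/-- The bracket in the recursion formula at the branch point `α`. -/
def SpectralCurve.bracket (C : SpectralCurve) (α : ℂ) (g m : ℕ) (p : ℂ) (z : Fin m → ℂ) : ℂ :=
  (if 0 < g then
      C.corr (g - 1) (m + 1) p (Fin.cons (C.σ α p) z) * deriv (C.σ α) p
    else 0) +
  ∑ h : Fin (g + 1), ∑ I : Finset (Fin m),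
    if ¬ ((h : ℕ) = 0 ∧ I.card = 0) ∧ ¬ (g - (h : ℕ) = 0 ∧ Iᶜ.card = 0) then
      C.corr h I.card p (pick z I) *
        (C.corr (g - h) Iᶜ.card (C.σ α p) (pick z Iᶜ) * deriv (C.σ α) p)
    else 0

lemma SpectralCurve.corr_eq (C : SpectralCurve) {g m : ℕ} (h0 : ¬ (g = 0 ∧ m = 0))
    (h1 : ¬ (g = 0 ∧ m = 1)) (p₁ : ℂ) (z : Fin m → ℂ) :
    C.corr g m p₁ z =
      ∑ α ∈ C.branch, residue (fun p => C.kernel α p₁ p * C.bracket α g m p z) α := by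
  rw [SpectralCurve.corr, if_neg h0, dif_neg h1]
  simp only [SpectralCurve.bracket, dite_eq_ite]

lemma SpectralCurve.corr_zero_one (C : SpectralCurve) (p₁ : ℂ) (z : Fin 1 → ℂ) :
    C.corr 0 1 p₁ z = 1 / (p₁ - z 0) ^ 2 := by
  rw [SpectralCurve.corr]
  simp

/-- The correlation differentials, with the power of `2` removed that comes from the factor `2`
between the denominators of the two recursion kernels. -/
def normCorr (s : Bool) (y : ℂ → ℂ) (g m : ℕ) (p : ℂ) (z : Fin m → ℂ) : ℂ :=
  (crv s y).corr g m p z / if s then 1 else 2 ^ (2 * g + m - 1)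

/-- `t ^ N * L t` has an expansion in `t` whose coefficient of `t ^ j` is a homogeneous family of
degree `j`. -/
def HasLocalRep {m : ℕ} (N : ℕ) (L : Bool → (ℂ → ℂ) → ℂ → (Fin m → ℂ) → ℂ) : Prop :=
  ∃ f : ℕ → Fam (Fin m), (∀ j, f j ∈ homFam (Fin m) j) ∧
    ∀ s y Z, Valid s y Z → ∀ z, (∀ i, Regular s (z i)) →
      HasExp (fun t => t ^ N * L s y t z) (fun j => f j s Z z)

lemma HasLocalRep.zero {m : ℕ} (N : ℕ) : HasLocalRep N (fun _ _ _ (_ : Fin m → ℂ) => (0 : ℂ)) :=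
  ⟨fun _ => 0, fun _ => zero_mem _, fun s y Z _ z _ => by simpa using HasExp.zero⟩

lemma HasLocalRep.add {m N : ℕ} {L L' : Bool → (ℂ → ℂ) → ℂ → (Fin m → ℂ) → ℂ}
    (h : HasLocalRep N L) (h' : HasLocalRep N L') :
    HasLocalRep N (fun s y t z => L s y t z + L' s y t z) := by
  obtain ⟨f, hf1, hf2⟩ := h
  obtain ⟨f', hf1', hf2'⟩ := h'
  refine ⟨fun j => f j + f' j, fun j => add_mem (hf1 j) (hf1' j), fun s y Z hv z hz => ?_⟩
  refine ((hf2 s y Z hv z hz).add (hf2' s y Z hv z hz)).congr (Eventually.of_forall fun t => ?_)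
  simp only; ring

lemma HasLocalRep.sum {m N : ℕ} {ι : Type} (S : Finset ι)
    {L : ι → Bool → (ℂ → ℂ) → ℂ → (Fin m → ℂ) → ℂ}
    (h : ∀ i ∈ S, HasLocalRep N (L i)) :
    HasLocalRep N (fun s y t z => ∑ i ∈ S, L i s y t z) := by
  classical
  induction S using Finset.induction_on with
  | empty => simpa using HasLocalRep.zero N
  | insert a S ha ih =>
    simp only [Finset.sum_insert ha]
    exact (h a (Finset.mem_insert_self _ _)).add
      (ih fun i hi => h i (Finset.mem_insert_of_mem hi))

/-- The product of an expansion at `t` and an expansion at `-t`, in complementary sets of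
points. -/
lemma HasLocalRep.pick_mul {m N N' : ℕ} (I : Finset (Fin m))
    {L : Bool → (ℂ → ℂ) → ℂ → (Fin I.card → ℂ) → ℂ}
    {L' : Bool → (ℂ → ℂ) → ℂ → (Fin Iᶜ.card → ℂ) → ℂ}
    (h : HasLocalRep N L) (h' : HasLocalRep N' L') (hN' : Even N') :
    HasLocalRep (N + N') (fun s y t z => L s y t (pick z I) * L' s y (-t) (pick z Iᶜ)) := by
  obtain ⟨f, hf1, hf2⟩ := h
  obtain ⟨f', hf1', hf2'⟩ := h'
  refine ⟨fun j => ∑ kl ∈ Finset.HasAntidiagonal.antidiagonal j, fun s Z z =>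
    f kl.1 s Z (pick z I) * ((-1 : ℤ) ^ kl.2 • f' kl.2) s Z (pick z Iᶜ), fun j => ?_,
    fun s y Z hv z hz => ?_⟩
  · refine sum_mem fun kl hkl => ?_
    rw [← Finset.HasAntidiagonal.mem_antidiagonal.mp hkl]
    exact pick_mul_mem I (hf1 _) (AddSubgroup.zsmul_mem _ (hf1' _) _)
  · have h1 := hf2 s y Z hv (pick z I) (fun i => hz _)
    have h2 := (hf2' s y Z hv (pick z Iᶜ) (fun i => hz _)).comp_neg
    convert h1.mul h2 using 2 with t j
    · rw [hN'.neg_pow, pow_add]; ring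
    · simp only [Finset.sum_apply, Pi.smul_apply]
      refine Finset.sum_congr rfl fun kl _ => ?_
      simp

lemma eventually_regular (s : Bool) : ∀ᶠ t in 𝓝[≠] (0 : ℂ), Regular s (localPt s t) := by
  cases s
  · filter_upwards [self_mem_nhdsWithin] with t ht using ht
  · obtain ⟨x, hx, h⟩ := hasRatExp_one_sub_exp_neg
    have h1 := h.tendsto
    rw [hx] at h1
    have h2 := h1.eventually_ne (b₂ := 0) (by norm_num)
    have h3 := tendsto_localPt_true.eventually_ne (b₂ := -1) (by norm_num)
    filter_upwards [h2, nhdsWithin_le_nhds h3] with t h4 h5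
    refine ⟨fun h6 => h4 ?_, h5⟩
    have : Complex.exp (-t) = 1 := h6
    rw [this]; simp

/-- The correlation differentials are obtained from a homogeneous family by symmetrization. -/
def IsHomogeneousCorr (g m : ℕ) : Prop :=
  ∃ F ∈ homFam (Fin (m + 1)) (6 * g + 2 * m - 4), ∀ s y Z, Valid s y Z → ∀ p z, Regular s p →
    (∀ i, Regular s (z i)) →
      normCorr s y g m p z = symm F s Z (Fin.cons p z : Fin (m + 1) → ℂ)

/-- What the recursion needs to know about a correlation differential: its local expansion in the
first point, and its behaviour under `z ↦ -z`. Unlike `IsHomogeneousCorr` this includes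
`ω_{0,2} = B`, which has no pole at the branch points. -/
def IsLocallyHomogeneous (g m : ℕ) : Prop :=
  HasLocalRep (6 * g + 2 * m - 2)
      (fun s y t z => localWt s t * normCorr s y g m (localPt s t) z) ∧
    ∀ y Z, Valid true y Z → ∀ p (z : Fin m → ℂ), Regular true p → (∀ i, Regular true (z i)) →
      (crv true y).corr g m (-p) (-z) = (-1) ^ (m + 1) * (crv true y).corr g m p z

lemma Regular.neg {z : ℂ} (h : Regular true z) : Regular true (-z) :=
  ⟨fun h1 => h.2 (by rw [← h1, neg_neg]), fun h1 => h.1 (neg_injective h1)⟩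

lemma IsHomogeneousCorr.isLocallyHomogeneous {g m : ℕ} (hgm : 1 ≤ g ∨ 2 ≤ m)
    (h : IsHomogeneousCorr g m) : IsLocallyHomogeneous g m := by
  obtain ⟨F, hF, h⟩ := h
  refine ⟨?_, fun y Z hv p z hp hz => ?_⟩
  · obtain ⟨f, hf1, hf2⟩ := exists_expansion_one hF
    refine ⟨f, hf1, fun s y Z hv z hz => (hf2 s Z z).congr ?_⟩
    have hd : 6 * g + 2 * m - 2 = 6 * g + 2 * m - 4 + 2 := by omega
    filter_upwards [eventually_regular s] with t ht
    rw [h s y Z hv _ z ht hz, hd, mul_assoc]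
  · have h1 := h true y Z hv p z hp hz
    have h2 := h true y Z hv (-p) (-z) hp.neg (fun i => (hz i).neg)
    have h3 : (Fin.cons (-p) (-z) : Fin (m + 1) → ℂ) = -(Fin.cons p z : Fin (m + 1) → ℂ) := by
      funext i
      cases i using Fin.cases <;> simp
    rw [h3, symm_true_neg, ← h1] at h2
    simpa [normCorr] using h2

lemma isLocallyHomogeneous_zero_one : IsLocallyHomogeneous 0 1 := by
  refine ⟨⟨fun j => gen (MvPolynomial.C (1 / (j.factorial : ℚ))) fun _ => (1, j), fun j => ?_,
    fun s y Z hv z hz => ?_⟩, fun y Z hv p z hp hz => ?_⟩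
  · exact gen_mem_homFam
      ⟨⟨0, MvPolynomial.isWeightedHomogeneous_C _ _, by simp⟩, Or.inl fun _ => rfl⟩
  · convert hasExp_bidifferential s (hz 0) using 2 with t j
    · simp [normCorr, SpectralCurve.corr_zero_one]
    · simp [gen, scalEval]
      ring
  · rw [SpectralCurve.corr_zero_one, SpectralCurve.corr_zero_one]
    have : -p - (-z) 0 = -(p - z 0) := by simp; ring
    rw [this, neg_sq]; norm_num

/-- The unstable case `(0, 1)`, the bidifferential, is only locally homogeneous. -/
lemma isLocallyHomogeneous_of_lt {g m : ℕ}
    (ih : ∀ g' m', 2 * g' + m' < 2 * g + m → (1 ≤ g' ∨ 2 ≤ m') → IsHomogeneousCorr g' m')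
    (g' m' : ℕ) (h1 : 2 * g' + m' < 2 * g + m) (h2 : ¬ (g' = 0 ∧ m' = 0)) :
    IsLocallyHomogeneous g' m' := by
  by_cases h3 : g' = 0 ∧ m' = 1
  · obtain ⟨rfl, rfl⟩ := h3
    exact isLocallyHomogeneous_zero_one
  · have h4 : 1 ≤ g' ∨ 2 ≤ m' := by omega
    exact (ih g' m' h1 h4).isLocallyHomogeneous h4

lemma localWt_mul_neg (s : Bool) (t : ℂ) : localWt s t * localWt s (-t) = 1 := by
  cases s
  · simp [localWt]
  · simp [localWt, ← Complex.exp_add]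

lemma σ_localPt (s : Bool) (y : ℂ → ℂ) (t : ℂ) :
    (crv s y).σ (brPt s) (localPt s t) = localPt s (-t) := by
  cases s
  · rfl
  · change (Complex.exp (-t))⁻¹ = Complex.exp (- -t)
    rw [← Complex.exp_neg]

/-- The bracket in the local coordinate, with a sign and normalized like `normCorr`. For
`x = z + 1/z` the factor `-p²` is the reciprocal of `σ'(p)`. -/
def normBracket (s : Bool) (y : ℂ → ℂ) (g m : ℕ) (t : ℂ) (z : Fin m → ℂ) : ℂ :=
  (crv s y).bracket (brPt s) g m (localPt s t) z *
    if s then -(localPt s t) ^ 2 else -(1 / 2 ^ (2 * g + m - 2))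

lemma deriv_σ_true (y : ℂ → ℂ) (t : ℂ) :
    deriv ((crv true y).σ (brPt true)) (localPt true t) * -(localPt true t) ^ 2 = 1 := by
  have hσ : deriv ((crv true y).σ (brPt true)) (localPt true t) = -(localPt true t ^ 2)⁻¹ :=
    deriv_inv
  have h0 : localPt true t ≠ 0 := Complex.exp_ne_zero _
  rw [hσ]
  field_simp

lemma deriv_σ_false (y : ℂ → ℂ) (p : ℂ) : deriv ((crv false y).σ (brPt false)) p = -1 :=
  (hasDerivAt_neg p).deriv

lemma normBracket_eq (s : Bool) (y : ℂ → ℂ) {g m : ℕ} (t : ℂ)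
    (z : Fin m → ℂ) :
    normBracket s y g m t z =
      (if 0 < g then localWt s t * localWt s (-t) * normCorr s y (g - 1) (m + 1) (localPt s t)
          (Fin.cons (localPt s (-t)) z) else 0) +
      ∑ h : Fin (g + 1), ∑ I : Finset (Fin m),
        if ¬ ((h : ℕ) = 0 ∧ I.card = 0) ∧ ¬ (g - (h : ℕ) = 0 ∧ Iᶜ.card = 0) then
          localWt s t * normCorr s y h I.card (localPt s t) (pick z I) *
            (localWt s (-t) * normCorr s y (g - h) Iᶜ.card (localPt s (-t)) (pick z Iᶜ))
        else 0 := by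
  simp only [normBracket, SpectralCurve.bracket, add_mul, Finset.sum_mul, ite_mul, zero_mul,
    σ_localPt, localWt_mul_neg, one_mul]
  congr 1
  · refine ite_congr rfl (fun hg => ?_) (fun _ => rfl)
    cases s
    · have h1 : 2 * (g - 1) + (m + 1) - 1 = 2 * g + m - 2 := by omega
      rw [deriv_σ_false]
      simp only [normCorr, h1, Bool.false_eq_true, if_false]
      ring
    · rw [if_pos rfl, mul_assoc, deriv_σ_true]
      simp [normCorr]
  · refine Finset.sum_congr rfl fun h _ => Finset.sum_congr rfl fun I _ => ?_
    refine ite_congr rfl (fun hI => ?_) (fun _ => rfl)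
    have h2 := localWt_mul_neg s t
    cases s
    · have hI' : I.card + Iᶜ.card = m := by simp
      have hh := h.isLt
      have h1 : (2 : ℂ) ^ (2 * g + m - 2) =
          2 ^ (2 * (h : ℕ) + I.card - 1) * 2 ^ (2 * (g - h) + Iᶜ.card - 1) := by
        rw [← pow_add]; congr 1; omega
      rw [deriv_σ_false]
      simp only [normCorr, h1, Bool.false_eq_true, if_false]
      simp only [localWt]
      field_simp
    · have h1 := deriv_σ_true y t
      simp only [normCorr, if_true, div_one]
      linear_combination (crv true y).corr h I.card (localPt true t) (pick z I) *
        (crv true y).corr (g - h) Iᶜ.card (localPt true (-t)) (pick z Iᶜ) * (h1 - h2)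

/-- `t² B(p, σ(p))`, up to sign. -/
lemma hasScaledExp_diagonal :
    HasScaledExp (fun s t => t ^ 2 * (1 / (localPt s t - localPt s (-t)) ^ 2)) (4⁻¹) := by
  refine (hasScaledExp_sqFactor.inv (by norm_num)).congr fun s => ?_
  filter_upwards [self_mem_nhdsWithin] with t ht
  have ht0 : t ≠ 0 := ht
  cases s
  · simp only [localPt, sqFactor]
    rw [sub_neg_eq_add, ← two_mul]
    field_simp
    norm_num
  · simp only [localPt, sqFactor, neg_neg]
    rw [← neg_sub (Complex.exp t), neg_sq, div_pow, inv_div]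
    ring

/-- The bracket has homogeneous expansion coefficients if the lower correlation differentials
have. -/
lemma hasLocalRep_normBracket {g m : ℕ} (hgm : 1 ≤ g ∨ 2 ≤ m)
    (ih : ∀ g' m', 2 * g' + m' < 2 * g + m → (1 ≤ g' ∨ 2 ≤ m') → IsHomogeneousCorr g' m') :
    HasLocalRep (6 * g + 2 * m - 4) (fun s y t z => normBracket s y g m t z) := by
  have ih' := isLocallyHomogeneous_of_lt ih
  simp only [normBracket_eq]
  refine HasLocalRep.add ?_ (HasLocalRep.sum _ fun h _ => HasLocalRep.sum _ fun I _ => ?_)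
  · by_cases hg : 0 < g
    · simp only [hg, if_true]
      by_cases h1 : g = 1 ∧ m = 0
      · obtain ⟨rfl, rfl⟩ := h1
        obtain ⟨f, hf1, hf2⟩ := exists_expansion_of_scaled (m := 0) (r := 0) (k := 0)
          hasScaledExp_diagonal (MvPolynomial.isWeightedHomogeneous_one ℚ scalDeg)
          (a := Fin.elim0) (by simp) (Or.inr (Or.inl fun i => i.elim0))
        refine ⟨f, hf1, fun s y Z hv z hz => ?_⟩
        convert hf2 s Z z using 2 with t
        simp [normCorr, localWt_mul_neg, gen, SpectralCurve.corr_zero_one]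
      · obtain ⟨F, hF, h2⟩ := ih (g - 1) (m + 1) (by omega) (by omega)
        obtain ⟨f, hf1, hf2⟩ := exists_expansion_two hF
        refine ⟨f, hf1, fun s y Z hv z hz => (hf2 s Z z).congr ?_⟩
        have hd : 6 * g + 2 * m - 4 = 6 * (g - 1) + 2 * (m + 1) - 4 + 4 := by omega
        filter_upwards [eventually_regular s,
          tendsto_neg_punctured.eventually (eventually_regular s)] with t ht ht'
        rw [h2 s y Z hv _ _ ht, hd]
        · ring
        · intro i
          cases i using Fin.cases with
          | zero => exact ht'
          | succ i => exact hz i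
    · simp only [hg, if_false]
      exact HasLocalRep.zero _
  · by_cases hI : ¬ ((h : ℕ) = 0 ∧ I.card = 0) ∧ ¬ (g - (h : ℕ) = 0 ∧ Iᶜ.card = 0)
    · simp only [if_pos hI]
      have hI' : I.card + Iᶜ.card = m := by simp
      have hh := h.isLt
      have h1 := (ih' h I.card (by omega) hI.1).1
      have h2 := (ih' (g - h) Iᶜ.card (by omega) hI.2).1
      have h3 := HasLocalRep.pick_mul I h1 h2
        (by rw [Nat.even_sub (by omega)]; simp [parity_simps])
      have hd : 6 * (h : ℕ) + 2 * I.card - 2 + (6 * (g - h) + 2 * Iᶜ.card - 2) =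
          6 * g + 2 * m - 4 := by omega
      rwa [hd] at h3
    · simp only [if_neg hI]
      exact HasLocalRep.zero _

/-! ### The recursion step -/

/-- The brackets at the two branch points of `x = z + 1/z` are exchanged by `z ↦ -z`. -/
lemma crv_bracket_neg (y : ℂ → ℂ) {Z : ℕ → ℂ} (hv : Valid true y Z) {g m : ℕ}
    (ih : ∀ g' m', 2 * g' + m' < 2 * g + m → ¬ (g' = 0 ∧ m' = 0) → IsLocallyHomogeneous g' m')
    {p : ℂ} (hp : Regular true p) (z : Fin m → ℂ) (hz : ∀ i, Regular true (z i)) :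
    (crv true y).bracket (-1) g m (-p) z = (-1) ^ m * (crv true y).bracket 1 g m p (-z) := by
  have hσ : ∀ α q, (crv true y).σ α q = q⁻¹ := fun _ _ => rfl
  have hσ' : ∀ α q, deriv ((crv true y).σ α) q = -(q ^ 2)⁻¹ := fun _ _ => deriv_inv
  have hp' : Regular true p⁻¹ := by
    refine ⟨fun h => hp.1 ?_, fun h => hp.2 ?_⟩
    · rw [inv_eq_one] at h; exact h
    · rw [← inv_inv p, h]; norm_num
  have hz' : ∀ i, Regular true ((-z) i) := fun i => (hz i).neg
  simp only [SpectralCurve.bracket, hσ, hσ', mul_add, Finset.mul_sum, mul_ite, mul_zero, neg_sq,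
    inv_neg]
  congr 1
  · refine ite_congr rfl (fun hg => ?_) (fun _ => rfl)
    have h1 : (Fin.cons (-p⁻¹) z : Fin (m + 1) → ℂ) = -(Fin.cons p⁻¹ (-z) : Fin (m + 1) → ℂ) := by
      funext i
      cases i using Fin.cases <;> simp
    rw [h1, (ih (g - 1) (m + 1) (by omega) (by omega)).2 y Z hv p _ hp]
    · rw [pow_succ, pow_succ]; ring
    · intro i
      cases i using Fin.cases with
      | zero => exact hp'
      | succ i => exact hz' i
  · refine Finset.sum_congr rfl fun h _ => Finset.sum_congr rfl fun I _ => ?_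
    refine ite_congr rfl (fun hI => ?_) (fun _ => rfl)
    have hI' : I.card + Iᶜ.card = m := by simp
    have hh := h.isLt
    have h1 : ∀ J : Finset (Fin m), pick z J = -pick (-z) J := by
      intro J; funext i; simp [pick]
    rw [h1 I, h1 Iᶜ, (ih h I.card (by omega) hI.1).2 y Z hv p (pick (-z) I) hp
      fun i => hz' _,
      (ih (g - h) Iᶜ.card (by omega) hI.2).2 y Z hv p⁻¹ (pick (-z) Iᶜ) hp'
      fun i => hz' _, pow_succ, pow_succ]
    have h2 : (-1 : ℂ) ^ m = (-1) ^ I.card * (-1) ^ Iᶜ.card := by rw [← pow_add, hI']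
    rw [h2]
    ring

lemma kernel_eq (s : Bool) (y : ℂ → ℂ) (p₁ p : ℂ) : (crv s y).kernel (brPt s) p₁ p =
    1 / 2 * (1 / (p₁ - (crv s y).σ (brPt s) p) - 1 / (p₁ - p)) / kernelDen s y p := rfl

/-- The two recursion kernels of `x = z + 1/z` are exchanged by `z ↦ -z`. -/
lemma kernel_neg {y : ℂ → ℂ} {Z : ℕ → ℂ} (hv : Valid true y Z) (p₁ : ℂ) : ∀ᶠ p in 𝓝 (1 : ℂ),
    (crv true y).kernel (-1) p₁ (-p) = (crv true y).kernel 1 (-p₁) p := by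
  have h1 := hv.2 1
  have h1' := hv.2 (-1)
  simp only [Units.val_one, Int.cast_one, Units.val_neg, Int.cast_neg] at h1 h1'
  have hinv : Tendsto (fun p : ℂ => p⁻¹) (𝓝 1) (𝓝 1) := by
    have := (continuousAt_inv₀ (one_ne_zero (α := ℂ))).tendsto
    rwa [inv_one] at this
  have hneg : Tendsto (fun p : ℂ => -p) (𝓝 1) (𝓝 (-1)) := (continuous_neg (G := ℂ)).tendsto 1
  have hodd : ∀ᶠ p in 𝓝 (1 : ℂ), y (-p) = -y p := by
    filter_upwards [h1, hneg.eventually h1'] with p h2 h3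
    rw [h2, h3, inv_neg, ← neg_sub' p, neg_sq]; ring
  filter_upwards [hodd, hinv.eventually hodd, isOpen_ne.mem_nhds (one_ne_zero (α := ℂ))]
    with p h2 h3 h4
  have h4' : p ≠ 0 := h4
  have hx : ∀ w : ℂ, w ≠ 0 → deriv (crv true y).x w = 1 - (w ^ 2)⁻¹ :=
    fun w hw => deriv_add_inv hw
  have hσ : ∀ α q, (crv true y).σ α q = q⁻¹ := fun _ _ => rfl
  have hσ' : ∀ α q, deriv ((crv true y).σ α) q = -(q ^ 2)⁻¹ := fun _ _ => deriv_inv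
  have hy : (crv true y).y = y := rfl
  simp only [SpectralCurve.kernel, hσ, hσ', hy]
  rw [inv_neg, h2, h3, hx _ h4', hx _ (neg_ne_zero.mpr h4'), hx _ (inv_ne_zero h4'),
    hx _ (neg_ne_zero.mpr (inv_ne_zero h4')), neg_sq, neg_sq]
  have h5 : p₁ - -p⁻¹ = -(-p₁ - p⁻¹) := by ring
  have h6 : p₁ - -p = -(-p₁ - p) := by ring
  rw [h5, h6, one_div_neg_eq_neg_one_div, one_div_neg_eq_neg_one_div, ← neg_div_neg_eq]
  congr 1
  · ring
  · ring

/-- The local coordinate, as a function of the point: the inverse of `localPt`. -/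
def localCoord : Bool → ℂ → ℂ
  | true, p => -Complex.log p
  | false, p => p

lemma analyticAt_localCoord (s : Bool) : AnalyticAt ℂ (localCoord s) (brPt s) := by
  cases s
  · exact analyticAt_id
  · exact (analyticAt_clog (by simp [brPt])).neg

lemma localCoord_brPt (s : Bool) : localCoord s (brPt s) = 0 := by
  cases s <;> simp [localCoord, brPt]

lemma hasDerivAt_localCoord_true {p : ℂ} (hp : p ∈ Complex.slitPlane) :
    HasDerivAt (localCoord true) (-p⁻¹) p := (Complex.hasDerivAt_log hp).neg

lemma localPt_localCoord (s : Bool) {p : ℂ} (hp : s = true → p ≠ 0) :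
    localPt s (localCoord s p) = p := by
  cases s
  · rfl
  · simp [localPt, localCoord, Complex.exp_log (hp rfl)]

/-- The integrand in the local coordinate. -/
def localIntegrand (s : Bool) (y : ℂ → ℂ) (g m : ℕ) (p₁ : ℂ) (z : Fin m → ℂ) (t : ℂ) : ℂ :=
  kernelNum s t p₁ * ((if s then 1 else 2) * (localWt s t * kernelDen s y (localPt s t)))⁻¹ *
    normBracket s y g m t z * if s then 1 else 2 ^ (2 * g + m - 1)

lemma localIntegrand_eq (s : Bool) (y : ℂ → ℂ) {g m : ℕ} (hgm : 1 ≤ g ∨ 2 ≤ m) (p₁ : ℂ)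
    (z : Fin m → ℂ) (t : ℂ) :
    localIntegrand s y g m p₁ z t = (if s then -localPt s t else 1) *
      ((crv s y).kernel (brPt s) p₁ (localPt s t) *
        (crv s y).bracket (brPt s) g m (localPt s t) z) := by
  rw [kernel_eq, σ_localPt]
  simp only [localIntegrand, kernelNum, normBracket]
  cases s
  · have h1 : 2 * g + m - 1 = 2 * g + m - 2 + 1 := by omega
    have h2 : (2 : ℂ) ^ (2 * g + m - 2) ≠ 0 := pow_ne_zero _ two_ne_zero
    simp only [Bool.false_eq_true, if_false, h1, pow_succ, localWt, one_mul, div_eq_mul_inv,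
      mul_inv]
    generalize (2 : ℂ) ^ (2 * g + m - 2) = w at h2
    generalize (p₁ - localPt false (-t))⁻¹ = A
    generalize (p₁ - localPt false t)⁻¹ = B
    generalize (kernelDen false y (localPt false t))⁻¹ = D
    field_simp
  · have h0 : localPt true t ≠ 0 := Complex.exp_ne_zero _
    have h1 : localWt true t = localPt true t := rfl
    simp only [if_true, h1, one_mul, mul_one, div_eq_mul_inv, mul_inv]
    generalize (p₁ - localPt true (-t))⁻¹ = A
    generalize (p₁ - localPt true t)⁻¹ = B
    generalize (kernelDen true y (localPt true t))⁻¹ = D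
    field_simp

/-- The family that the recursion produces from the expansion coefficients `κ` of the reciprocal of
the kernel denominator and `q` of the bracket, where the poles of these have orders `2` and `W`. The
coefficient of `t^j` in the kernel numerator, `j` odd, is `ξ_{j - 1} / j!`, of degree `j - 1`, so
that the coefficient of `t^{W + 1}`, the residue, has degree `W`. -/
def stepFam {m : ℕ} (W : ℕ) (κ : ℕ → Scal) (q : ℕ → Fam (Fin m)) : Fam (Fin (m + 1)) :=
  ∑ jr ∈ Finset.HasAntidiagonal.antidiagonal (W + 1),
    ∑ ik ∈ Finset.HasAntidiagonal.antidiagonal jr.2,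
      if Odd jr.1 then consMul (jr.1 - 1) (scalMul (MvPolynomial.C (1 / (jr.1.factorial : ℚ)))
        (scalMul (κ ik.1) (q ik.2))) else 0

lemma stepFam_mem {m W : ℕ} {κ : ℕ → Scal} {q : ℕ → Fam (Fin m)}
    (hκ : ∀ i, MvPolynomial.IsWeightedHomogeneous scalDeg (κ i) i)
    (hq : ∀ j, q j ∈ homFam (Fin m) j) : stepFam W κ q ∈ homFam (Fin (m + 1)) W := by
  refine sum_mem fun jr hjr => sum_mem fun ik hik => ?_
  have h1 := Finset.HasAntidiagonal.mem_antidiagonal.mp hjr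
  have h2 := Finset.HasAntidiagonal.mem_antidiagonal.mp hik
  split_ifs with h
  · have h3 := consMul_mem (jr.1 - 1) (scalMul_mem
      (MvPolynomial.isWeightedHomogeneous_C scalDeg (1 / (jr.1.factorial : ℚ)))
        (scalMul_mem (hκ ik.1) (hq ik.2)))
    have h4 := h.pos
    have h5 : jr.1 - 1 + (0 + (ik.1 + ik.2)) = W := by omega
    rwa [h5] at h3
  · exact zero_mem _

/-- The residue at the branch point `brPt s` will be `c (W + 1)`. -/
lemma residue_step {g m : ℕ} {W : ℕ} (s : Bool) {y : ℂ → ℂ} {Z : ℕ → ℂ}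
    {κ : ℕ → Scal} {q : ℕ → Fam (Fin m)}
    (hκ : HasExp (fun t => t ^ 2 *
      ((if s then 1 else 2) * (localWt s t * kernelDen s y (localPt s t)))⁻¹)
      (fun i => scalEval s Z (κ i)))
    {p₁ : ℂ} (hp₁ : Regular s p₁) {z : Fin m → ℂ}
    (hq : HasExp (fun t => t ^ W * normBracket s y g m t z) (fun j => q j s Z z)) :
    ∃ c : ℕ → ℂ, HasExp (fun t => t ^ (W + 2) * localIntegrand s y g m p₁ z t) c ∧
      c (W + 1) = stepFam W κ q s Z (Fin.cons p₁ z : Fin (m + 1) → ℂ) *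
        if s then 1 else 2 ^ (2 * g + m - 1) := by
  have h := ((hasExp_kernelNum s hp₁).mul (hκ.mul hq)).const_mul
    (if s then 1 else 2 ^ (2 * g + m - 1))
  refine ⟨_, h.congr (Eventually.of_forall fun t => ?_), ?_⟩
  · simp only [localIntegrand, pow_add]; ring
  · simp only [stepFam, Finset.sum_apply]
    rw [mul_comm]
    congr 1
    refine Finset.sum_congr rfl fun jr _ => ?_
    rw [Finset.mul_sum]
    refine Finset.sum_congr rfl fun ik _ => ?_
    by_cases hj : Odd jr.1
    · simp only [hj, if_true, consMul, scalMul, AddMonoidHom.coe_mk, ZeroHom.coe_mk, Fin.cons_zero,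
        Fin.tail_cons]
      simp only [scalEval, MvPolynomial.aeval_C]
      simp
      ring
    · simp [hj]

/-- The residue at the branch point `brPt s`. -/
lemma residue_brPt {g m : ℕ} (hgm : 1 ≤ g ∨ 2 ≤ m) (N : ℕ) (s : Bool) (y : ℂ → ℂ) (p₁ : ℂ)
    (z : Fin m → ℂ) {c : ℕ → ℂ}
    (hc : HasExp (fun t => t ^ (N + 1) * localIntegrand s y g m p₁ z t) c) :
    residue (fun p => (crv s y).kernel (brPt s) p₁ p * (crv s y).bracket (brPt s) g m p z)
      (brPt s) = c N := by
  refine residue_eq_coeff hc N (analyticAt_localCoord s) (localCoord_brPt s) ?_ ?_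
  · cases s
    · have : deriv (localCoord false) (brPt false) = 1 := (hasDerivAt_id _).deriv
      rw [this]; exact one_ne_zero
    · rw [(hasDerivAt_localCoord_true (by simp [brPt])).deriv]
      simp [brPt]
  · cases s
    · refine Eventually.of_forall fun p => ?_
      have : deriv (localCoord false) p = 1 := (hasDerivAt_id _).deriv
      rw [localIntegrand_eq _ _ hgm, localPt_localCoord _ (by simp), this]
      simp
    · have h1 : ∀ᶠ p in 𝓝 (1 : ℂ), p ∈ Complex.slitPlane :=
        Complex.isOpen_slitPlane.mem_nhds (by simp)
      filter_upwards [nhdsWithin_le_nhds h1] with p hp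
      have hp0 : p ≠ 0 := Complex.slitPlane_ne_zero hp
      rw [localIntegrand_eq _ _ hgm, localPt_localCoord _ (fun _ => hp0),
        (hasDerivAt_localCoord_true hp).deriv]
      simp only [if_true]
      field_simp

/-- The residue at the branch point `-1` of `x = z + 1/z`, by the symmetry `z ↦ -z`. -/
lemma residue_neg_one {y : ℂ → ℂ} {Z : ℕ → ℂ} (hv : Valid true y Z) {g m : ℕ}
    (hgm : 1 ≤ g ∨ 2 ≤ m)
    (ih : ∀ g' m', 2 * g' + m' < 2 * g + m → ¬ (g' = 0 ∧ m' = 0) → IsLocallyHomogeneous g' m')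
    (N : ℕ) (p₁ : ℂ) (z : Fin m → ℂ) (hz : ∀ i, Regular true (z i)) {c : ℕ → ℂ}
    (hc : HasExp (fun t => t ^ (N + 1) * localIntegrand true y g m (-p₁) (-z) t) c) :
    residue (fun p => (crv true y).kernel (-1) p₁ p * (crv true y).bracket (-1) g m p z) (-1) =
      (-1) ^ (m + 1) * c N := by
  have hneg : Tendsto (fun p : ℂ => -p) (𝓝 (-1)) (𝓝 1) := by
    simpa using (continuous_neg (G := ℂ)).tendsto (-1)
  have hneg' : Tendsto (fun p : ℂ => -p) (𝓝[≠] (-1)) (𝓝[≠] 1) := by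
    refine tendsto_nhdsWithin_of_tendsto_nhds_of_eventually_within _
      (hneg.mono_left nhdsWithin_le_nhds) ?_
    filter_upwards [self_mem_nhdsWithin] with p hp h1
    refine hp ?_
    rw [← neg_neg p]
    simpa using congrArg Neg.neg h1
  have hslit : ∀ᶠ p in 𝓝 (1 : ℂ), p ∈ Complex.slitPlane :=
    Complex.isOpen_slitPlane.mem_nhds (by simp)
  have hder : ∀ p : ℂ, -p ∈ Complex.slitPlane →
      HasDerivAt (fun p => localCoord true (-p)) (-p⁻¹) p := by
    intro p hp
    refine ((hasDerivAt_localCoord_true hp).comp p (hasDerivAt_neg p)).congr_deriv ?_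
    rw [inv_neg]; ring
  refine residue_eq_coeff (τ := fun p => localCoord true (-p)) (hc.const_mul ((-1) ^ (m + 1))) N
    ?_ ?_ ?_ ?_
  · have h1 : AnalyticAt ℂ (localCoord true) (-(-1)) := by
      rw [neg_neg]; exact analyticAt_localCoord true
    exact h1.comp (f := fun p : ℂ => -p) analyticAt_id.neg
  · simp only [neg_neg]; exact localCoord_brPt true
  · rw [(hder (-1) (by simp)).deriv]; norm_num
  · have hreg : ∀ᶠ p in 𝓝[≠] (1 : ℂ), Regular true p := by
      filter_upwards [self_mem_nhdsWithin,
        nhdsWithin_le_nhds (isOpen_ne.mem_nhds (by norm_num : (1 : ℂ) ≠ -1))] with p h1 h2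
      exact ⟨h1, h2⟩
    filter_upwards [hneg'.eventually hreg, nhdsWithin_le_nhds (hneg.eventually hslit),
      nhdsWithin_le_nhds (hneg.eventually (kernel_neg hv p₁))] with p h1 h2 h3
    have hp0 : -p ≠ 0 := Complex.slitPlane_ne_zero h2
    have hp0' : p ≠ 0 := neg_ne_zero.mp hp0
    have h4 := crv_bracket_neg y hv ih h1 z hz
    rw [neg_neg] at h3 h4
    rw [h3, h4, (hder p h2).deriv, localIntegrand_eq _ _ hgm, localPt_localCoord _ (fun _ => hp0)]
    simp only [if_true, brPt, pow_succ]
    field_simp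

/-- In terms of the number `n = m + 1` of points: `ω_{g,n}` is homogeneous of degree
`6g - 6 + 2n`, for `2g - 2 + n > 0`. -/
lemma isHomogeneousCorr (g m : ℕ) (hgm : 1 ≤ g ∨ 2 ≤ m) : IsHomogeneousCorr g m := by
  induction h : 2 * g + m using Nat.strong_induction_on generalizing g m with
  | _ n ih =>
    subst h
    have ih1 : ∀ g' m', 2 * g' + m' < 2 * g + m → (1 ≤ g' ∨ 2 ≤ m') → IsHomogeneousCorr g' m' :=
      fun g' m' h1 h2 => ih _ h1 g' m' h2 rfl
    have ih2 := isLocallyHomogeneous_of_lt ih1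
    obtain ⟨κ, hκ, hκe⟩ := exists_kernelDen_expansion
    obtain ⟨q, hq, hqe⟩ := hasLocalRep_normBracket hgm ih1
    refine ⟨stepFam _ κ q, stepFam_mem hκ hq, fun s y Z hv p z hp hz => ?_⟩
    rw [normCorr, SpectralCurve.corr_eq _ (by omega) (by omega)]
    obtain ⟨c, hc, hcv⟩ := residue_step s (hκe s y Z hv) hp (hqe s y Z hv z hz)
    have h1 := residue_brPt hgm _ s y p z hc
    rw [hcv] at h1
    cases s
    · have hbr : (crv false y).branch = {0} := rfl
      rw [hbr, Finset.sum_singleton]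
      change residue _ (brPt false) / _ = _
      simp only [brPt] at h1 ⊢
      rw [h1]
      simp only [Bool.false_eq_true, if_false, symm]
      field_simp
    · have hbr : (crv true y).branch = {1, -1} := rfl
      rw [hbr, Finset.sum_pair (by norm_num)]
      obtain ⟨c', hc', hcv'⟩ := residue_step true (hκe true y Z hv) hp.neg
        (hqe true y Z hv (-z) fun i => (hz i).neg)
      have h2 := residue_neg_one hv hgm ih2 _ p z hz hc'
      rw [hcv'] at h2
      simp only [brPt] at h1
      rw [h1, h2]
      have h3 : (Fin.cons (-p) (-z) : Fin (m + 1) → ℂ) = -(Fin.cons p z : Fin (m + 1) → ℂ) := by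
        funext i
        cases i using Fin.cases <;> simp
      simp [symm, h3]

/-! ### Okuyama's curve -/

/-- `q^m / (1 - q^m)²` at `m = k + 1`, the numbers of which the `ζ_q(2k)` are the power sums. -/
def qWeight (q : ℂ) (k : ℕ) : ℂ := q ^ (k + 1) / (1 - q ^ (k + 1)) ^ 2

lemma qZetaEven_eq (q : ℂ) (k : ℕ) : qZetaEven q k = ∑' m, qWeight q m ^ k := by
  refine tsum_congr fun m => ?_
  rw [qWeight, div_pow, ← pow_mul, ← pow_mul]

lemma one_sub_pow_ne_zero {q : ℂ} (hq : ‖q‖ < 1) (k : ℕ) : 1 - q ^ (k + 1) ≠ 0 := by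
  intro h
  have h1 : ‖q ^ (k + 1)‖ = 1 := by rw [← sub_eq_zero.mp h]; simp
  rw [norm_pow] at h1
  exact (pow_lt_one₀ (norm_nonneg q) hq (Nat.succ_ne_zero k)).ne h1

lemma norm_qWeight_le {q : ℂ} (hq : ‖q‖ < 1) (k : ℕ) :
    ‖qWeight q k‖ ≤ ((1 - ‖q‖) ^ 2)⁻¹ * ‖q‖ ^ (k + 1) := by
  have h0 : 0 < 1 - ‖q‖ := by linarith
  have h1 : 1 - ‖q‖ ≤ ‖1 - q ^ (k + 1)‖ := by
    have h2 : ‖q ^ (k + 1)‖ ≤ ‖q‖ := by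
      rw [norm_pow]
      exact pow_le_of_le_one (norm_nonneg q) hq.le (Nat.succ_ne_zero k)
    have h3 := norm_sub_norm_le (1 : ℂ) (q ^ (k + 1))
    rw [norm_one] at h3
    linarith
  rw [qWeight, norm_div, norm_pow, norm_pow, div_eq_inv_mul]
  gcongr

lemma expGrowth_qZetaEven {q : ℂ} (hq : ‖q‖ < 1) : ExpGrowth fun k => qZetaEven q (k + 1) := by
  have h0 : 0 < 1 - ‖q‖ := by linarith
  set A := ((1 - ‖q‖) ^ 2)⁻¹ with hA
  have hA0 : 0 ≤ A := by positivity
  have h1 : 1 ≤ (1 - ‖q‖)⁻¹ := by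
    rw [one_le_inv₀ h0]; linarith [norm_nonneg q]
  refine ⟨A * (1 - ‖q‖)⁻¹, fun k => ?_⟩
  have hg := (hasSum_geometric_of_lt_one (norm_nonneg q) hq).mul_left (A ^ (k + 1))
  simp only [qZetaEven_eq]
  have h2 : ‖∑' m, qWeight q m ^ (k + 1)‖ ≤ A ^ (k + 1) * (1 - ‖q‖)⁻¹ := by
    refine tsum_of_norm_bounded hg fun m => ?_
    rw [norm_pow]
    calc ‖qWeight q m‖ ^ (k + 1) ≤ (A * ‖q‖ ^ (m + 1)) ^ (k + 1) := by
          gcongr; exact norm_qWeight_le hq m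
      _ = A ^ (k + 1) * ‖q‖ ^ ((m + 1) * (k + 1)) := by rw [mul_pow, ← pow_mul]
      _ ≤ A ^ (k + 1) * ‖q‖ ^ m := by
          refine mul_le_mul_of_nonneg_left ?_ (by positivity)
          refine pow_le_pow_of_le_one (norm_nonneg q) hq.le ?_
          nlinarith
  rw [mul_pow]
  refine h2.trans (mul_le_mul_of_nonneg_left ?_ (by positivity))
  exact le_self_pow₀ h1 (Nat.succ_ne_zero k)

/-- The product formula for `expSum`, when the parameters are power sums. -/
lemma tprod_eq_expSum {q : ℂ} (hq : ‖q‖ < 1) : ∀ᶠ w in 𝓝 (0 : ℂ),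
    ∏' k, (1 - qWeight q k * w) = expSum (fun k => qZetaEven q (k + 1)) w := by
  have h0 : 0 < 1 - ‖q‖ := by linarith
  set A := ((1 - ‖q‖) ^ 2)⁻¹ with hA
  have hA0 : 0 ≤ A := by positivity
  have hev : ∀ᶠ w in 𝓝 (0 : ℂ), A * ‖w‖ < 1 / 2 := by
    have : ContinuousAt (fun w : ℂ => A * ‖w‖) 0 := by fun_prop
    exact this.eventually_lt_const (by simp)
  filter_upwards [hev] with w hw
  have hgeo : Summable fun k : ℕ => ‖q‖ ^ (k + 1) :=
    (summable_nat_add_iff 1).mpr (summable_geometric_of_lt_one (norm_nonneg q) hq)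
  have hb : ∀ k, ‖qWeight q k * w‖ ≤ (1 / 2) * ‖q‖ ^ (k + 1) := by
    intro k
    rw [norm_mul]
    have h2 := mul_le_mul_of_nonneg_right (norm_qWeight_le hq k) (norm_nonneg w)
    have h3 := mul_le_mul_of_nonneg_right hw.le (pow_nonneg (norm_nonneg q) (k + 1))
    linarith
  have hlt : ∀ k, ‖qWeight q k * w‖ < 1 := by
    intro k
    have h3 : ‖q‖ ^ (k + 1) ≤ 1 := pow_le_one₀ (norm_nonneg q) hq.le
    linarith [hb k]
  have hne : ∀ k, 1 - qWeight q k * w ≠ 0 := by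
    intro k h
    have h4 := hlt k
    rw [← sub_eq_zero.mp h] at h4
    simp at h4
  have hlog : Summable fun k => Complex.log (1 - qWeight q k * w) := by
    have h5 : Summable fun k => -(qWeight q k * w) :=
      (Summable.of_norm_bounded (hgeo.mul_left (1 / 2)) hb).neg
    simpa [sub_eq_add_neg] using Complex.summable_log_one_add_of_summable h5
  rw [← Complex.cexp_tsum_eq_tprod hne hlog, expSum]
  congr 1
  have h6 : ∀ k, HasSum (fun n : ℕ => (qWeight q k * w) ^ (n + 1) / ((n : ℂ) + 1))
      (-Complex.log (1 - qWeight q k * w)) := by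
    intro k
    have h7 := Complex.hasSum_taylorSeries_neg_log (hlt k)
    rw [← hasSum_nat_add_iff' 1] at h7
    simpa using h7
  have hs : Summable (Function.uncurry fun (k n : ℕ) =>
      (qWeight q k * w) ^ (n + 1) / ((n : ℂ) + 1)) := by
    have hhalf : Summable fun n : ℕ => (1 / 2 : ℝ) ^ n :=
      summable_geometric_of_lt_one (by norm_num) (by norm_num)
    have h8 := Summable.mul_of_nonneg hgeo hhalf (fun k => by positivity) (fun n => by positivity)
    refine Summable.of_norm_bounded h8 fun x => ?_
    obtain ⟨k, n⟩ := x
    simp only [Function.uncurry_apply_pair]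
    rw [norm_div, norm_pow]
    have h9 : 1 ≤ ‖(n : ℂ) + 1‖ := by
      rw [← Nat.cast_add_one, Complex.norm_natCast]
      push_cast
      linarith [(Nat.cast_nonneg n : (0 : ℝ) ≤ n)]
    refine (div_le_self (by positivity) h9).trans ?_
    calc ‖qWeight q k * w‖ ^ (n + 1) ≤ ((1 / 2) * ‖q‖ ^ (k + 1)) ^ (n + 1) := by
          gcongr; exact hb k
      _ = ‖q‖ ^ ((k + 1) * (n + 1)) * (1 / 2) ^ (n + 1) := by rw [mul_pow, ← pow_mul]; ring
      _ ≤ ‖q‖ ^ (k + 1) * (1 / 2) ^ n := by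
          refine mul_le_mul ?_ ?_ (by positivity) (by positivity)
          · exact pow_le_pow_of_le_one (norm_nonneg q) hq.le (Nat.le_mul_of_pos_right _ n.succ_pos)
          · exact pow_le_pow_of_le_one (by norm_num) (by norm_num) n.le_succ
  have h10 : ∑' k, Complex.log (1 - qWeight q k * w) =
      -∑' k, ∑' n : ℕ, (qWeight q k * w) ^ (n + 1) / ((n : ℂ) + 1) := by
    rw [← tsum_neg]
    refine tsum_congr fun k => ?_
    rw [(h6 k).tsum_eq, neg_neg]
  rw [h10, ← hs.tsum_comm]
  congr 1
  refine tsum_congr fun n => ?_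
  rw [qZetaEven_eq, div_mul_eq_mul_div, ← tsum_mul_right, ← tsum_div_const]
  refine tsum_congr fun k => ?_
  rw [mul_pow]

/-- The function `y` of Okuyama's curve. -/
def okuyamaY (q z : ℂ) : ℂ :=
  (1 / 2) * (z - z⁻¹) *
    ∏' k : ℕ, (1 - q ^ (k + 1) * z ^ 2) * (1 - q ^ (k + 1) * (z⁻¹) ^ 2) / (1 - q ^ (k + 1)) ^ 2

lemma valid_okuyama {q : ℂ} (hq : ‖q‖ < 1) :
    Valid true (okuyamaY q) fun k => qZetaEven q (k + 1) := by
  refine ⟨expGrowth_qZetaEven hq, fun χ => ?_⟩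
  have hχ : ((χ : ℤ) : ℂ) ≠ 0 := by
    rcases Int.units_eq_one_or χ with rfl | rfl <;> simp
  have hχ2 : ((χ : ℤ) : ℂ) - ((χ : ℤ) : ℂ)⁻¹ = 0 := by
    rcases Int.units_eq_one_or χ with rfl | rfl <;> norm_num
  have htend : Tendsto (fun z : ℂ => (z - z⁻¹) ^ 2) (𝓝 ((χ : ℤ) : ℂ)) (𝓝 0) := by
    have : ContinuousAt (fun z : ℂ => (z - z⁻¹) ^ 2) ((χ : ℤ) : ℂ) :=
      (continuousAt_id.sub (continuousAt_inv₀ hχ)).pow 2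
    have h := this.tendsto
    simp only [hχ2] at h
    simpa using h
  filter_upwards [htend.eventually (tprod_eq_expSum hq), isOpen_ne.mem_nhds hχ] with z h1 h2
  have hz : z ≠ 0 := h2
  rw [okuyamaY, ← h1]
  congr 1
  refine tprod_congr fun k => ?_
  have h3 := one_sub_pow_ne_zero hq k
  rw [qWeight]
  field_simp
  ring

lemma okuyamaCurve_eq (q : ℂ) : okuyamaCurve q = crv true (okuyamaY q) := rfl

/-- The function `y` of the curve with independent parameters. -/
def genericY (Z : ℕ → ℂ) (z : ℂ) : ℂ :=
  (1 / 2) * (z - z⁻¹) *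
    Complex.exp (-∑' k : ℕ, Z k / ((k : ℂ) + 1) * (z - z⁻¹) ^ (2 * (k + 1)))

lemma valid_generic {Z : ℕ → ℂ} (hZ : ExpGrowth Z) : Valid true (genericY Z) Z := by
  refine ⟨hZ, fun χ => Eventually.of_forall fun z => ?_⟩
  simp only [genericY, expSum, pow_mul]

lemma genericOkuyamaCurve_eq (Z : ℕ → ℂ) : genericOkuyamaCurve Z = crv true (genericY Z) := rfl

/-- The function `y` of `S^top`. -/
def topY (q z : ℂ) : ℂ :=
  z * Complex.exp (-∑' m : ℕ, qZetaEven q (m + 1) / ((m : ℂ) + 1) * (4 * z ^ 2) ^ (m + 1))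

lemma valid_top {q : ℂ} (hq : ‖q‖ < 1) : Valid false (topY q) fun k => qZetaEven q (k + 1) :=
  ⟨expGrowth_qZetaEven hq, Eventually.of_forall fun _ => rfl⟩

lemma topCurve_eq (q : ℂ) : topCurve q = crv false (topY q) := rfl

/-! ### Laplace transforms of polynomials -/

/-- `ℒ` on polynomials, as a polynomial in the `z_i⁻¹`: `∏ x_i^{d_i} ↦ ∏ d_i! z_i^{-(d_i + 1)}`. -/
def laplacePoly (n : ℕ) : MvPolynomial (Fin n) ℂ →ₗ[ℂ] MvPolynomial (Fin n) ℂ :=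
  (MvPolynomial.basisMonomials (Fin n) ℂ).constr ℂ fun d =>
    MvPolynomial.monomial (d + Finsupp.equivFunOnFinite.symm 1) (∏ i, ((d i).factorial : ℂ))

/-- The mixed derivative of the Laplace transform, up to the sign `(-1)^n`:
`∏ x_i^{d_i} ↦ ∏ (d_i + 1)! z_i^{-(d_i + 2)}`. -/
def laplaceDeriv {n : ℕ} (z : Fin n → ℂ) : MvPolynomial (Fin n) ℂ →ₗ[ℂ] ℂ :=
  (MvPolynomial.basisMonomials (Fin n) ℂ).constr ℂ fun d =>
    ∏ i, (((d i + 1).factorial : ℂ) / z i ^ (d i + 2))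

lemma laplacePoly_monomial {n : ℕ} (d : Fin n →₀ ℕ) (c : ℂ) :
    laplacePoly n (MvPolynomial.monomial d c) =
      MvPolynomial.monomial (d + Finsupp.equivFunOnFinite.symm 1)
        (c * ∏ i, ((d i).factorial : ℂ)) := by
  have h : MvPolynomial.monomial d c = c • MvPolynomial.basisMonomials (Fin n) ℂ d := by
    rw [MvPolynomial.coe_basisMonomials, MvPolynomial.smul_monomial, smul_eq_mul, mul_one]
  rw [h, map_smul, laplacePoly, Module.Basis.constr_basis, MvPolynomial.smul_monomial, smul_eq_mul]

lemma laplaceDeriv_monomial {n : ℕ} (z : Fin n → ℂ) (d : Fin n →₀ ℕ) (c : ℂ) :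
    laplaceDeriv z (MvPolynomial.monomial d c) =
      c * ∏ i, (((d i + 1).factorial : ℂ) / z i ^ (d i + 2)) := by
  have h : MvPolynomial.monomial d c = c • MvPolynomial.basisMonomials (Fin n) ℂ d := by
    rw [MvPolynomial.coe_basisMonomials, MvPolynomial.smul_monomial, smul_eq_mul, mul_one]
  rw [h, map_smul, laplaceDeriv, Module.Basis.constr_basis, smul_eq_mul]

lemma integrableOn_pow_mul_exp_neg {z : ℂ} (hz : 0 < z.re) (d : ℕ) :
    IntegrableOn (fun t : ℝ => (t : ℂ) ^ d * Complex.exp (-(z * t))) (Set.Ioi 0) := by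
  have h := integrableOn_rpow_mul_exp_neg_mul_rpow (p := 1) (s := d)
    (by have : (0 : ℝ) ≤ d := d.cast_nonneg
        linarith) one_pos hz
  refine Integrable.mono' h (by fun_prop) ?_
  refine (ae_restrict_mem measurableSet_Ioi).mono fun t ht => ?_
  have ht0 : (0 : ℝ) < t := ht
  rw [norm_mul, norm_pow, Complex.norm_real, Complex.norm_exp, Real.norm_of_nonneg ht0.le]
  simp

lemma tendsto_pow_mul_exp_neg {z : ℂ} (hz : 0 < z.re) (d : ℕ) :
    Tendsto (fun t : ℝ => (t : ℂ) ^ d * Complex.exp (-(z * t))) atTop (𝓝 0) := by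
  rw [tendsto_zero_iff_norm_tendsto_zero]
  refine (tendsto_rpow_mul_exp_neg_mul_atTop_nhds_zero d z.re hz).congr' ?_
  filter_upwards [eventually_gt_atTop 0] with t ht0
  rw [norm_mul, norm_pow, Complex.norm_real, Complex.norm_exp, Real.norm_of_nonneg ht0.le]
  simp

lemma integral_pow_mul_exp_neg {z : ℂ} (hz : 0 < z.re) (d : ℕ) :
    ∫ t in Set.Ioi (0 : ℝ), (t : ℂ) ^ d * Complex.exp (-(z * t)) =
      (d.factorial : ℂ) * z⁻¹ ^ (d + 1) := by
  have hz0 : z ≠ 0 := by rintro rfl; simp at hz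
  have hexp : ∀ t : ℝ, HasDerivAt (fun t : ℝ => Complex.exp (-(z * t)))
      (-z * Complex.exp (-(z * t))) t := by
    intro t
    have h1 : HasDerivAt (fun t : ℝ => -(z * (t : ℂ))) (-(z * 1)) t :=
      ((Complex.ofRealCLM.hasDerivAt (x := t)).const_mul z).neg
    have h2 := h1.cexp
    convert h2 using 1
    ring
  induction d with
  | zero =>
    have h := integral_Ioi_of_hasDerivAt_of_tendsto' (a := (0 : ℝ)) (m := 0)
      (fun t _ => hexp t)
      (by have := (integrableOn_pow_mul_exp_neg hz 0).const_mul (-z)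
          simpa [IntegrableOn] using this)
      (by simpa using tendsto_pow_mul_exp_neg hz 0)
    rw [integral_const_mul] at h
    simp only [pow_zero, one_mul, Nat.factorial_zero, Nat.cast_one, zero_add, pow_one]
    field_simp
    simp at h
    linear_combination h
  | succ d ih =>
    have hderiv : ∀ t ∈ Set.Ici (0 : ℝ),
        HasDerivAt (fun t : ℝ => (t : ℂ) ^ (d + 1) * Complex.exp (-(z * t)))
          (((d : ℂ) + 1) * ((t : ℂ) ^ d * Complex.exp (-(z * t))) +
            -z * ((t : ℂ) ^ (d + 1) * Complex.exp (-(z * t)))) t := by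
      intro t _
      have h1 : HasDerivAt (fun t : ℝ => (t : ℂ) ^ (d + 1)) (((d : ℂ) + 1) * (t : ℂ) ^ d) t := by
        simpa using (hasDerivAt_pow (d + 1) (t : ℂ)).comp_ofReal
      refine (h1.mul (hexp t)).congr_deriv ?_
      ring
    have hi1 := (integrableOn_pow_mul_exp_neg hz d).const_mul ((d : ℂ) + 1)
    have hi2 := (integrableOn_pow_mul_exp_neg hz (d + 1)).const_mul (-z)
    have h := integral_Ioi_of_hasDerivAt_of_tendsto' (a := (0 : ℝ)) (m := 0) hderiv
      (hi1.add hi2) (tendsto_pow_mul_exp_neg hz (d + 1))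
    rw [integral_add hi1 hi2, integral_const_mul, integral_const_mul, ih] at h
    rw [Nat.factorial_succ]
    push_cast
    have h3 : z * ∫ t in Set.Ioi (0 : ℝ), (t : ℂ) ^ (d + 1) * Complex.exp (-(z * t)) =
        ((d : ℂ) + 1) * ((d.factorial : ℂ) * z⁻¹ ^ (d + 1)) := by
      simp at h
      linear_combination -h
    rw [pow_succ z⁻¹ (d + 1), ← mul_right_inj' hz0, h3]
    field_simp

lemma laplace_eval {n : ℕ} (p : MvPolynomial (Fin n) ℂ) {z : Fin n → ℂ}
    (hz : ∀ i, 0 < (z i).re) :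
    laplace (fun x => MvPolynomial.eval (fun i => (x i : ℂ)) p) z =
      MvPolynomial.eval (fun i => (z i)⁻¹) (laplacePoly n p) := by
  -- integrability is carried along for the additivity of the integral
  suffices h : IntegrableOn (fun x : Fin n → ℝ => MvPolynomial.eval (fun i => (x i : ℂ)) p *
      ∏ i, Complex.exp (-(z i * x i))) (Set.univ.pi fun _ => Set.Ioi 0) ∧
      laplace (fun x => MvPolynomial.eval (fun i => (x i : ℂ)) p) z =
        MvPolynomial.eval (fun i => (z i)⁻¹) (laplacePoly n p) from h.2
  induction p using MvPolynomial.induction_on' with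
  | monomial d c =>
    have heq : ∀ x : Fin n → ℝ, MvPolynomial.eval (fun i => (x i : ℂ)) (MvPolynomial.monomial d c) *
        ∏ i, Complex.exp (-(z i * x i)) =
          c * ∏ i, ((x i : ℂ) ^ d i * Complex.exp (-(z i * x i))) := by
      intro x
      rw [MvPolynomial.eval_monomial, Finsupp.prod_fintype _ _ fun i => pow_zero _,
        Finset.prod_mul_distrib, mul_assoc]
    have hmeas : (volume : Measure (Fin n → ℝ)).restrict (Set.univ.pi fun _ => Set.Ioi 0) =
        Measure.pi fun _ => (volume : Measure ℝ).restrict (Set.Ioi 0) := by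
      rw [volume_pi, Measure.restrict_pi_pi]
    simp only [laplace, IntegrableOn, heq, hmeas]
    constructor
    · exact (Integrable.fintype_prod fun i => integrableOn_pow_mul_exp_neg (hz i) (d i)).const_mul c
    · rw [integral_const_mul]
      rw [integral_fintype_prod_eq_prod (f := fun i (t : ℝ) =>
        (t : ℂ) ^ d i * Complex.exp (-(z i * t)))]
      simp only [integral_pow_mul_exp_neg (hz _)]
      rw [laplacePoly_monomial, MvPolynomial.eval_monomial,
        Finsupp.prod_fintype _ _ fun i => pow_zero _, Finset.prod_mul_distrib, mul_assoc]
      simp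
  | add p q hp hq =>
    have heq : ∀ x : Fin n → ℝ, MvPolynomial.eval (fun i => (x i : ℂ)) (p + q) *
        ∏ i, Complex.exp (-(z i * x i)) =
        MvPolynomial.eval (fun i => (x i : ℂ)) p * ∏ i, Complex.exp (-(z i * x i)) +
        MvPolynomial.eval (fun i => (x i : ℂ)) q * ∏ i, Complex.exp (-(z i * x i)) := by
      intro x; rw [map_add, add_mul]
    rw [map_add, map_add, ← hp.2, ← hq.2]
    simp only [laplace, heq]
    exact ⟨hp.1.add hq.1, integral_add hp.1 hq.1⟩

/-- `∂/∂z_i` in the coordinates `z_j⁻¹`. -/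
def invDeriv {n : ℕ} (i : Fin n) : MvPolynomial (Fin n) ℂ →ₗ[ℂ] MvPolynomial (Fin n) ℂ :=
  -(LinearMap.mulLeft ℂ (MvPolynomial.X i ^ 2)) ∘ₗ (MvPolynomial.pderiv i).toLinearMap

lemma hasDerivAt_eval_inv {n : ℕ} (G : MvPolynomial (Fin n) ℂ) (i : Fin n) {z : Fin n → ℂ}
    (hz : z i ≠ 0) :
    HasDerivAt (fun w => MvPolynomial.eval (fun j => (Function.update z i w j)⁻¹) G)
      (MvPolynomial.eval (fun j => (z j)⁻¹) (invDeriv i G)) (z i) := by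
  induction G using MvPolynomial.induction_on with
  | C c => simpa [invDeriv] using hasDerivAt_const (z i) c
  | add p q hp hq => simp only [map_add]; exact hp.add hq
  | mul_X p j hp =>
    have hX : HasDerivAt (fun w => (Function.update z i w j)⁻¹)
        (MvPolynomial.eval (fun j => (z j)⁻¹) (invDeriv i (MvPolynomial.X j))) (z i) := by
      rcases eq_or_ne j i with rfl | hj
      · simpa [invDeriv] using hasDerivAt_inv hz
      · simpa [invDeriv, Function.update_of_ne hj, hj] using
          hasDerivAt_const (z i) (z j)⁻¹
    have h := hp.mul hX
    simp only [Function.update_eq_self] at h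
    simp only [map_mul, MvPolynomial.eval_X]
    refine h.congr_deriv ?_
    simp [invDeriv]
    ring

lemma foldr_partialDeriv_eval_inv {n : ℕ} (G : MvPolynomial (Fin n) ℂ) (l : List (Fin n))
    (z : Fin n → ℂ) (hz : ∀ i, z i ≠ 0) :
    l.foldr partialDeriv (fun w => MvPolynomial.eval (fun i => (w i)⁻¹) G) z =
      MvPolynomial.eval (fun i => (z i)⁻¹) (l.foldr (fun i H => invDeriv i H) G) := by
  induction l generalizing z with
  | nil => rfl
  | cons i l ih =>
    rw [List.foldr_cons, List.foldr_cons, partialDeriv]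
    refine Eq.trans ?_ (hasDerivAt_eval_inv _ i (hz i)).deriv
    refine EventuallyEq.deriv_eq ?_
    filter_upwards [isOpen_ne.mem_nhds (hz i)] with w hw
    refine ih _ fun j => ?_
    rcases eq_or_ne j i with rfl | hj
    · simpa using hw
    · simpa [hj] using hz j

lemma invDeriv_monomial {n : ℕ} (i : Fin n) (d : Fin n →₀ ℕ) (c : ℂ) (hd : d i ≠ 0) :
    invDeriv i (MvPolynomial.monomial d c) =
      MvPolynomial.monomial (d + Finsupp.single i 1) (c * -(d i : ℂ)) := by
  simp only [invDeriv, LinearMap.neg_apply, LinearMap.comp_apply, LinearMap.mulLeft_apply,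
    Derivation.coeFn_coe, MvPolynomial.pderiv_monomial, MvPolynomial.X_pow_eq_monomial,
    MvPolynomial.monomial_mul]
  rw [← map_neg]
  congr 1
  · congr 1
    ext j
    rcases eq_or_ne j i with rfl | hj
    · simp; omega
    · simp [hj]
  · ring

lemma foldr_invDeriv_monomial {n : ℕ} (l : List (Fin n)) (hl : l.Nodup) (d : Fin n →₀ ℕ) (c : ℂ)
    (hd : ∀ i, d i ≠ 0) :
    l.foldr (fun i H => invDeriv i H) (MvPolynomial.monomial d c) =
      MvPolynomial.monomial (d + (l.map fun i => Finsupp.single i 1).sum)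
        (c * (l.map fun i => -(d i : ℂ)).prod) := by
  induction l with
  | nil => simp
  | cons i l ih =>
    obtain ⟨hi, hl'⟩ := List.nodup_cons.mp hl
    have hsum : ((l.map fun i => Finsupp.single i 1).sum : Fin n →₀ ℕ) i = 0 := by
      clear ih hl hl'
      induction l with
      | nil => simp
      | cons j l ih =>
        simp only [List.mem_cons, not_or] at hi
        rw [List.map_cons, List.sum_cons, Finsupp.add_apply, ih hi.2,
          Finsupp.single_eq_of_ne hi.1]
    have hdi : (d + (l.map fun i => Finsupp.single i 1).sum : Fin n →₀ ℕ) i = d i := by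
      rw [Finsupp.add_apply, hsum, add_zero]
    rw [List.foldr_cons, ih hl', invDeriv_monomial _ _ _ (by rw [hdi]; exact hd i), hdi,
      List.map_cons, List.map_cons, List.sum_cons, List.prod_cons]
    congr 1
    · congr 1; abel
    · ring

lemma mixedPartial_eval_inv {n : ℕ} (p : MvPolynomial (Fin n) ℂ) {z : Fin n → ℂ}
    (hz : ∀ i, z i ≠ 0) :
    mixedPartial (fun w => MvPolynomial.eval (fun i => (w i)⁻¹) (laplacePoly n p)) z =
      (-1) ^ n * laplaceDeriv z p := by
  rw [mixedPartial, foldr_partialDeriv_eval_inv _ _ _ hz]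
  induction p using MvPolynomial.induction_on' with
  | monomial d c =>
    rw [laplacePoly_monomial, foldr_invDeriv_monomial _ (List.nodup_finRange n) _ _ (by simp),
      laplaceDeriv_monomial, MvPolynomial.eval_monomial,
      Finsupp.prod_fintype _ _ fun i => pow_zero _]
    have h1 : ((List.finRange n).map fun i => (Finsupp.single i 1 : Fin n →₀ ℕ)).sum =
        Finsupp.equivFunOnFinite.symm 1 := by
      rw [← List.ofFn_eq_map, List.sum_ofFn]
      ext j
      simp [Finsupp.finsetSum_apply, Finsupp.single_apply]
    rw [h1, ← List.ofFn_eq_map, List.prod_ofFn, Finset.prod_neg]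
    simp only [Finset.card_univ, Fintype.card_fin, Finsupp.add_apply,
      Finsupp.equivFunOnFinite_symm_apply_apply, Pi.one_apply, div_eq_mul_inv]
    simp only [Nat.factorial_succ, Nat.cast_mul, Finset.prod_mul_distrib, inv_pow,
      Finset.prod_inv_distrib, add_assoc, Nat.reduceAdd]
    ring
  | add p q hp hq =>
    have hfold : ∀ (l : List (Fin n)) (P Q : MvPolynomial (Fin n) ℂ),
        l.foldr (fun i H => invDeriv i H) (P + Q) =
          l.foldr (fun i H => invDeriv i H) P + l.foldr (fun i H => invDeriv i H) Q := by
      intro l P Q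
      induction l with
      | nil => rfl
      | cons i l ih => simp only [List.foldr_cons, ih, map_add]
    rw [map_add, hfold, map_add, hp, hq, map_add, mul_add]

/-! ### Discrete volumes -/

lemma summable_mul_complex {ι κ : Type*} {f : ι → ℂ} {g : κ → ℂ}
    (hf : Summable f) (hg : Summable g) :
    Summable fun x : ι × κ => f x.1 * g x.2 := by
  have h1 : Summable fun i => ‖f i‖ := hf.norm
  have h2 : Summable fun i => ‖g i‖ := hg.norm
  exact summable_mul_of_summable_norm h1 h2

lemma hasSum_prod {n : ℕ} {f : Fin n → ℕ → ℂ} {a : Fin n → ℂ} (h : ∀ i, HasSum (f i) (a i)) :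
    HasSum (fun b : Fin n → ℕ => ∏ i, f i (b i)) (∏ i, a i) := by
  induction n with
  | zero => simp
  | succ n ih =>
    have h1 := ih fun i => h i.succ
    have h2 := summable_mul_complex (h 0).summable h1.summable
    have h3 := HasSum.mul (h 0) h1 h2
    rw [Fin.prod_univ_succ]
    refine ((Fin.consEquiv fun _ : Fin (n + 1) => ℕ).hasSum_iff).mp ?_
    refine HasSum.of_congr (fun x => ?_) h3
    simp only [Function.comp_apply, Fin.consEquiv_apply, Fin.prod_univ_succ, Fin.cons_zero,
      Fin.cons_succ]

/-- `P` has degree at most `d`, and `N` is its homogeneous part of degree `d`. -/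
def HasTop {n : ℕ} (d : ℕ) (P N : VolRing n) : Prop :=
  (∀ m ∈ P.support, Finsupp.weight (volDeg n) m ≤ d) ∧
    MvPolynomial.weightedHomogeneousComponent (volDeg n) d P = N

namespace HasTop

variable {n d : ℕ} {P P' N N' : VolRing n}

lemma zero : HasTop d (0 : VolRing n) 0 := ⟨by simp, map_zero _⟩

lemma add (h : HasTop d P N) (h' : HasTop d P' N') : HasTop d (P + P') (N + N') := by
  refine ⟨fun m hm => ?_, by rw [map_add, h.2, h'.2]⟩
  rcases Finset.mem_union.mp (MvPolynomial.support_add hm) with hm | hm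
  · exact h.1 m hm
  · exact h'.1 m hm

lemma neg (h : HasTop d P N) : HasTop d (-P) (-N) := by
  refine ⟨fun m hm => h.1 m ?_, by rw [map_neg, h.2]⟩
  rwa [MvPolynomial.support_neg] at hm

lemma C_mul (c : ℚ) (h : HasTop d P N) :
    HasTop d (MvPolynomial.C c * P) (MvPolynomial.C c * N) := by
  refine ⟨fun m hm => h.1 m ?_, by
    rw [MvPolynomial.weightedHomogeneousComponent_C_mul, h.2]⟩
  rw [MvPolynomial.mem_support_iff, MvPolynomial.coeff_C_mul] at hm
  exact MvPolynomial.mem_support_iff.mpr (right_ne_zero_of_mul hm)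

lemma sum {ι : Type*} (s : Finset ι) {P N : ι → VolRing n} (h : ∀ i ∈ s, HasTop d (P i) (N i)) :
    HasTop d (∑ i ∈ s, P i) (∑ i ∈ s, N i) := by
  classical
  induction s using Finset.induction_on with
  | empty => exact zero
  | insert i s hi ih =>
    rw [Finset.sum_insert hi, Finset.sum_insert hi]
    exact (h i (Finset.mem_insert_self i s)).add
      (ih fun j hj => h j (Finset.mem_insert_of_mem hj))

lemma monomial {m : ℕ ⊕ Fin n →₀ ℕ} (hm : Finsupp.weight (volDeg n) m ≤ d) (c : ℚ) :
    HasTop d (MvPolynomial.monomial m c)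
      (if Finsupp.weight (volDeg n) m = d then MvPolynomial.monomial m c else 0) := by
  refine ⟨fun m' hm' => ?_, ?_⟩
  · rw [Finset.mem_singleton.mp (MvPolynomial.support_monomial_subset hm')]
    exact hm
  · have h := MvPolynomial.isWeightedHomogeneous_monomial (volDeg n) m c rfl
    split_ifs with hd
    · rw [← hd]; exact h.weightedHomogeneousComponent_same
    · exact h.weightedHomogeneousComponent_ne _ (Ne.symm hd)

end HasTop

/-- A polynomial in the parameters, with the homogenizing variable evaluated at `s`. -/
def dehomog (n : ℕ) (s : ℚ) : Scal →ₐ[ℚ] VolRing n :=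
  MvPolynomial.aeval fun o => o.elim (MvPolynomial.C s) fun k => MvPolynomial.X (Sum.inl k)

lemma dehomog_monomial (n : ℕ) (s : ℚ) (d : Option ℕ →₀ ℕ) (c : ℚ) :
    dehomog n s (MvPolynomial.monomial d c) =
      MvPolynomial.monomial (d.some.mapDomain Sum.inl) (s ^ d none * c) := by
  rw [dehomog, MvPolynomial.aeval_monomial, Finsupp.prod_option_index _ _ (fun o => pow_zero _)
    fun o m₁ m₂ => pow_add _ _ _, MvPolynomial.monomial_eq, Finsupp.prod_mapDomain_index
    (fun o => pow_zero _) fun o m₁ m₂ => pow_add _ _ _, MvPolynomial.algebraMap_eq]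
  simp only [Option.elim, map_mul, map_pow]
  ring

lemma weight_mapDomain_inl (n : ℕ) (d : ℕ →₀ ℕ) :
    Finsupp.weight (volDeg n) (d.mapDomain Sum.inl) = d.sum fun k m => m * (2 * (k + 1)) := by
  rw [Finsupp.weight_apply, Finsupp.sum_mapDomain_index (h := fun i c => c • volDeg n i)
    (fun _ => zero_smul ..) fun _ _ _ => add_smul ..]
  rfl

/-- Evaluating the homogenizing variable at `0` instead of `1` selects the top degree part. -/
lemma hasTop_dehomog {n k : ℕ} {φ : Scal}
    (hφ : MvPolynomial.IsWeightedHomogeneous scalDeg φ k) (e : Fin n → ℕ) :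
    HasTop (k + ∑ i, e i) (dehomog n 1 φ * ∏ i, MvPolynomial.X (Sum.inr i) ^ e i)
      (dehomog n 0 φ * ∏ i, MvPolynomial.X (Sum.inr i) ^ e i) := by
  have hX : ∏ i, (MvPolynomial.X (Sum.inr i) : VolRing n) ^ e i =
      MvPolynomial.monomial (∑ i, Finsupp.single (Sum.inr i) (e i)) 1 := by
    rw [MvPolynomial.monomial_sum_one]
    exact Finset.prod_congr rfl fun i _ => MvPolynomial.X_pow_eq_monomial
  have hw : Finsupp.weight (volDeg n) (∑ i, Finsupp.single (Sum.inr i) (e i)) = ∑ i, e i := by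
    rw [map_sum]
    refine Finset.sum_congr rfl fun i _ => ?_
    simp [Finsupp.weight_apply, volDeg]
  rw [hX, MvPolynomial.as_sum φ, map_sum, map_sum, Finset.sum_mul, Finset.sum_mul]
  refine HasTop.sum _ fun d hd => ?_
  have hk : d none + d.some.sum (fun j m => m * (2 * (j + 1))) = k := by
    have h := hφ (MvPolynomial.mem_support_iff.mp hd)
    rw [Finsupp.weight_apply, Finsupp.sum_option_index_smul] at h
    simpa [scalDeg] using h
  rw [dehomog_monomial, dehomog_monomial, MvPolynomial.monomial_mul, MvPolynomial.monomial_mul]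
  have hwt : Finsupp.weight (volDeg n) (d.some.mapDomain Sum.inl +
      ∑ i, Finsupp.single (Sum.inr i) (e i)) + d none = k + ∑ i, e i := by
    rw [map_add, weight_mapDomain_inl, hw]; omega
  have h := HasTop.monomial (n := n) (d := k + ∑ i, e i) (m := d.some.mapDomain Sum.inl +
      ∑ i, Finsupp.single (Sum.inr i) (e i)) (by omega) (MvPolynomial.coeff d φ)
  rw [one_pow, one_mul, mul_one, mul_one]
  convert h using 1
  rcases Nat.eq_zero_or_pos (d none) with h0 | h0
  · rw [if_pos (by omega), h0, pow_zero, one_mul]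
  · rw [if_neg (by omega), zero_pow h0.ne', zero_mul, map_zero]

lemma evalVol_dehomog_one {n : ℕ} (φ : Scal) (Z : ℕ → ℂ) (b : Fin n → ℂ) :
    evalVol (dehomog n 1 φ) Z b = scalEval true Z φ := by
  have : (MvPolynomial.aeval (Sum.elim Z b)).comp (dehomog n 1) = scalEval true Z := by
    refine MvPolynomial.algHom_ext fun o => ?_
    cases o <;> simp [scalEval, dehomog]
  exact DFunLike.congr_fun this φ

/-- Evaluation of the zeta variables, keeping the `b_i` as variables. -/
def specialize {n : ℕ} (Z : ℕ → ℂ) : VolRing n →ₐ[ℚ] MvPolynomial (Fin n) ℂ :=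
  MvPolynomial.aeval (Sum.elim (fun k => MvPolynomial.C (Z k)) MvPolynomial.X)

lemma eval_specialize {n : ℕ} (N : VolRing n) (Z : ℕ → ℂ) (b : Fin n → ℂ) :
    MvPolynomial.eval b (specialize Z N) = evalVol N Z b := by
  have : ((MvPolynomial.aeval b : MvPolynomial (Fin n) ℂ →ₐ[ℂ] ℂ).restrictScalars ℚ).comp
      (specialize Z) = MvPolynomial.aeval (Sum.elim Z b) := by
    refine MvPolynomial.algHom_ext fun o => ?_
    cases o <;> simp [specialize]
  have h := DFunLike.congr_fun this N
  rw [evalVol, ← h]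
  simp [MvPolynomial.aeval_eq_eval]

lemma specialize_dehomog_zero {n : ℕ} (φ : Scal) (Z : ℕ → ℂ) :
    specialize Z (dehomog n 0 φ) = MvPolynomial.C (scalEval false Z φ) := by
  have : (specialize Z).comp (dehomog n 0) =
      ((Algebra.ofId ℂ (MvPolynomial (Fin n) ℂ)).restrictScalars ℚ).comp (scalEval false Z) := by
    refine MvPolynomial.algHom_ext fun o => ?_
    cases o <;> simp [scalEval, dehomog, specialize, Algebra.ofId_apply]
  exact DFunLike.congr_fun this φ

lemma dehomog_zero_eq_zero {n : ℕ} {φ : Scal} (h : topSymbol φ = 0) : dehomog n 0 φ = 0 := by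
  have : (MvPolynomial.rename Sum.inl).comp topSymbol = dehomog n 0 := by
    refine MvPolynomial.algHom_ext fun o => ?_
    cases o <;> simp [topSymbol, dehomog]
  rw [← this, AlgHom.comp_apply, h, map_zero]

/-- The expansion coefficients of `F` for the curve `x = z + 1/z` are given by the polynomials
`P ε` of degree at most `d`, with common top degree part `N` for `∑ ε` even, and the value of `F`
for the curve `x = z² / 2` is, up to a factor, the mixed derivative of the Laplace transform of `N`.
The factor `2` is the number of branch points of `x = z + 1/z`. -/
structure IsQuasiPoly {n : ℕ} (d : ℕ) (F : Fam (Fin n)) (P : (Fin n → ZMod 2) → VolRing n)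
    (N : VolRing n) : Prop where
  top : ∀ ε, (∑ i, ε i) = 0 → HasTop d (P ε) N
  odd : ∀ ε, (∑ i, ε i) ≠ 0 → P ε = 0
  hasSum : ∀ Z z, (∀ i, ‖z i‖ < 1) → HasSum (fun b : Fin n → ℕ =>
    evalQuasi P Z (fun i => b i + 1) * ∏ i, (((b i : ℂ) + 1) * z i ^ b i)) (symm F true Z z)
  laplace : ∀ Z z, laplaceDeriv z (specialize Z N) = 2 * F false Z z

lemma sign_pow_val (χ : ℤˣ) (b : ℕ) : χ ^ ((b : ℕ) : ZMod 2).val = χ ^ b := by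
  rw [ZMod.val_natCast, ← Int.units_pow_eq_pow_mod_two]

lemma isQuasiPoly_gen {m d : ℕ} {φ : Scal} {a : Fin (m + 1) → ℤˣ × ℕ} (h : IsGen d φ a) :
    IsQuasiPoly d (gen φ a)
      (fun ε => if ∑ i, ε i = 0 then MvPolynomial.C (2 * ∏ i, (((a i).1 : ℤ) : ℚ) ^ (ε i).val) *
        (dehomog (m + 1) 1 φ * ∏ i, MvPolynomial.X (Sum.inr i) ^ (a i).2) else 0)
      (MvPolynomial.C 2 *
        (dehomog (m + 1) 0 φ * ∏ i, MvPolynomial.X (Sum.inr i) ^ (a i).2)) where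
  top ε hε := by
    obtain ⟨⟨k, hφ, rfl⟩, h2⟩ := h
    simp only [hε, if_true]
    have h3 := (hasTop_dehomog hφ fun i => (a i).2).C_mul (2 * ∏ i, (((a i).1 : ℤ) : ℚ) ^ (ε i).val)
    rcases h2 with h2 | h2
    · simpa [h2] using h3
    · simpa [dehomog_zero_eq_zero h2] using h3
  odd ε hε := if_neg hε
  hasSum Z z hz := by
    rw [symm_gen h]
    have h1 := (hasSum_prod fun i => hasSum_basisFn (a i) (hz i)).mul_left (scalEval true Z φ)
    have h2 := (hasSum_prod fun i => hasSum_basisFn (-(a i).1, (a i).2) (hz i)).mul_left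
      (scalEval true Z φ)
    refine HasSum.of_congr (fun b => ?_) (h1.add h2)
    -- the coefficients of the two branch points differ by the sign `(-1) ^ ∑ i, (b i + 1)`
    have hsign : ∏ i, ((((-(a i).1 : ℤˣ) : ℤ) : ℂ) ^ (b i + 1)) =
        (-1) ^ (∑ i, (b i + 1)) * ∏ i, ((((a i).1 : ℤ) : ℂ) ^ (b i + 1)) := by
      rw [← Finset.prod_pow_eq_pow_sum, ← Finset.prod_mul_distrib]
      refine Finset.prod_congr rfl fun i _ => ?_
      rw [← mul_pow]
      push_cast
      ring
    simp only [Finset.prod_mul_distrib, hsign, evalQuasi]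
    have hpar : (∑ i, (((b i + 1 : ℕ) : ℕ) : ZMod 2)) = 0 ↔ Even (∑ i, (b i + 1)) := by
      rw [← Nat.cast_sum, ZMod.natCast_eq_zero_iff_even]
    by_cases he : Even (∑ i, (b i + 1))
    · rw [if_pos (hpar.mpr he), he.neg_one_pow]
      have hval : ∀ i, (((a i).1 : ℤ) : ℂ) ^ (((b i + 1 : ℕ) : ℕ) : ZMod 2).val =
          (((a i).1 : ℤ) : ℂ) ^ (b i + 1) := by
        intro i
        exact_mod_cast congrArg (fun u : ℤˣ => ((u : ℤ) : ℂ)) (sign_pow_val (a i).1 (b i + 1))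
      simp only [Nat.cast_add, Nat.cast_one] at hval
      have hev : evalVol (MvPolynomial.C
          (2 * ∏ i, (((a i).1 : ℤ) : ℚ) ^ (((b i + 1 : ℕ) : ℕ) : ZMod 2).val) *
          (dehomog (m + 1) 1 φ * ∏ i, MvPolynomial.X (Sum.inr i) ^ (a i).2)) Z
            (fun i => ((b i + 1 : ℕ) : ℂ)) =
          2 * (∏ i, (((a i).1 : ℤ) : ℂ) ^ (b i + 1)) *
            (scalEval true Z φ * ∏ i, ((b i : ℂ) + 1) ^ (a i).2) := by
        rw [← evalVol_dehomog_one φ Z fun i => ((b i + 1 : ℕ) : ℂ)]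
        simp only [evalVol, map_mul, map_prod, map_pow, MvPolynomial.aeval_X, Sum.elim_inr,
          map_ofNat, map_intCast, hval, Nat.cast_add, Nat.cast_one]
      rw [hev]
      simp only [pow_succ, Finset.prod_mul_distrib]
      ring
    · rw [if_neg fun h => he (hpar.mp h), (Nat.not_even_iff_odd.mp he).neg_one_pow]
      simp [evalVol]
  laplace Z z := by
    have hX : ∏ i, (MvPolynomial.X i : MvPolynomial (Fin (m + 1)) ℂ) ^ (a i).2 =
        MvPolynomial.monomial (Finsupp.equivFunOnFinite.symm fun i => (a i).2) 1 := by
      rw [MvPolynomial.monomial_eq, Finsupp.prod_fintype _ _ fun i => pow_zero _]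
      simp
    have hsp : specialize Z (MvPolynomial.C 2 *
        (dehomog (m + 1) 0 φ * ∏ i, MvPolynomial.X (Sum.inr i) ^ (a i).2)) =
        MvPolynomial.monomial (Finsupp.equivFunOnFinite.symm fun i => (a i).2)
          (2 * scalEval false Z φ) := by
      rw [map_mul, map_mul, specialize_dehomog_zero, map_prod]
      have hXs : ∀ i : Fin (m + 1), specialize Z (MvPolynomial.X (Sum.inr i) ^ (a i).2) =
          MvPolynomial.X i ^ (a i).2 := by
        intro i; simp [specialize]
      simp only [hXs, hX]
      rw [map_ofNat, map_ofNat, ← mul_assoc, ← map_ofNat (MvPolynomial.C (R := ℂ)) 2, ← map_mul,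
        MvPolynomial.C_mul_monomial, mul_one]
    rw [hsp, laplaceDeriv_monomial, gen, mul_assoc]
    congr 1
    rcases h.2 with h2 | h2
    · simp [basisFn, h2]
    · rw [scalEval_false_eq_zero h2, zero_mul, zero_mul]

lemma exists_isQuasiPoly {m d : ℕ} {F : Fam (Fin (m + 1))} (hF : F ∈ homFam (Fin (m + 1)) d) :
    ∃ P N, IsQuasiPoly d F P N := by
  refine homFam_induction (p := fun F => ∃ P N, IsQuasiPoly d F P N)
    (fun φ a h => ⟨_, _, isQuasiPoly_gen h⟩) ⟨0, 0, ?_⟩ ?_ ?_ hF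
  · exact ⟨fun _ _ => HasTop.zero, fun _ _ => rfl,
      fun Z z _ => by simp [symm_zero, evalQuasi, evalVol],
      fun Z z => by simp⟩
  · rintro F G ⟨P, N, h⟩ ⟨P', N', h'⟩
    refine ⟨P + P', N + N', fun ε hε => (h.top ε hε).add (h'.top ε hε),
      fun ε hε => by simp [h.odd ε hε, h'.odd ε hε], fun Z z hz => ?_, fun Z z => ?_⟩
    · rw [symm_add]
      refine HasSum.of_congr (fun b => ?_) ((h.hasSum Z z hz).add (h'.hasSum Z z hz))
      simp only [evalQuasi, evalVol, Pi.add_apply, map_add, add_mul]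
    · rw [map_add, map_add, h.laplace, h'.laplace, Pi.add_apply, Pi.add_apply, Pi.add_apply,
        mul_add]
  · rintro F ⟨P, N, h⟩
    refine ⟨-P, -N, fun ε hε => (h.top ε hε).neg,
      fun ε hε => by simp [h.odd ε hε], fun Z z hz => ?_, fun Z z => ?_⟩
    · rw [symm_neg]
      refine HasSum.of_congr (fun b => ?_) (h.hasSum Z z hz).neg
      simp only [evalQuasi, evalVol, Pi.neg_apply, map_neg, neg_mul]
    · rw [map_neg, map_neg, h.laplace, Pi.neg_apply, Pi.neg_apply, Pi.neg_apply, mul_neg]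

/-- The family `F` computes the discrete volumes for every admissible `y`. -/
lemma isDiscreteVolume_crv {g m d : ℕ} {F : Fam (Fin (m + 1))} {P : (Fin (m + 1) → ZMod 2) →
    VolRing (m + 1)} {N : VolRing (m + 1)} (hP : IsQuasiPoly d F P N)
    (hF : ∀ s y Z, Valid s y Z → ∀ p z, Regular s p → (∀ i, Regular s (z i)) →
      normCorr s y g m p z = symm F s Z (Fin.cons p z))
    {y : ℂ → ℂ} {Z : ℕ → ℂ} (hv : Valid true y Z) :
    IsDiscreteVolume (crv true y) g (m + 1) (evalQuasi P Z) := by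
  have hball : ∀ᶠ z in 𝓝 (0 : Fin (m + 1) → ℂ), ∀ i, ‖z i‖ < 1 := by
    refine eventually_all.mpr fun i => ?_
    have : ContinuousAt (fun z : Fin (m + 1) → ℂ => ‖z i‖) 0 :=
      (continuous_apply i).norm.continuousAt
    exact this.eventually_lt_const (by simp)
  filter_upwards [hball] with z hz
  have hreg : ∀ i, Regular true (z i) := by
    intro i
    constructor <;> intro h <;> have := hz i <;> simp [h] at this
  have h1 := hF true y Z hv (z 0) (Fin.tail z) (hreg 0) fun i => hreg i.succ
  rw [Fin.cons_self_tail, normCorr, if_pos rfl, div_one] at h1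
  rw [SpectralCurve.omega, h1]
  exact hP.hasSum Z z hz

end TopRec

end

theorem lemma4p1 (g n : ℕ) (hn : 1 ≤ n) (hgn : 3 ≤ 2 * g + n) :
    ∃ P : (Fin n → ZMod 2) → TopRec.VolRing n,
      TopRec.IsOkuyamaVolume g n P ∧
      (∀ ε, MvPolynomial.weightedTotalDegree (TopRec.volDeg n) (P ε) ≤ 6 * g + 2 * n - 6) ∧
      (∀ ε, (∑ i, ε i) ≠ 0 → P ε = 0) ∧
      ∃ Ntop : TopRec.VolRing n,
        (∀ ε, (∑ i, ε i) = 0 → TopRec.topPart g (P ε) = Ntop) ∧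
        ∀ q : ℂ, ‖q‖ < 1 →
          ∃ F : MvPolynomial (Fin n) ℂ,
            (∀ z : Fin n → ℂ, (∀ i, 0 < (z i).re) →
              TopRec.laplace
                (fun x => TopRec.evalVol Ntop (fun k => TopRec.qZetaEven q (k + 1))
                  (fun i => (x i : ℂ))) z
                = MvPolynomial.eval (fun i => (z i)⁻¹) F) ∧
            ∀ z : Fin n → ℂ, (∀ i, z i ≠ 0) →
              (TopRec.topCurve q).omega g n z =
                (-1) ^ n * (2 : ℂ) ^ (2 * (g : ℤ) - 3 + (n : ℤ)) *
                  TopRec.mixedPartial (fun w => MvPolynomial.eval (fun i => (w i)⁻¹) F) z := by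
  obtain ⟨m, rfl⟩ : ∃ m, n = m + 1 := ⟨n - 1, by omega⟩
  obtain ⟨F, hFv, hF⟩ := TopRec.isHomogeneousCorr g m (by omega)
  obtain ⟨P, N, hP⟩ := TopRec.exists_isQuasiPoly hFv
  have hd : 6 * g + 2 * (m + 1) - 6 = 6 * g + 2 * m - 4 := by omega
  refine ⟨P, ⟨fun q hq => ?_, fun Z hZ => ?_⟩, fun ε => ?_, hP.odd, N, fun ε hε => ?_,
    fun q hq => ⟨TopRec.laplacePoly (m + 1)
      (TopRec.specialize (fun k => TopRec.qZetaEven q (k + 1)) N), fun z hz => ?_, fun z hz => ?_⟩⟩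
  · rw [TopRec.okuyamaCurve_eq]
    exact TopRec.isDiscreteVolume_crv hP hF (TopRec.valid_okuyama hq)
  · rw [TopRec.genericOkuyamaCurve_eq]
    exact TopRec.isDiscreteVolume_crv hP hF (TopRec.valid_generic hZ)
  · rw [hd]
    by_cases hε : ∑ i, ε i = 0
    · exact Finset.sup_le (hP.top ε hε).1
    · rw [hP.odd ε hε, MvPolynomial.weightedTotalDegree_zero]
      exact Nat.zero_le _
  · rw [TopRec.topPart, hd]
    exact (hP.top ε hε).2
  · simp only [← TopRec.eval_specialize]
    exact TopRec.laplace_eval _ hz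
  · have h1 := hF false _ _ (TopRec.valid_top hq) (z 0) (Fin.tail z) (hz 0) fun i => hz i.succ
    rw [Fin.cons_self_tail, TopRec.normCorr, if_neg Bool.false_ne_true,
      div_eq_iff (pow_ne_zero _ two_ne_zero), TopRec.symm] at h1
    rw [TopRec.mixedPartial_eval_inv _ hz, hP.laplace, TopRec.topCurve_eq,
      TopRec.SpectralCurve.omega, h1]
    -- one factor `2` of the normalization is the number of branch points of `x = z + 1/z`
    have h2 : (2 : ℂ) ^ (2 * (g : ℤ) - 3 + ((m + 1 : ℕ) : ℤ)) * 2 = 2 ^ (2 * g + m - 1) := by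
      rw [← zpow_add_one₀ two_ne_zero, ← zpow_natCast]
      congr 1
      omega
    have h3 : ((-1 : ℂ) ^ (m + 1)) * (-1) ^ (m + 1) = 1 := by rw [← mul_pow]; norm_num
    linear_combination -F false (fun k => TopRec.qZetaEven q (k + 1)) z * h2 -
      2 * (2 : ℂ) ^ (2 * (g : ℤ) - 3 + ((m + 1 : ℕ) : ℤ)) *
        F false (fun k => TopRec.qZetaEven q (k + 1)) z * h3
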